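/- **Setting.** Let $T>0$, $\rho^1,\rho^2>0$, $\sigma,g\ge 0$. A *solution of the periodic two-fluid system on $[0,T]$* consists of a $C^4$ map $z:\mathbb R\times[0,T]\to\mathbb R^2$, regions $\Omega^1(t),\Omega^2(t)\subseteq\mathbb R^2$, velocities $u^j$ and pressures $P^j$ such that the following holds for every $t\in[0,T]$ and $j\in\{1,2\}$. - $z(\cdot,t)$ is injective and $z(\alpha+2\pi,t)=z(\alpha,t)+(2\pi,0)$. With $\Gamma_t=\{z(\alpha,t):\alpha\in\mathbb R\}$, the plane is the disjoint union $\Omega^1(t)\cup\Omega^2(t)\cup\Gamma_t$; each $\Omega^j(t)$ is open, connected, simply connected, invariant under translation by $(2\pi,0)$, and $\partial\Omega^j(t)=\Gamma_t$. For some $a\ge1$ independent of $t$, $\mathbb R\times(-\infty,-a]\subseteq\Omega^1(t)$ and $\mathbb R\times[a,\infty)\subseteq\Omega^2(t)$. - $u^j(t)\in C^3(\overline{\Omega^j(t)})$, $u^j$ is $C^1$ in $(x,t)$ on $\{(x,t):t\in[0,T],\,x\in\overline{\Omega^j(t)}\}$, and $P^j(t)\in C^1(\overline{\Omega^j(t)})$.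 In $\Omega^j(t)$, $\rho^j(\partial_tu^j+[u^j\cdot\nabla]u^j)=-\nabla P^j-g\rho^je_2$ with $e_2=(0,1)$, $\operatorname{div}u^j=0$, $\operatorname{curl}u^j=0$, and $u^j(x+(2\pi,0),t)=u^j(x,t)$. Moreover $u^j(t)\in L^2(\Omega^j(t)\cap[0,2\pi]\times\mathbb R)$. - On $\Gamma_t$, $(\partial_tz-u^j)\cdot(\partial_\alpha z)^\perp=0$ for $j=1,2$, and $P^2-P^1=-\sigma\,\dfrac{\partial_\alpha z_1\partial_\alpha^2z_2-\partial_\alpha z_2\partial_\alpha^2z_1}{|\partial_\alpha z|^3}$. Here $u^j(z(\alpha,t),t)$ is the boundary value from $\overline{\Omega^j(t)}$. Let $F(z)(\alpha,\beta,t)=\frac{|z(\alpha,t)-z(\beta,t)|}{|\alpha-\beta|}$ if $\alpha\ne\beta$, and $F(z)(\alpha,\alpha,t)=|z_\alpha(\alpha,t)|$. The solution is *bounded by $A>0$* if $$\|z(\alpha,t)-(\alpha,0)\|_{C^4(\mathbb R\times[0,T])}\le A,\qquad \inf_{\alpha,t}|z_\alpha(\alpha,t)|\ge A^{-1},\qquad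 \|u^1(z(\alpha,t),t)\|_{C^3(\mathbb R\times[0,T])}\le A,$$ $$\inf_{\alpha,\beta}F(z)(\alpha,\beta,0)\ge A^{-1},\qquad \sup_\alpha|u^2(z(\alpha,0),0)|\le A.$$ For $\varepsilon_1>0$, $(\alpha_1,\alpha_2)$ is a *conjugate pair at time $t$* if $|\alpha_1-\alpha_2|\in[2\varepsilon_1,\varepsilon_1^{-1}/2]$ and $$|z(\alpha_1,t)-z(\alpha_2,t)|=\inf_{|\alpha-\beta|\in[\varepsilon_1,\varepsilon_1^{-1}]}|z(\alpha,t)-z(\beta,t)|.$$ **Proposition 2.5.** Let $A>0$. For every sufficiently small $\varepsilon_1>0$ (depending only on $A$) there is $C>0$, depending only on $A$ and $\varepsilon_1$, such that for every $\varepsilon_2>0$ and $T>0$ there are $\varepsilon_4,\varepsilon_5\in(0,\varepsilon_2)$ with $\varepsilon_4\le\varepsilon_5^{100}$, depending only on $A,\varepsilon_1,\varepsilon_2,T$, with the following property. For all $\rho^1,\rho^2>0$, $\sigma,g\ge0$, every solution on $[0,T]$ bounded by $A$, and every $t\in[0,T]$ with $\varepsilon:=\inf_{\alpha,\beta\in\mathbb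 R}F(z)(\alpha,\beta,t)\le\varepsilon_4$, a conjugate pair at time $t$ exists, and for every conjugate pair $(\alpha_1,\alpha_2)$, setting $d:=|z(\alpha_2,t)-z(\alpha_1,t)|$ and $e:=d^{-1}(z(\alpha_2,t)-z(\alpha_1,t))$: (i) The open segment between $z(\alpha_1,t)$ and $z(\alpha_2,t)$ lies in $\Omega^2(t)$; $z_\alpha(\alpha_1,t)\cdot e=z_\alpha(\alpha_2,t)\cdot e=0$ and $z_\alpha(\alpha_1,t)\cdot z_\alpha(\alpha_2,t)<0$; $d>0$ and $C^{-1}\varepsilon\le d\le C\varepsilon$; and $$\{z(\beta,t)-\rho e:|\beta-\alpha_1|\le\varepsilon_5,\ \rho\in(0,\varepsilon_5)\}\cup\{z(\beta,t)+\rho e:|\beta-\alpha_2|\le\varepsilon_5,\ \rho\in(0,\varepsilon_5)\}\subseteq\Omega^1(t),$$ $$\{z(\beta,t)+\rho e:|\beta-\alpha_1|\le\varepsilon_5,\ \rho\in(0,d)\}\cup\{z(\beta,t)-\rho e:|\beta-\alpha_2|\le\varepsilon_5,\ \rho\in(0,d)\}\subseteq\Omega^2(t).$$ (ii) Let $R:\mathbb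 R^2\to\mathbb R^2$ be a rigid motion (affine isometry) with $R(0,0)=\frac{z(\alpha_1,t)+z(\alpha_2,t)}2$, $R(0,-d/2)=z(\alpha_1,t)$, $R(0,d/2)=z(\alpha_2,t)$, and let $I=(-\varepsilon_5^4,\varepsilon_5^4)$. There are functions $f_1,f_2,\beta_1,\beta_2:I\to(-\varepsilon_5^2,\varepsilon_5^2)$ of class $C^4$ such that, for all $\rho\in I$, $$R(\rho,f_1(\rho))=z(\alpha_1+\beta_1(\rho),t),\qquad R(\rho,f_2(\rho))=z(\alpha_2+\beta_2(\rho),t);$$ $f_1(0)=-d/2$, $f_2(0)=d/2$, $\beta_1(0)=\beta_2(0)=0$, $f_1'(0)=f_2'(0)=0$; the $C^4(I)$ norms of $f_1,f_2,\beta_1,\beta_2$ are at most $C$; and $C^{-1}\le-\beta_1'(\rho)\beta_2'(\rho)\le C$ and $f_2(\rho)-f_1(\rho)\ge d$ for all $\rho\in I$. Finally, for every $\rho\in I$: $R(\rho,y)\in\Omega^1(t)$ if $y\in(f_2(\rho),\varepsilon_5^2)$ or $y\in(-\varepsilon_5^2,f_1(\rho))$, and $R(\rho,y)\in\Omega^2(t)$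 if $y\in(f_1(\rho),f_2(\rho))$. (A $C^n$ norm is the supremum of the norms of all derivatives of order at most $n$.) -/

import Mathlib

open Set

noncomputable section

/-- The Euclidean plane. -/
abbrev Plane : Type := EuclideanSpace ℝ (Fin 2)

/-- Counterclockwise rotation by a right angle, `(x₁, x₂)^⊥ = (-x₂, x₁)`. -/
def perp (v : Plane) : Plane := !₂[-(v 1), v 0]

/-- The unit vertical vector. -/
def e₂ : Plane := !₂[0, 1]

/-- The horizontal translation by `2π`. -/
def Tr₂ (x : Plane) : Plane := !₂[x 0 + 2 * Real.pi, x 1]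

/-- `g` is of class `C^n` on `S` and all its derivatives of order `0, …, n` are bounded by `B` there,
i.e. `‖g‖_{C^n(S)} ≤ B`. -/
def CkNormLE {E F : Type*} [NormedAddCommGroup E] [NormedSpace ℝ E]
    [NormedAddCommGroup F] [NormedSpace ℝ F] (n : ℕ) (g : E → F) (S : Set E) (B : ℝ) : Prop :=
  ContDiffOn ℝ n g S ∧ ∀ k ≤ n, ∀ x ∈ S, ‖iteratedFDerivWithin ℝ k g S x‖ ≤ B

/-- `∂ₖ wₘ (x)` for a planar vector field `w`. -/
def partialComp (w : Plane → Plane) (k m : Fin 2) (x : Plane) : ℝ :=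
  (fderiv ℝ w x (EuclideanSpace.single k 1)) m

/-- The divergence of a planar vector field. -/
def div (w : Plane → Plane) (x : Plane) : ℝ := partialComp w 0 0 x + partialComp w 1 1 x

/-- The (scalar) curl of a planar vector field. -/
def curl (w : Plane → Plane) (x : Plane) : ℝ := partialComp w 0 1 x - partialComp w 1 0 x

/-- The interface `Γ_t = {z(α,t) : α ∈ ℝ}`. -/
def interface (z : ℝ → ℝ → Plane) (t : ℝ) : Set Plane := range fun α => z α t

/-- `z_α(α,t)`. -/
def zα (z : ℝ → ℝ → Plane) (α t : ℝ) : Plane := deriv (fun a => z a t) α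

/-- `z_αα(α,t)`. -/
def zαα (z : ℝ → ℝ → Plane) (α t : ℝ) : Plane := deriv (fun a => zα z a t) α

/-- `z_t(α,t)`, one-sided at the ends of the time interval `[0,T]`. -/
def zt (T : ℝ) (z : ℝ → ℝ → Plane) (α t : ℝ) : Plane :=
  derivWithin (fun s => z α s) (Icc 0 T) t

/-- The curvature `K(z)` of the interface. -/
def curvature (z : ℝ → ℝ → Plane) (α t : ℝ) : ℝ :=
  (zα z α t 0 * zαα z α t 1 - zα z α t 1 * zαα z α t 0) / ‖zα z α t‖ ^ 3

/-- The chord-arc function `F(z)(α,β,t)`. -/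
def chordArc (z : ℝ → ℝ → Plane) (α β t : ℝ) : ℝ :=
  if α = β then ‖zα z α t‖ else ‖z α t - z β t‖ / |α - β|

/-- `inf_{α,β ∈ ℝ} F(z)(α,β,t)`. -/
def chordArcInf (z : ℝ → ℝ → Plane) (t : ℝ) : ℝ := ⨅ p : ℝ × ℝ, chordArc z p.1 p.2 t

/-- `inf { |z(α,t) - z(β,t)| : |α - β| ∈ [ε₁, ε₁⁻¹] }`. -/
def restrictedDist (z : ℝ → ℝ → Plane) (ε₁ t : ℝ) : ℝ :=
  sInf {r : ℝ | ∃ α β : ℝ, |α - β| ∈ Icc ε₁ ε₁⁻¹ ∧ r = ‖z α t - z β t‖}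

/-- `z(α₁,t), z(α₂,t)` is a conjugate (distance-minimizing) pair at scale `ε₁`. -/
def IsConjugatePair (z : ℝ → ℝ → Plane) (ε₁ t α₁ α₂ : ℝ) : Prop :=
  |α₁ - α₂| ∈ Icc (2 * ε₁) (ε₁⁻¹ / 2) ∧ ‖z α₁ t - z α₂ t‖ = restrictedDist z ε₁ t

/-- On the time interval `[0,T]`, the region `Ω(t)`, bounded by the interface, is filled with an
incompressible irrotational fluid of density `ρ`, velocity `u` and pressure `P`, which obeys the Euler
equation with gravity `g`, does not cross the interface, is `2π`-periodic in the horizontal variable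
and is square integrable over a period. -/
structure IsFluidPhase (ρ g T : ℝ) (z : ℝ → ℝ → Plane) (Ω : ℝ → Set Plane)
    (u : ℝ → Plane → Plane) (P : ℝ → Plane → ℝ) : Prop where
  isOpen : ∀ t ∈ Icc 0 T, IsOpen (Ω t)
  isConnected : ∀ t ∈ Icc 0 T, IsConnected (Ω t)
  isSimplyConnected : ∀ t ∈ Icc 0 T, IsSimplyConnected (Ω t)
  frontier_eq : ∀ t ∈ Icc 0 T, frontier (Ω t) = interface z t
  image_Tr₂ : ∀ t ∈ Icc 0 T, Tr₂ '' Ω t = Ω t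
  /-- smoothness of the velocity and of the pressure, up to the boundary -/
  velocity_space : ∀ t ∈ Icc 0 T, ContDiffOn ℝ 3 (u t) (closure (Ω t))
  velocity_spacetime :
    ContDiffOn ℝ 1 (fun p : ℝ × Plane => u p.1 p.2) {p | p.1 ∈ Icc 0 T ∧ p.2 ∈ closure (Ω p.1)}
  pressure_space : ∀ t ∈ Icc 0 T, ContDiffOn ℝ 1 (P t) (closure (Ω t))
  /-- the Euler equation -/
  euler : ∀ t ∈ Icc 0 T, ∀ x ∈ Ω t,
    ρ • (derivWithin (fun s => u s x) (Icc 0 T) t + fderiv ℝ (u t) x (u t x))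
      = -gradient (P t) x - (g * ρ) • e₂
  div_eq_zero : ∀ t ∈ Icc 0 T, ∀ x ∈ Ω t, div (u t) x = 0
  curl_eq_zero : ∀ t ∈ Icc 0 T, ∀ x ∈ Ω t, curl (u t) x = 0
  /-- the interface moves with the fluid -/
  kinematic : ∀ t ∈ Icc 0 T, ∀ α : ℝ,
    inner ℝ (zt T z α t - u t (z α t)) (perp (zα z α t)) = 0
  velocity_periodic : ∀ t ∈ Icc 0 T, ∀ x ∈ Ω t, u t (Tr₂ x) = u t x
  velocity_L2 : ∀ t ∈ Icc 0 T,
    MeasureTheory.MemLp (u t) 2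
      (MeasureTheory.volume.restrict (Ω t ∩ {x | x 0 ∈ Icc 0 (2 * Real.pi)}))

/-- The unknowns of the two-fluid interface problem: the parametrization of the interface, the two
fluid regions, the velocities and the pressures. -/
structure TwoFluid where
  z : ℝ → ℝ → Plane
  Ω₁ : ℝ → Set Plane
  Ω₂ : ℝ → Set Plane
  u₁ : ℝ → Plane → Plane
  u₂ : ℝ → Plane → Plane
  P₁ : ℝ → Plane → ℝ
  P₂ : ℝ → Plane → ℝ

/-- `S` is a (classical, irrotational) solution of the periodic two-fluid system on `[0,T]`, with
densities `ρ₁, ρ₂`, surface tension `σ` and gravity `g`; fluid 1 is the lower one. -/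
structure TwoFluid.IsSolution (S : TwoFluid) (ρ₁ ρ₂ σ g T : ℝ) : Prop where
  contDiff_z : ContDiffOn ℝ 4 (fun p : ℝ × ℝ => S.z p.1 p.2) (univ ×ˢ Icc 0 T)
  injective_z : ∀ t ∈ Icc 0 T, Function.Injective fun α => S.z α t
  periodic_z : ∀ t ∈ Icc 0 T, ∀ α : ℝ, S.z (α + 2 * Real.pi) t = Tr₂ (S.z α t)
  union_eq : ∀ t ∈ Icc 0 T, S.Ω₁ t ∪ S.Ω₂ t ∪ interface S.z t = univ
  disjoint_regions : ∀ t ∈ Icc 0 T, Disjoint (S.Ω₁ t) (S.Ω₂ t)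
  disjoint_interface₁ : ∀ t ∈ Icc 0 T, Disjoint (S.Ω₁ t) (interface S.z t)
  disjoint_interface₂ : ∀ t ∈ Icc 0 T, Disjoint (S.Ω₂ t) (interface S.z t)
  half_planes : ∃ a : ℝ, 1 ≤ a ∧ ∀ t ∈ Icc 0 T,
    {x : Plane | x 1 ≤ -a} ⊆ S.Ω₁ t ∧ {x : Plane | a ≤ x 1} ⊆ S.Ω₂ t
  phase₁ : IsFluidPhase ρ₁ g T S.z S.Ω₁ S.u₁ S.P₁
  phase₂ : IsFluidPhase ρ₂ g T S.z S.Ω₂ S.u₂ S.P₂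
  pressure_jump : ∀ t ∈ Icc 0 T, ∀ α : ℝ,
    S.P₂ t (S.z α t) - S.P₁ t (S.z α t) = -σ * curvature S.z α t

/-- The quantitative bounds, with constant `A`, on the interface and on the velocities on the interface. -/
structure TwoFluid.IsBoundedBy (S : TwoFluid) (A T : ℝ) : Prop where
  z_bound : CkNormLE 4 (fun p : ℝ × ℝ => S.z p.1 p.2 - !₂[p.1, 0]) (univ ×ˢ Icc 0 T) A
  z_regular : ∀ α : ℝ, ∀ t ∈ Icc 0 T, A⁻¹ ≤ ‖zα S.z α t‖
  v₁_bound : CkNormLE 3 (fun p : ℝ × ℝ => S.u₁ p.2 (S.z p.1 p.2)) (univ ×ˢ Icc 0 T) A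
  chordArc_zero : A⁻¹ ≤ chordArcInf S.z 0
  v₂_zero : ∀ α : ℝ, ‖S.u₂ 0 (S.z α 0)‖ ≤ A

end

open Filter Topology

/-! ### Coordinates in the plane -/

/-! A small chord-arc constant means that two arcs with well separated parameters nearly touch: for
nearby parameters the speed and second derivative bounds keep the ratio large, for distant ones the
closeness of the curve to a horizontal line does. A pair minimizing the distance at scale `ε₁` then
lies strictly inside the parameter window, so its chord is normal to the curve at both ends, and the
interior of the chord misses the curve. The chord therefore runs in a single fluid, and the crux is
to exclude fluid 1.

In fluid 1 the complex velocity is holomorphic, and the gradient of `u₁` is a similarity, so its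
size is read off from any one direction. On the interface the tangential derivative of the velocity
is at most `A` and the speed of the parametrization at least `A⁻¹`; hence the gradient is at most `A
^ 2` there, and by the maximum principle `IsPeriodicFlow.norm_gradient_le` throughout the region. So
a chord through fluid 1 that is normal to the interface at both ends contracts at rate at most `A ^
2`. A space-time minimization with an exponential weight (`IsMovingCurve.hasLongChords`) reduces all
chords avoiding fluid 2 to this case. Since the chord-arc constant is at least `A⁻¹` at time 0, such
chords at scale `ε₁` stay longer than some `c` depending on `A`, `ε₁` and `T` only.

The geometry follows from this one fact. A minimal chord shorter than `c` lies in fluid 2. A short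
segment leaving the curve on the other side cannot return to it, so the strip behind each arc lies
in fluid 1. The tangents at the two ends are opposite because the left normal points into the same
fluid all along the curve (`IsRegularCurve.normal_side`). A quantitative inverse function theorem
(`exists_graph`) writes both arcs as graphs over the line perpendicular to the chord. No third arc
enters between them (`IsMinimalPair.notMem_between`): the point of such an arc closest to the line
of the chord would have its tangent parallel to the chord, and following the curve from there would
cross one of the two graphs. -/

theorem plane_inner (x y : Plane) : inner ℝ x y = x 0 * y 0 + x 1 * y 1 := by
  simp [PiLp.inner_apply, Fin.sum_univ_two, mul_comm]

theorem plane_norm_sq (x : Plane) : ‖x‖ ^ 2 = x 0 ^ 2 + x 1 ^ 2 := by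
  rw [← real_inner_self_eq_norm_sq, plane_inner]; ring

@[simp] theorem perp_apply_zero (v : Plane) : perp v 0 = -(v 1) := rfl

@[simp] theorem perp_apply_one (v : Plane) : perp v 1 = v 0 := rfl

@[simp] theorem Tr₂_apply_zero (x : Plane) : Tr₂ x 0 = x 0 + 2 * Real.pi := rfl

@[simp] theorem Tr₂_apply_one (x : Plane) : Tr₂ x 1 = x 1 := rfl

theorem plane_ext {x y : Plane} (h0 : x 0 = y 0) (h1 : x 1 = y 1) : x = y := by
  ext i; fin_cases i <;> assumption

theorem Tr₂_eq_add (x : Plane) : Tr₂ x = x + !₂[2 * Real.pi, 0] := by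
  apply plane_ext <;> simp

theorem inner_perp_self (v : Plane) : inner ℝ v (perp v) = 0 := by
  rw [plane_inner]; simp; ring

theorem norm_perp (v : Plane) : ‖perp v‖ = ‖v‖ := by
  rw [← sq_eq_sq₀ (norm_nonneg _) (norm_nonneg _), plane_norm_sq, plane_norm_sq]; simp; ring

theorem inner_perp_perp (v w : Plane) : inner ℝ (perp v) (perp w) = inner ℝ v w := by
  simp only [plane_inner, perp_apply_zero, perp_apply_one]; ring

theorem perp_perp (v : Plane) : perp (perp v) = -v := by
  apply plane_ext <;> simp

/-- The rotation `perp` as a continuous linear map. -/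
noncomputable def perpL : Plane →L[ℝ] Plane :=
  LinearMap.toContinuousLinearMap
    { toFun := perp
      map_add' := fun x y => by apply plane_ext <;> simp; ring
      map_smul' := fun c x => by apply plane_ext <;> simp }

@[simp] theorem perpL_apply (v : Plane) : perpL v = perp v := rfl

/-- Expansion of a vector in the orthonormal frame `(perp e, e)`. -/
theorem plane_expand {e : Plane} (he : ‖e‖ = 1) (x : Plane) :
    x = (inner ℝ x (perp e) : ℝ) • perp e + (inner ℝ x e : ℝ) • e := by
  have h := plane_norm_sq e
  rw [he] at h
  simp only [plane_inner, perp_apply_zero, perp_apply_one]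
  apply plane_ext <;> simp <;> linear_combination (x _) * h

theorem plane_norm_sq_frame {e : Plane} (he : ‖e‖ = 1) (x : Plane) :
    ‖x‖ ^ 2 = (inner ℝ x (perp e) : ℝ) ^ 2 + (inner ℝ x e : ℝ) ^ 2 := by
  have h := plane_norm_sq e
  rw [he] at h
  rw [plane_norm_sq]
  simp only [plane_inner, perp_apply_zero, perp_apply_one]
  linear_combination (x 0 ^ 2 + x 1 ^ 2) * h

/-- A vector orthogonal to a unit vector `e` is a multiple of `perp e`. -/
theorem eq_smul_perp_of_inner_eq_zero {e x : Plane} (he : ‖e‖ = 1) (h : inner ℝ x e = 0) :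
    x = (inner ℝ x (perp e) : ℝ) • perp e := by
  conv_lhs => rw [plane_expand he x, h, zero_smul, add_zero]

theorem abs_inner_perp_of_inner_eq_zero {e x : Plane} (he : ‖e‖ = 1) (h : inner ℝ x e = 0) :
    |(inner ℝ x (perp e) : ℝ)| = ‖x‖ := by
  rw [← sq_eq_sq₀ (abs_nonneg _) (norm_nonneg _), plane_norm_sq_frame he, h, sq_abs]; ring

/-! ### Regular curves -/

/-- A `C⁴` simple curve, periodic modulo a horizontal translation, with quantitative bounds. -/
structure IsRegularCurve (M : ℝ) (ζ : ℝ → Plane) : Prop where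
  one_le : 1 ≤ M
  contDiff : ContDiff ℝ 4 ζ
  injective : Function.Injective ζ
  near : ∀ α, ‖ζ α - !₂[α, 0]‖ ≤ M
  speed : ∀ α, M⁻¹ ≤ ‖deriv ζ α‖
  deriv_le : ∀ k, 1 ≤ k → k ≤ 4 → ∀ α, ‖iteratedDeriv k ζ α‖ ≤ M
  periodic : ∀ α, ζ (α + 2 * Real.pi) = Tr₂ (ζ α)

namespace IsRegularCurve

variable {M : ℝ} {ζ : ℝ → Plane}

theorem pos (h : IsRegularCurve M ζ) : 0 < M := lt_of_lt_of_le one_pos h.one_le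

theorem continuous (h : IsRegularCurve M ζ) : Continuous ζ := h.contDiff.continuous

theorem hasDerivAt (h : IsRegularCurve M ζ) (α : ℝ) : HasDerivAt ζ (deriv ζ α) α :=
  (h.contDiff.differentiable (by norm_num) α).hasDerivAt

theorem contDiff_deriv (h : IsRegularCurve M ζ) : ContDiff ℝ 3 (deriv ζ) := by
  have := h.contDiff
  rw [show (4 : WithTop ℕ∞) = 3 + 1 by norm_num, contDiff_succ_iff_deriv] at this
  exact this.2.2

theorem norm_deriv_le (h : IsRegularCurve M ζ) (α : ℝ) : ‖deriv ζ α‖ ≤ M := by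
  simpa using h.deriv_le 1 le_rfl (by norm_num) α

theorem chord_le (h : IsRegularCurve M ζ) (α β : ℝ) : ‖ζ α - ζ β‖ ≤ M * |α - β| := by
  have := Convex.norm_image_sub_le_of_norm_deriv_le (s := univ) (f := ζ) (C := M) (x := β) (y := α)
    (fun x _ => (h.hasDerivAt x).differentiableAt) (fun x _ => h.norm_deriv_le x) convex_univ
    (mem_univ _) (mem_univ _)
  simpa using this

theorem norm_deriv_sub_le (h : IsRegularCurve M ζ) (α β : ℝ) :
    ‖deriv ζ α - deriv ζ β‖ ≤ M * |α - β| := by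
  have := Convex.norm_image_sub_le_of_norm_deriv_le (s := univ) (f := deriv ζ) (C := M)
    (x := β) (y := α)
    (fun x _ => h.contDiff_deriv.differentiable (by norm_num) x)
    (fun x _ => by simpa [iteratedDeriv_succ] using h.deriv_le 2 (by norm_num) (by norm_num) x)
    convex_univ (mem_univ _) (mem_univ _)
  simpa using this

theorem norm_sub_sub_le (h : IsRegularCurve M ζ) (α β : ℝ) :
    ‖ζ α - ζ β - (α - β) • deriv ζ β‖ ≤ M * |α - β| ^ 2 := by
  have := Convex.norm_image_sub_le_of_norm_hasDerivWithin_le (s := uIcc β α)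
    (f := fun x => ζ x - x • deriv ζ β) (f' := fun x => deriv ζ x - (1 : ℝ) • deriv ζ β)
    (C := M * |α - β|) (x := β) (y := α)
    (fun x _ => ((h.hasDerivAt x).sub ((hasDerivAt_id x).smul_const _)).hasDerivWithinAt)
    (fun x hx => by
      rw [one_smul]
      refine (h.norm_deriv_sub_le x β).trans ?_
      have := abs_sub_left_of_mem_uIcc hx
      have hM := h.pos
      gcongr) (convex_uIcc _ _) left_mem_uIcc right_mem_uIcc
  rw [Real.norm_eq_abs] at this
  calc _ = ‖ζ α - α • deriv ζ β - (ζ β - β • deriv ζ β)‖ := by congr 1; module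
    _ ≤ _ := this
    _ = _ := by ring

/-- Chord-arc lower bound for nearby parameters. -/
theorem le_norm_sub_of_near (h : IsRegularCurve M ζ) {α β : ℝ} (hab : |α - β| ≤ 1 / (2 * M ^ 2)) :
    |α - β| / (2 * M) ≤ ‖ζ α - ζ β‖ := by
  have hM := h.pos
  have h1 := h.norm_sub_sub_le α β
  have h2 : |α - β| * M⁻¹ ≤ ‖(α - β) • deriv ζ β‖ := by
    rw [norm_smul, Real.norm_eq_abs]; gcongr; exact h.speed β
  have h3 : ‖(α - β) • deriv ζ β‖ ≤ ‖ζ α - ζ β‖ + ‖ζ α - ζ β - (α - β) • deriv ζ β‖ := by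
    have := norm_sub_le (ζ α - ζ β) (ζ α - ζ β - (α - β) • deriv ζ β)
    simpa using this
  have h4 : M * |α - β| ^ 2 ≤ |α - β| / (2 * M) := by
    have : |α - β| * (M * |α - β|) ≤ |α - β| * (M * (1 / (2 * M ^ 2))) := by gcongr
    calc _ = |α - β| * (M * |α - β|) := by ring
      _ ≤ _ := this
      _ = _ := by field_simp
  have h5 : |α - β| * M⁻¹ = |α - β| / (2 * M) + |α - β| / (2 * M) := by field_simp; ring
  linarith

theorem le_norm_sub (h : IsRegularCurve M ζ) (α β : ℝ) : |α - β| - 2 * M ≤ ‖ζ α - ζ β‖ := by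
  have h1 := h.near α
  have h2 := h.near β
  have h3 : |α - β| = ‖(!₂[α, 0] - !₂[β, 0] : Plane)‖ := by
    rw [← sq_eq_sq₀ (abs_nonneg _) (norm_nonneg _), plane_norm_sq]; simp
  have h4 : (!₂[α, 0] - !₂[β, 0] : Plane)
      = (ζ α - ζ β) - (ζ α - !₂[α, 0]) + (ζ β - !₂[β, 0]) := by module
  have h5 := norm_add_le ((ζ α - ζ β) - (ζ α - !₂[α, 0])) (ζ β - !₂[β, 0])
  have h6 := norm_sub_le (ζ α - ζ β) (ζ α - !₂[α, 0])
  rw [h3, h4]; linarith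

/-- Chord-arc lower bound for distant parameters. -/
theorem le_norm_sub_of_far (h : IsRegularCurve M ζ) {α β : ℝ} (hab : 4 * M ≤ |α - β|) :
    |α - β| / 2 ≤ ‖ζ α - ζ β‖ := by
  have := h.le_norm_sub α β; linarith

/-- Parameters of nearby points are either very close or far from each other at scale `ε₁`. -/
theorem mem_Ioo_of_norm_lt (h : IsRegularCurve M ζ) {ε₁ α β : ℝ} (hε : ε₁ ≤ 1 / (16 * M ^ 2))
    (hε0 : 0 < ε₁)
    (hab : ε₁ ≤ |α - β|) (hd : ‖ζ α - ζ β‖ < ε₁ / (2 * M)) :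
    1 / (2 * M ^ 2) < |α - β| ∧ |α - β| < 4 * M := by
  have hM := h.pos
  constructor
  · by_contra! hc
    have := h.le_norm_sub_of_near hc
    have : ε₁ / (2 * M) ≤ |α - β| / (2 * M) := by gcongr
    linarith
  · by_contra! hc
    have h1 := h.le_norm_sub_of_far hc
    have h2 : ε₁ / (2 * M) ≤ ε₁ := div_le_self hε0.le (by linarith [h.one_le])
    have h3 : 1 / (16 * M ^ 2) ≤ 1 := by
      rw [div_le_one (by positivity)]; nlinarith [h.one_le]
    linarith [h.one_le]

theorem dist_le_of_norm_lt (h : IsRegularCurve M ζ) {α β : ℝ} (hd : ‖ζ α - ζ β‖ < 1) :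
    |α - β| < 4 * M := by
  by_contra! hc
  have h1 := h.le_norm_sub_of_far hc
  linarith [h.one_le]

/-- The part of the curve with parameters away from `γ` keeps a distance from `ζ γ`. -/
theorem exists_separation (h : IsRegularCurve M ζ) (γ : ℝ) {η : ℝ} (hη : 0 < η) :
    ∃ r > 0, ∀ β, ‖ζ β - ζ γ‖ < r → |β - γ| < η := by
  have hK : IsCompact (ζ '' {β | η ≤ |β - γ| ∧ |β - γ| ≤ 4 * M}) := by
    refine IsCompact.image ?_ h.continuous
    refine (isCompact_closedBall γ (4 * M)).of_isClosed_subset ?_ ?_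
    · have hc : Continuous fun β : ℝ => |β - γ| := by fun_prop
      exact (isClosed_le continuous_const hc).inter (isClosed_le hc continuous_const)
    · intro β hβ; simpa [Real.dist_eq] using hβ.2
  have hγ : ζ γ ∈ (ζ '' {β | η ≤ |β - γ| ∧ |β - γ| ≤ 4 * M})ᶜ := by
    rintro ⟨β, hβ, he⟩
    have := h.injective he
    subst this
    simp at hβ; linarith
  obtain ⟨r, hr, hrs⟩ := Metric.isOpen_iff.1 hK.isClosed.isOpen_compl _ hγ
  -- The bound by 1 puts the parameter within `4 * M` of `γ`, where the compactness argument
  -- applies.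
  refine ⟨min r 1, by positivity, fun β hβ => ?_⟩
  by_contra! hc
  refine hrs (a := ζ β) ?_ ⟨β, ⟨hc, ?_⟩, rfl⟩
  · rw [Metric.mem_ball, dist_eq_norm]; exact hβ.trans_le (min_le_left _ _)
  · exact (h.dist_le_of_norm_lt (hβ.trans_le (min_le_right _ _))).le

/-- Where the tangent at `α` is orthogonal to `e`, the coordinate along `perp e` of the curve is
strictly monotone near `α`. -/
theorem exists_sign (h : IsRegularCurve M ζ) {e : Plane} (he : ‖e‖ = 1) {α : ℝ}
    (ho : inner ℝ (deriv ζ α) e = 0) :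
    ∃ s : ℝ, (s = 1 ∨ s = -1) ∧ inner ℝ (deriv ζ α) (perp e) = s * ‖deriv ζ α‖ ∧
      ∀ β, |β - α| ≤ 1 / (2 * M ^ 2) → 1 / (2 * M) ≤ s * inner ℝ (deriv ζ β) (perp e) := by
  have hM := h.pos
  have h1 := abs_inner_perp_of_inner_eq_zero he ho
  obtain ⟨s, hs, hse⟩ : ∃ s : ℝ, (s = 1 ∨ s = -1) ∧
      inner ℝ (deriv ζ α) (perp e) = s * ‖deriv ζ α‖ := by
    rcases abs_choice (inner ℝ (deriv ζ α) (perp e) : ℝ) with h2 | h2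
    · exact ⟨1, Or.inl rfl, by rw [← h1, h2, one_mul]⟩
    · exact ⟨-1, Or.inr rfl, by rw [← h1, h2]; ring⟩
  refine ⟨s, hs, hse, fun β hβ => ?_⟩
  have h3 : |(inner ℝ (deriv ζ β - deriv ζ α) (perp e) : ℝ)| ≤ 1 / (2 * M) := by
    refine (abs_real_inner_le_norm _ _).trans ?_
    rw [norm_perp, he, mul_one]
    refine (h.norm_deriv_sub_le β α).trans ?_
    calc M * |β - α| ≤ M * (1 / (2 * M ^ 2)) := by gcongr
      _ = _ := by field_simp
  rw [inner_sub_left, hse] at h3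
  have h4 := h.speed α
  have h5 : M⁻¹ = 1 / (2 * M) + 1 / (2 * M) := by field_simp; norm_num
  rw [abs_le] at h3
  rcases hs with rfl | rfl <;> linarith

/-- The coordinate along `perp e` is strictly monotone on the closed ball of radius `1 / (2 * M ^
2)`. This identifies a curve point lying straight above or below another one on the same arc. -/
theorem eq_of_inner_perp_eq (h : IsRegularCurve M ζ) {e : Plane} (he : ‖e‖ = 1) {α : ℝ}
    (ho : inner ℝ (deriv ζ α) e = 0) {β γ : ℝ} (hβ : |β - α| ≤ 1 / (2 * M ^ 2))
    (hγ : |γ - α| ≤ 1 / (2 * M ^ 2))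
    (heq : inner ℝ (ζ β) (perp e) = (inner ℝ (ζ γ) (perp e) : ℝ)) : β = γ := by
  obtain ⟨s, hs, -, hmono⟩ := h.exists_sign he ho
  have hM := h.pos
  have hder : ∀ x, HasDerivAt (fun x => s * (inner ℝ (ζ x) (perp e) : ℝ))
      (s * inner ℝ (deriv ζ x) (perp e)) x := fun x => by
    have := ((h.hasDerivAt x).inner ℝ (hasDerivAt_const x (perp e))).const_mul s
    simpa using this
  have hm : StrictMonoOn (fun x => s * (inner ℝ (ζ x) (perp e) : ℝ))
      (Metric.closedBall α (1 / (2 * M ^ 2))) := by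
    refine strictMonoOn_of_deriv_pos (convex_closedBall _ _)
      (fun x _ => (hder x).continuousAt.continuousWithinAt) fun x hx => ?_
    rw [(hder x).deriv]
    refine lt_of_lt_of_le (by positivity) (hmono x ?_)
    have := interior_subset hx
    simpa [Real.dist_eq] using this
  refine hm.injOn ?_ ?_ (by simp only [heq])
  · simpa [Real.dist_eq] using hβ
  · simpa [Real.dist_eq] using hγ

end IsRegularCurve

/-! ### The two sides of a curve -/

/-- The plane is cut by the curve `ζ` into the two open regions `U` and `V`. -/
structure IsSplitting (ζ : ℝ → Plane) (U V : Set Plane) : Prop where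
  isOpen_left : IsOpen U
  isOpen_right : IsOpen V
  disjoint : Disjoint U V
  disjoint_left : Disjoint U (range ζ)
  disjoint_right : Disjoint V (range ζ)
  union_eq : U ∪ V ∪ range ζ = univ
  frontier_left : frontier U = range ζ
  frontier_right : frontier V = range ζ

namespace IsSplitting

variable {M : ℝ} {ζ : ℝ → Plane} {U V : Set Plane}

theorem symm (h : IsSplitting ζ U V) : IsSplitting ζ V U :=
  ⟨h.isOpen_right, h.isOpen_left, h.disjoint.symm, h.disjoint_right, h.disjoint_left,
    by rw [union_comm V U, h.union_eq], h.frontier_right, h.frontier_left⟩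

theorem subset_union (h : IsSplitting ζ U V) {K : Set Plane} (hK : Disjoint K (range ζ)) :
    K ⊆ U ∪ V := fun x hx => by
  have : x ∈ U ∪ V ∪ range ζ := by rw [h.union_eq]; trivial
  exact this.resolve_right fun hr => hK.le_bot ⟨hx, hr⟩

theorem closure_left (h : IsSplitting ζ U V) : closure U = U ∪ range ζ := by
  rw [closure_eq_self_union_frontier, h.frontier_left]

/-- A connected set which misses the curve and meets a region lies in that region. -/
theorem subset_left (h : IsSplitting ζ U V) {K : Set Plane} (hc : IsPreconnected K)
    (hK : Disjoint K (range ζ)) (hU : (K ∩ U).Nonempty) : K ⊆ U :=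
  hc.subset_left_of_subset_union h.isOpen_left h.isOpen_right h.disjoint (h.subset_union hK) hU

theorem subset_or (h : IsSplitting ζ U V) {K : Set Plane} (hc : IsPreconnected K)
    (hK : Disjoint K (range ζ)) : K ⊆ U ∨ K ⊆ V := by
  rcases K.eq_empty_or_nonempty with rfl | ⟨x, hx⟩
  · simp
  · rcases h.subset_union hK hx with hU | hV
    · exact Or.inl (h.subset_left hc hK ⟨x, hx, hU⟩)
    · exact Or.inr (h.symm.subset_left hc hK ⟨x, hx, hV⟩)

end IsSplitting

/-- The half collar of the curve `ζ` about `γ` in the direction of the field `v`, at heights in `J`. -/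
def collar (ζ v : ℝ → Plane) (γ η : ℝ) (J : Set ℝ) : Set Plane :=
  (fun p : ℝ × ℝ => ζ p.1 + p.2 • v p.1) '' (Metric.ball γ η ×ˢ J)

theorem mem_collar {ζ v : ℝ → Plane} {γ η : ℝ} {J : Set ℝ} {β ρ : ℝ} (hβ : |β - γ| < η)
    (hρ : ρ ∈ J) : ζ β + ρ • v β ∈ collar ζ v γ η J :=
  ⟨(β, ρ), ⟨by simpa [Real.dist_eq] using hβ, hρ⟩, rfl⟩

theorem isPreconnected_collar {ζ v : ℝ → Plane} (hζ : Continuous ζ) (hv : Continuous v) {γ η : ℝ}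
    {J : Set ℝ} (hJ : IsPreconnected J) : IsPreconnected (collar ζ v γ η J) :=
  (((convex_ball γ η).isPreconnected).prod hJ).image _ (by fun_prop)

/-- The collar map `(β, ρ) ↦ ζ β + ρ v β` is a local homeomorphism where `v` is transversal. -/
theorem exists_collar_chart {ζ v : ℝ → Plane} (hζ : ContDiff ℝ 1 ζ) (hv : ContDiff ℝ 1 v) {γ : ℝ}
    (ht : inner ℝ (v γ) (perp (deriv ζ γ)) ≠ (0 : ℝ)) :
    ∃ s ∈ 𝓝 ((γ, 0) : ℝ × ℝ), InjOn (fun p : ℝ × ℝ => ζ p.1 + p.2 • v p.1) s ∧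
      map (fun p : ℝ × ℝ => ζ p.1 + p.2 • v p.1) (𝓝 (γ, 0)) = 𝓝 (ζ γ) := by
  set Φ : ℝ × ℝ → Plane := fun p => ζ p.1 + p.2 • v p.1 with hΦ
  have hcd : ContDiff ℝ 1 Φ := by fun_prop
  have hs : HasStrictFDerivAt Φ (fderiv ℝ Φ (γ, 0)) (γ, 0) :=
    hcd.contDiffAt.hasStrictFDerivAt (by norm_num)
  have hL : ∀ b r : ℝ, fderiv ℝ Φ (γ, 0) (b, r) = b • deriv ζ γ + r • v γ := by
    intro b r
    have h1 : HasFDerivAt Φ ((ContinuousLinearMap.toSpanSingleton ℝ (deriv ζ γ)).comp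
        (ContinuousLinearMap.fst ℝ ℝ ℝ) + ((0 : ℝ) • ((ContinuousLinearMap.toSpanSingleton ℝ
        (deriv v γ)).comp (ContinuousLinearMap.fst ℝ ℝ ℝ)) +
        (ContinuousLinearMap.snd ℝ ℝ ℝ).smulRight (v γ))) (γ, 0) := by
      have hζ' : HasFDerivAt ζ (ContinuousLinearMap.toSpanSingleton ℝ (deriv ζ γ)) γ :=
        ((hζ.differentiable (by norm_num)) γ).hasDerivAt.hasFDerivAt
      have hv' : HasFDerivAt v (ContinuousLinearMap.toSpanSingleton ℝ (deriv v γ)) γ :=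
        ((hv.differentiable (by norm_num)) γ).hasDerivAt.hasFDerivAt
      have hfst : HasFDerivAt (Prod.fst : ℝ × ℝ → ℝ) (ContinuousLinearMap.fst ℝ ℝ ℝ) (γ, 0) :=
        hasFDerivAt_fst
      have hsnd : HasFDerivAt (Prod.snd : ℝ × ℝ → ℝ) (ContinuousLinearMap.snd ℝ ℝ ℝ) (γ, 0) :=
        hasFDerivAt_snd
      exact (HasFDerivAt.comp (γ, (0 : ℝ)) hζ' hfst).add
        (hsnd.smul (HasFDerivAt.comp (γ, (0 : ℝ)) hv' hfst))
    rw [h1.fderiv]; simp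
  have hinj : Function.Injective (fderiv ℝ Φ (γ, 0)).toLinearMap := by
    rw [injective_iff_map_eq_zero]
    rintro ⟨b, r⟩ hbr
    have hbr : b • deriv ζ γ + r • v γ = 0 := by rw [← hL]; exact hbr
    have h1 : r * inner ℝ (v γ) (perp (deriv ζ γ)) = 0 := by
      have := congrArg (fun x => (inner ℝ x (perp (deriv ζ γ)) : ℝ)) hbr
      simpa [inner_add_left, inner_smul_left, inner_perp_self] using this
    have hr : r = 0 := (mul_eq_zero.1 h1).resolve_right ht
    subst hr
    have hne : deriv ζ γ ≠ 0 := by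
      intro h0; rw [h0] at ht; apply ht; rw [plane_inner]; simp
    have hb : b = 0 := by simpa [hne] using hbr
    rw [hb]; rfl
  let E := (LinearMap.linearEquivOfInjective _ hinj (by simp)).toContinuousLinearEquiv
  have hsE : HasStrictFDerivAt Φ (E : ℝ × ℝ →L[ℝ] Plane) (γ, 0) := by
    convert hs
    ext x <;> rfl
  refine ⟨(hsE.toOpenPartialHomeomorph Φ).source,
    (hsE.toOpenPartialHomeomorph Φ).open_source.mem_nhds hsE.mem_toOpenPartialHomeomorph_source,
    (hsE.toOpenPartialHomeomorph Φ).injOn, ?_⟩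
  have := hsE.map_nhds_eq_of_equiv
  rwa [show Φ (γ, 0) = ζ γ by simp [hΦ]] at this

/-- A transversal field points to one region on one side of the curve and to the other region on the
other side. -/
theorem IsRegularCurve.exists_two_sides {M : ℝ} {ζ : ℝ → Plane} {U V : Set Plane}
    (h : IsRegularCurve M ζ) (hs : IsSplitting ζ U V) {v : ℝ → Plane} (hv : ContDiff ℝ 1 v) {γ : ℝ}
    (ht : inner ℝ (v γ) (perp (deriv ζ γ)) ≠ (0 : ℝ)) :
    ∃ η : ℝ, 0 < η ∧
      ((collar ζ v γ η (Ioo 0 η) ⊆ U ∧ collar ζ v γ η (Ioo (-η) 0) ⊆ V) ∨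
      (collar ζ v γ η (Ioo 0 η) ⊆ V ∧ collar ζ v γ η (Ioo (-η) 0) ⊆ U)) := by
  obtain ⟨s, hsn, hinj, hmap⟩ := exists_collar_chart (h.contDiff.of_le (by norm_num)) hv ht
  set Φ : ℝ × ℝ → Plane := fun p => ζ p.1 + p.2 • v p.1 with hΦ
  have hcont : Continuous Φ := by have := h.continuous; have := hv.continuous; fun_prop
  obtain ⟨η₀, hη₀, hη₀s⟩ := Metric.mem_nhds_iff.1 hsn
  obtain ⟨r, hr, hrs⟩ := h.exists_separation γ hη₀
  have hpre : Φ ⁻¹' Metric.ball (ζ γ) r ∈ 𝓝 ((γ, 0) : ℝ × ℝ) := by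
    refine hcont.continuousAt.preimage_mem_nhds ?_
    simpa [hΦ] using Metric.ball_mem_nhds _ hr
  obtain ⟨η, hη, hηs⟩ := Metric.mem_nhds_iff.1 (inter_mem hpre hsn)
  have hbox : ∀ β ρ : ℝ, |β - γ| < η → |ρ| < η → (β, ρ) ∈ Metric.ball ((γ, 0) : ℝ × ℝ) η := by
    intro β ρ hβ hρ
    rw [Metric.mem_ball, Prod.dist_eq, max_lt_iff]
    simp [Real.dist_eq, hβ, hρ]
  -- A curve point in the image of the box has its parameter within `η₀` of `γ`, by separation; it
  -- is then also the image of a point of height 0 in the chart, and injectivity of the collar map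
  -- forces the height of `p` to vanish.
  have hmiss : ∀ p ∈ Metric.ball ((γ, 0) : ℝ × ℝ) η, Φ p ∈ range ζ → p.2 = 0 := by
    rintro p hp ⟨β, hβ⟩
    have h1 := hηs hp
    have h2 : |β - γ| < η₀ := hrs β (by rw [hβ, ← dist_eq_norm]; exact h1.1)
    have h3 : ((β, 0) : ℝ × ℝ) ∈ s := hη₀s (by
      rw [Metric.mem_ball, Prod.dist_eq, max_lt_iff]; simp [Real.dist_eq, h2, hη₀])
    have h4 := hinj h1.2 h3 (by simp only [hΦ] at hβ ⊢; simp [hβ])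
    rw [h4]
  have hcol : ∀ J : Set ℝ, (∀ ρ ∈ J, |ρ| < η ∧ ρ ≠ 0) → Disjoint (collar ζ v γ η J) (range ζ) := by
    intro J hJ
    rw [Set.disjoint_left]
    rintro _ ⟨⟨β, ρ⟩, ⟨hβ, hρ⟩, rfl⟩ hx
    exact (hJ ρ hρ).2 (hmiss (β, ρ) (hbox _ _ (by simpa [Real.dist_eq] using hβ) (hJ ρ hρ).1) hx)
  have hP := hs.subset_or (isPreconnected_collar h.continuous hv.continuous isPreconnected_Ioo)
    (hcol (Ioo 0 η) fun ρ hρ => ⟨by rw [abs_of_pos hρ.1]; exact hρ.2, hρ.1.ne'⟩)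
  have hN := hs.subset_or (isPreconnected_collar h.continuous hv.continuous isPreconnected_Ioo)
    (hcol (Ioo (-η) 0) fun ρ hρ => ⟨by rw [abs_of_neg hρ.2]; linarith [hρ.1], hρ.2.ne⟩)
  -- The collar map covers a neighborhood of `ζ γ`, which is a frontier point of both regions, so
  -- each region meets one of the two half collars. As each half lies in a single region, the halves
  -- cannot lie in the same one.
  have hcover : ∀ W : Set Plane, Disjoint W (range ζ) → frontier W = range ζ →
      (∃ x ∈ W, x ∈ collar ζ v γ η (Ioo 0 η) ∨ x ∈ collar ζ v γ η (Ioo (-η) 0)) := by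
    intro W hW hf
    have h1 : ζ γ ∈ closure W := frontier_subset_closure (hf ▸ mem_range_self γ)
    have h2 : Φ '' Metric.ball ((γ, 0) : ℝ × ℝ) η ∈ 𝓝 (ζ γ) := by
      rw [← hmap]; exact image_mem_map (Metric.ball_mem_nhds _ hη)
    obtain ⟨_, ⟨p, hp, rfl⟩, hpW⟩ := mem_closure_iff_nhds.1 h1 _ h2
    rw [Metric.mem_ball, Prod.dist_eq, max_lt_iff] at hp
    simp only [Real.dist_eq, sub_zero] at hp
    have hp' := abs_lt.1 hp.2
    refine ⟨_, hpW, ?_⟩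
    rcases lt_trichotomy p.2 0 with h0 | h0 | h0
    · exact Or.inr (mem_collar hp.1 ⟨hp'.1, h0⟩)
    · exact absurd ⟨p.1, by simp [hΦ, h0]⟩ (Set.disjoint_left.1 hW hpW)
    · exact Or.inl (mem_collar hp.1 ⟨h0, hp'.2⟩)
  refine ⟨η, hη, ?_⟩
  have hd : ∀ x, x ∈ U → x ∈ V → False := fun x h1 h2 => Set.disjoint_left.1 hs.disjoint h1 h2
  obtain ⟨x, hxU, hx⟩ := hcover U hs.disjoint_left hs.frontier_left
  obtain ⟨y, hyV, hy⟩ := hcover V hs.disjoint_right hs.frontier_right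
  rcases hP with hP | hP <;> rcases hN with hN | hN
  · exact (hy.elim (fun hy => hd y (hP hy) hyV) (fun hy => hd y (hN hy) hyV)).elim
  · exact Or.inl ⟨hP, hN⟩
  · exact Or.inr ⟨hP, hN⟩
  · exact (hx.elim (fun hx => hd x hxU (hP hx)) (fun hx => hd x hxU (hN hx))).elim

/-- A point of the curve has one region ahead and the other behind along a transversal direction. -/
theorem IsRegularCurve.exists_two_sides_of_direction {M : ℝ} {ζ : ℝ → Plane} {U V : Set Plane}
    (h : IsRegularCurve M ζ) (hs : IsSplitting ζ U V) {n : Plane} {γ : ℝ}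
    (ht : inner ℝ n (perp (deriv ζ γ)) ≠ (0 : ℝ)) :
    ∃ η : ℝ, 0 < η ∧
      (((∀ ρ ∈ Ioo 0 η, ζ γ + ρ • n ∈ U) ∧ (∀ ρ ∈ Ioo 0 η, ζ γ - ρ • n ∈ V)) ∨
      ((∀ ρ ∈ Ioo 0 η, ζ γ + ρ • n ∈ V) ∧ (∀ ρ ∈ Ioo 0 η, ζ γ - ρ • n ∈ U))) := by
  obtain ⟨η, hη, hU⟩ := h.exists_two_sides hs (v := fun _ => n) contDiff_const ht
  refine ⟨η, hη, ?_⟩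
  have hγ : |γ - γ| < η := by simpa using hη
  have key : ∀ W W' : Set Plane, collar ζ (fun _ => n) γ η (Ioo 0 η) ⊆ W →
      collar ζ (fun _ => n) γ η (Ioo (-η) 0) ⊆ W' →
      (∀ ρ ∈ Ioo 0 η, ζ γ + ρ • n ∈ W) ∧ (∀ ρ ∈ Ioo 0 η, ζ γ - ρ • n ∈ W') := by
    refine fun W W' h1 h2 => ⟨fun ρ hρ => h1 (mem_collar hγ hρ), fun ρ hρ => ?_⟩
    have := h2 (mem_collar hγ (ρ := -ρ) ⟨by linarith [hρ.2], by linarith [hρ.1]⟩)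
    simpa [sub_eq_add_neg] using this
  exact hU.imp (fun h => key _ _ h.1 h.2) (fun h => key _ _ h.1 h.2)

/-- The left normal of the curve points to the same region at all points. -/
theorem IsRegularCurve.normal_side {M : ℝ} {ζ : ℝ → Plane} {U V : Set Plane}
    (h : IsRegularCurve M ζ) (hs : IsSplitting ζ U V) :
    (∀ γ, ∃ η : ℝ, 0 < η ∧ (∀ ρ ∈ Ioo 0 η, ζ γ + ρ • perp (deriv ζ γ) ∈ U) ∧
      (∀ ρ ∈ Ioo 0 η, ζ γ - ρ • perp (deriv ζ γ) ∈ V)) ∨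
    (∀ γ, ∃ η : ℝ, 0 < η ∧ (∀ ρ ∈ Ioo 0 η, ζ γ + ρ • perp (deriv ζ γ) ∈ V) ∧
      (∀ ρ ∈ Ioo 0 η, ζ γ - ρ • perp (deriv ζ γ) ∈ U)) := by
  set v : ℝ → Plane := fun γ => perp (deriv ζ γ) with hv
  have hvc : ContDiff ℝ 1 v := perpL.contDiff.comp (h.contDiff_deriv.of_le (by norm_num))
  have ht : ∀ γ, inner ℝ (v γ) (perp (deriv ζ γ)) ≠ (0 : ℝ) := fun γ => by
    rw [real_inner_self_eq_norm_sq, norm_perp]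
    have := h.speed γ
    have : 0 < ‖deriv ζ γ‖ := lt_of_lt_of_le (inv_pos.2 h.pos) this
    positivity
  have key : ∀ (γ η : ℝ) (W W' : Set Plane), 0 < η → collar ζ v γ η (Ioo 0 η) ⊆ W →
      collar ζ v γ η (Ioo (-η) 0) ⊆ W' → ∀ β ∈ Metric.ball γ η,
      (∀ ρ ∈ Ioo 0 η, ζ β + ρ • v β ∈ W) ∧ (∀ ρ ∈ Ioo 0 η, ζ β - ρ • v β ∈ W') := by
    intro γ η W W' hη h1 h2 β hβ
    rw [Metric.mem_ball, Real.dist_eq] at hβ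
    refine ⟨fun ρ hρ => h1 (mem_collar hβ hρ), fun ρ hρ => ?_⟩
    have := h2 (mem_collar hβ (ρ := -ρ) ⟨by linarith [hρ.2], by linarith [hρ.1]⟩)
    simpa [sub_eq_add_neg] using this
  -- Connectedness of the parameter line: the parameters whose left normal points into `U`, and
  -- those whose left normal points into `V`, form two disjoint open sets covering `ℝ`.
  set O : Set Plane → Set Plane → Set ℝ := fun W W' => {γ | ∃ η : ℝ, 0 < η ∧
    (∀ ρ ∈ Ioo 0 η, ζ γ + ρ • v γ ∈ W) ∧ (∀ ρ ∈ Ioo 0 η, ζ γ - ρ • v γ ∈ W')} with hO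
  have hopen : ∀ W W', (W = U ∧ W' = V) ∨ (W = V ∧ W' = U) → IsOpen (O W W') := by
    intro W W' hW
    rw [isOpen_iff_mem_nhds]
    rintro γ ⟨δ, hδ, hγ, -⟩
    obtain ⟨η, hη, hside⟩ := h.exists_two_sides hs hvc (ht γ)
    have hm : ζ γ + (min δ η / 2) • v γ ∈ W := hγ _ ⟨by positivity, by
      have := min_le_left δ η; linarith⟩
    have hmP : ζ γ + (min δ η / 2) • v γ ∈ collar ζ v γ η (Ioo 0 η) :=
      mem_collar (by simpa using hη) ⟨by positivity, by have := min_le_right δ η; linarith⟩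
    refine mem_of_superset (Metric.ball_mem_nhds γ hη) fun β hβ => ⟨η, hη, ?_⟩
    rcases hW with ⟨rfl, rfl⟩ | ⟨rfl, rfl⟩ <;> rcases hside with hside | hside
    · exact key γ η _ _ hη hside.1 hside.2 β hβ
    · exact (Set.disjoint_left.1 hs.disjoint hm (hside.1 hmP)).elim
    · exact (Set.disjoint_left.1 hs.disjoint (hside.1 hmP) hm).elim
    · exact key γ η _ _ hη hside.1 hside.2 β hβ
  have hcov : ∀ γ, γ ∈ O U V ∪ O V U := by
    intro γ
    obtain ⟨η, hη, hside⟩ := h.exists_two_sides hs hvc (ht γ)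
    have hγ : γ ∈ Metric.ball γ η := Metric.mem_ball_self hη
    exact hside.imp (fun h' => ⟨η, hη, key γ η _ _ hη h'.1 h'.2 γ hγ⟩)
      (fun h' => ⟨η, hη, key γ η _ _ hη h'.1 h'.2 γ hγ⟩)
  have hdisj : Disjoint (O U V) (O V U) := by
    rw [Set.disjoint_left]
    rintro γ ⟨η, hη, h1, -⟩ ⟨η', hη', h2, -⟩
    have l1 := min_le_left η η'
    have l2 := min_le_right η η'
    have l3 : 0 < min η η' := by positivity
    exact Set.disjoint_left.1 hs.disjoint (h1 (min η η' / 2) ⟨by linarith, by linarith⟩)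
      (h2 (min η η' / 2) ⟨by linarith, by linarith⟩)
  rcases isPreconnected_univ.subset_or_subset (hopen U V (Or.inl ⟨rfl, rfl⟩))
    (hopen V U (Or.inr ⟨rfl, rfl⟩)) hdisj (fun γ _ => hcov γ) with h1 | h1
  · exact Or.inl fun γ => h1 (mem_univ γ)
  · exact Or.inr fun γ => h1 (mem_univ γ)

/-! ### Distance minimizing pairs -/

/-- `(α₁, α₂)` minimizes the distance among all pairs of parameters at scale `ε`. -/
structure IsMinimalPair (ζ : ℝ → Plane) (ε α₁ α₂ : ℝ) : Prop where
  scale : |α₁ - α₂| ∈ Icc (2 * ε) (ε⁻¹ / 2)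
  le : ∀ α β : ℝ, |α - β| ∈ Icc ε ε⁻¹ → ‖ζ α₁ - ζ α₂‖ ≤ ‖ζ α - ζ β‖

/-- The direction from `ζ α₁` to `ζ α₂`. -/
noncomputable def direction (ζ : ℝ → Plane) (α₁ α₂ : ℝ) : Plane :=
  ‖ζ α₂ - ζ α₁‖⁻¹ • (ζ α₂ - ζ α₁)

theorem direction_comm (ζ : ℝ → Plane) (α₁ α₂ : ℝ) :
    direction ζ α₂ α₁ = -direction ζ α₁ α₂ := by
  unfold direction
  rw [norm_sub_rev, ← smul_neg, neg_sub]

/-- Chords at scale `ε` which avoid the region `V` are at least `c` long. -/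
def HasLongChords (ζ : ℝ → Plane) (V : Set Plane) (ε c : ℝ) : Prop :=
  ∀ α β : ℝ, |α - β| ∈ Icc ε ε⁻¹ → Disjoint (segment ℝ (ζ α) (ζ β)) V → c ≤ ‖ζ α - ζ β‖

namespace IsRegularCurve

variable {M ε : ℝ} {ζ : ℝ → Plane} {U V : Set Plane} {α₁ α₂ : ℝ}

/-- Points closer than 1 have parameters less than `4 * M` apart, so this makes the upper end of the
window `[ε, ε⁻¹]` harmless for short chords, even after halving. -/
theorem four_mul_le_inv (h : IsRegularCurve M ζ) (hε : 0 < ε) (hεM : ε ≤ 1 / (16 * M ^ 2)) :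
    8 * M ≤ ε⁻¹ := by
  have hM := h.pos
  have h1 : ε * (16 * M ^ 2) ≤ 1 := by rwa [le_div_iff₀ (by positivity)] at hεM
  rw [le_inv_comm₀ (by positivity) hε]
  refine hεM.trans ?_
  rw [div_le_iff₀ (by positivity), inv_mul_eq_div, le_div_iff₀ (by positivity)]
  nlinarith [h.one_le]

theorem lt_one_of_le (h : IsRegularCurve M ζ) (hεM : ε ≤ 1 / (16 * M ^ 2)) : ε < 1 := by
  refine hεM.trans_lt ?_
  have hM := h.pos
  rw [div_lt_one (by positivity)]
  nlinarith [h.one_le]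

/-- If `‖ζ α - ζ β‖` is below the minimal distance, the parameters are close. -/
theorem near_of_norm_lt (h : IsRegularCurve M ζ) (hε : 0 < ε) (hεM : ε ≤ 1 / (16 * M ^ 2))
    (hp : IsMinimalPair ζ ε α₁ α₂) (hd : ‖ζ α₁ - ζ α₂‖ ≤ 1) {α β : ℝ}
    (hab : ‖ζ α - ζ β‖ < ‖ζ α₁ - ζ α₂‖) : |α - β| < ε := by
  by_contra! hc
  have h1 := h.dist_le_of_norm_lt (hab.trans_le hd)
  have h2 := h.four_mul_le_inv hε hεM
  exact absurd (hp.le α β ⟨hc, by linarith [h.pos]⟩) (not_le.2 hab)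

end IsRegularCurve

namespace IsMinimalPair

variable {M ε : ℝ} {ζ : ℝ → Plane} {U V : Set Plane} {α₁ α₂ : ℝ}

theorem symm (hp : IsMinimalPair ζ ε α₁ α₂) : IsMinimalPair ζ ε α₂ α₁ :=
  ⟨by rw [abs_sub_comm]; exact hp.scale, fun α β h => by rw [norm_sub_rev]; exact hp.le α β h⟩

theorem norm_pos (hp : IsMinimalPair ζ ε α₁ α₂) (h : IsRegularCurve M ζ) (hε : 0 < ε) :
    0 < ‖ζ α₂ - ζ α₁‖ := by
  rw [norm_pos_iff, sub_ne_zero]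
  intro he
  have := h.injective he
  subst this
  have := hp.scale.1
  simp at this; linarith

theorem norm_direction (hp : IsMinimalPair ζ ε α₁ α₂) (h : IsRegularCurve M ζ) (hε : 0 < ε) :
    ‖direction ζ α₁ α₂‖ = 1 := by
  rw [direction, norm_smul, norm_inv, norm_norm, inv_mul_cancel₀ (hp.norm_pos h hε).ne']

theorem norm_smul_direction (hp : IsMinimalPair ζ ε α₁ α₂) (h : IsRegularCurve M ζ)
    (hε : 0 < ε) : ‖ζ α₂ - ζ α₁‖ • direction ζ α₁ α₂ = ζ α₂ - ζ α₁ := by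
  rw [direction, smul_smul, mul_inv_cancel₀ (hp.norm_pos h hε).ne', one_smul]

/-- A curve point on the open chord would be closer to each end than the ends are to each other. By
minimality its parameter would be within `ε` of both `α₁` and `α₂`, which are at least `2 * ε`
apart. -/
theorem disjoint_openSegment (hp : IsMinimalPair ζ ε α₁ α₂) (h : IsRegularCurve M ζ) (hε : 0 < ε)
    (hεM : ε ≤ 1 / (16 * M ^ 2)) (hd : ‖ζ α₁ - ζ α₂‖ ≤ 1) :
    Disjoint (openSegment ℝ (ζ α₁) (ζ α₂)) (range ζ) := by
  rw [Set.disjoint_left]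
  rintro _ hx ⟨γ, rfl⟩
  rw [openSegment_eq_image'] at hx
  obtain ⟨s, hs, hx⟩ := hx
  simp only at hx
  have hpos := hp.norm_pos h hε
  rw [norm_sub_rev] at hpos
  have h1 : ‖ζ γ - ζ α₁‖ < ‖ζ α₁ - ζ α₂‖ := by
    rw [← hx, add_sub_cancel_left, norm_smul, Real.norm_of_nonneg hs.1.le, norm_sub_rev]
    nlinarith [hs.2]
  have h2 : ‖ζ γ - ζ α₂‖ < ‖ζ α₁ - ζ α₂‖ := by
    have : ζ γ - ζ α₂ = (1 - s) • (ζ α₁ - ζ α₂) := by rw [← hx]; module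
    rw [this, norm_smul, Real.norm_of_nonneg (by linarith [hs.2])]
    nlinarith [hs.1]
  have h3 := h.near_of_norm_lt hε hεM hp hd h1
  have h4 := h.near_of_norm_lt hε hεM hp hd h2
  have h5 := hp.scale.1
  have h6 := abs_sub_le α₁ γ α₂
  rw [abs_sub_comm α₁ γ] at h6
  linarith

/-- The chord of a minimal pair is orthogonal to the curve. -/
theorem inner_deriv_eq_zero (hp : IsMinimalPair ζ ε α₁ α₂) (h : IsRegularCurve M ζ) (hε : 0 < ε)
    : inner ℝ (deriv ζ α₁) (direction ζ α₁ α₂) = (0 : ℝ) := by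
  -- The scale of a minimal pair is interior to the window of competitors, so `α₁` may be varied
  -- freely.
  have hmin : IsLocalMin (fun α => ‖ζ α - ζ α₂‖ ^ 2) α₁ := by
    have hnear : ∀ᶠ α in 𝓝 α₁, |α - α₂| ∈ Ioo ε ε⁻¹ := by
      have hc : ContinuousAt (fun α : ℝ => |α - α₂|) α₁ := by fun_prop
      refine hc.eventually_mem (isOpen_Ioo.mem_nhds ⟨?_, ?_⟩)
      · linarith [hp.scale.1]
      · linarith [hp.scale.2, inv_pos.2 hε]
    filter_upwards [hnear] with α hα
    have := hp.le α α₂ (Ioo_subset_Icc_self hα)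
    gcongr
  have hder := ((h.hasDerivAt α₁).sub_const (ζ α₂)).norm_sq
  have h0 := hmin.hasDerivAt_eq_zero hder
  rw [direction, inner_smul_right, real_inner_comm, ← neg_sub, inner_neg_left]
  have : inner ℝ (ζ α₁ - ζ α₂) (deriv ζ α₁) = (0 : ℝ) := by linarith
  rw [this]; simp

theorem mem_right_of_openSegment (hp : IsMinimalPair ζ ε α₁ α₂) (h : IsRegularCurve M ζ)
    (hε : 0 < ε) (hO : openSegment ℝ (ζ α₁) (ζ α₂) ⊆ V) {ρ : ℝ}
    (hρ : ρ ∈ Ioo 0 ‖ζ α₂ - ζ α₁‖) : ζ α₁ + ρ • direction ζ α₁ α₂ ∈ V := by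
  refine hO ?_
  rw [openSegment_eq_image']
  have hpos := hp.norm_pos h hε
  refine ⟨ρ * ‖ζ α₂ - ζ α₁‖⁻¹, ⟨by have := hρ.1; positivity, ?_⟩, ?_⟩
  · rw [← div_eq_mul_inv, div_lt_one hpos]; exact hρ.2
  · simp only [direction, smul_smul]

/-- The strip of height `d` over the curve near a minimal pair lies in the inner region. -/
theorem inner_strip (hp : IsMinimalPair ζ ε α₁ α₂) (h : IsRegularCurve M ζ)
    (hs : IsSplitting ζ U V) (hε : 0 < ε) (hεM : ε ≤ 1 / (16 * M ^ 2))
    (hd : ‖ζ α₁ - ζ α₂‖ ≤ 1) (hO : openSegment ℝ (ζ α₁) (ζ α₂) ⊆ V) {δ : ℝ} (hδε : δ ≤ ε) (hδ : 0 ≤ δ)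
    {β ρ : ℝ} (hβ : |β - α₁| ≤ δ) (hρ : ρ ∈ Ioo 0 ‖ζ α₂ - ζ α₁‖) :
    ζ β + ρ • direction ζ α₁ α₂ ∈ V := by
  set e := direction ζ α₁ α₂ with he
  have hM := h.pos
  have hK : IsPreconnected ((fun p : ℝ × ℝ => ζ p.1 + p.2 • e) ''
      (Metric.closedBall α₁ δ ×ˢ Ioo 0 ‖ζ α₂ - ζ α₁‖)) := by
    have := h.continuous
    exact ((convex_closedBall α₁ δ).isPreconnected.prod isPreconnected_Ioo).image _ (by fun_prop)
  have hbd : 2 * ε ≤ 1 / (2 * M ^ 2) := by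
    calc 2 * ε ≤ 2 * (1 / (16 * M ^ 2)) := by gcongr
      _ = 1 / (8 * M ^ 2) := by field_simp; norm_num
      _ ≤ _ := by gcongr; norm_num
  have hmem : ζ α₁ + ρ • e ∈ V := hp.mem_right_of_openSegment h hε hO hρ
  refine hs.symm.subset_left hK ?_ ⟨_, ⟨(α₁, ρ), ⟨by simpa using hδ, hρ⟩, rfl⟩, hmem⟩
    ⟨(β, ρ), ⟨by simpa [Real.dist_eq] using hβ, hρ⟩, rfl⟩
  rw [Set.disjoint_left]
  rintro _ ⟨⟨β, ρ⟩, ⟨hβ, hρ⟩, rfl⟩ ⟨γ, hγ⟩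
  -- A curve point in the strip is at distance `ρ`, less than the minimal one, from `ζ β`, so its
  -- parameter is within `ε` of `β`. It has the same `perp e` coordinate as `ζ β`, hence equals it,
  -- contradicting `0 < ρ`.
  simp only [Metric.mem_closedBall, Real.dist_eq] at hβ hρ hγ
  have hne : ‖ζ γ - ζ β‖ = ρ := by
    rw [hγ, add_sub_cancel_left, norm_smul, hp.norm_direction h hε, mul_one,
      Real.norm_of_nonneg hρ.1.le]
  have h1 : |γ - β| < ε := h.near_of_norm_lt hε hεM hp hd (by
    rw [hne, norm_sub_rev (ζ α₁)]; exact hρ.2)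
  have h2 := abs_sub_le γ β α₁
  have := h.eq_of_inner_perp_eq (hp.norm_direction h hε) (hp.inner_deriv_eq_zero h hε)
    (β := γ) (γ := β) (by linarith) (by linarith) (by
      rw [hγ, inner_add_left, inner_smul_left, inner_perp_self]; simp)
  rw [this, sub_self, norm_zero] at hne
  exact hρ.1.ne hne

/-- A chord running in `U` would avoid `V` and hence be at least `c` long. Through `HasLongChords`
this is one of the two places where the dynamics enters the geometry; the other is `outer_strip`. -/
theorem openSegment_subset (hp : IsMinimalPair ζ ε α₁ α₂) (h : IsRegularCurve M ζ)
    (hs : IsSplitting ζ U V) (hε : 0 < ε) (hεM : ε ≤ 1 / (16 * M ^ 2)) {c : ℝ}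
    (hd : ‖ζ α₁ - ζ α₂‖ ≤ 1) (hdc : ‖ζ α₁ - ζ α₂‖ < c) (hlong : HasLongChords ζ V ε c) :
    openSegment ℝ (ζ α₁) (ζ α₂) ⊆ V := by
  rcases hs.subset_or (convex_openSegment _ _).isPreconnected
    (hp.disjoint_openSegment h hε hεM hd) with hU | hV
  · refine absurd (hlong α₁ α₂ ⟨?_, ?_⟩ ?_) (not_le.2 hdc)
    · linarith [hp.scale.1]
    · linarith [hp.scale.2, inv_pos.2 hε]
    · rw [← insert_endpoints_openSegment, Set.disjoint_left]
      rintro x (rfl | rfl | hx) hV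
      · exact Set.disjoint_left.1 hs.disjoint_right hV (mem_range_self _)
      · exact Set.disjoint_left.1 hs.disjoint_right hV (mem_range_self _)
      · exact Set.disjoint_left.1 hs.disjoint (hU hx) hV
  · exact hV

/-- Behind the curve near a minimal pair there is a strip which lies in the outer region. -/
theorem outer_strip (hp : IsMinimalPair ζ ε α₁ α₂) (h : IsRegularCurve M ζ)
    (hs : IsSplitting ζ U V) (hε : 0 < ε) (hεM : ε ≤ 1 / (16 * M ^ 2)) {c : ℝ}
    (hd : ‖ζ α₁ - ζ α₂‖ ≤ 1) (hdc : ‖ζ α₁ - ζ α₂‖ < c) (hlong : HasLongChords ζ V ε c)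
    {δ : ℝ} (hδ : 0 ≤ δ) (hδε : δ ≤ ε) (hδc : δ ≤ c) {β ρ : ℝ} (hβ : |β - α₁| ≤ δ)
    (hρ : ρ ∈ Ioo 0 δ) : ζ β - ρ • direction ζ α₁ α₂ ∈ U := by
  set e := direction ζ α₁ α₂ with he
  have hM := h.pos
  have hO := hp.openSegment_subset h hs hε hεM hd hdc hlong
  have hen : ‖e‖ = 1 := hp.norm_direction h hε
  have hbd : 2 * ε ≤ 1 / (2 * M ^ 2) := by
    calc 2 * ε ≤ 2 * (1 / (16 * M ^ 2)) := by gcongr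
      _ = 1 / (8 * M ^ 2) := by field_simp; norm_num
      _ ≤ _ := by gcongr; norm_num
  have hort := hp.inner_deriv_eq_zero h hε
  have htr : inner ℝ e (perp (deriv ζ β)) ≠ (0 : ℝ) := by
    obtain ⟨s, hs, -, hmono⟩ := h.exists_sign hen hort
    have h1 := hmono β (by linarith)
    have h2 : inner ℝ e (perp (deriv ζ β)) = -(inner ℝ (deriv ζ β) (perp e) : ℝ) := by
      simp only [plane_inner, perp_apply_zero, perp_apply_one]; ring
    rw [h2]
    have h3 : (0 : ℝ) < 1 / (2 * M) := by positivity
    rcases hs with rfl | rfl <;> intro h4 <;> linarith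
  obtain ⟨η, hη, hside⟩ := h.exists_two_sides_of_direction hs htr
  -- The forward direction starts inside the inner strip, hence in `V`; so the backward one starts
  -- in `U`.
  have hback : ∀ r ∈ Ioo 0 η, ζ β - r • e ∈ U := by
    rcases hside with hside | hside
    · have hpos := hp.norm_pos h hε
      have hm : 0 < min η ‖ζ α₂ - ζ α₁‖ := lt_min hη hpos
      have l1 := min_le_left η ‖ζ α₂ - ζ α₁‖
      have l2 := min_le_right η ‖ζ α₂ - ζ α₁‖
      have h1 := hside.1 (min η ‖ζ α₂ - ζ α₁‖ / 2) ⟨by linarith, by linarith⟩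
      have h2 := hp.inner_strip h hs hε hεM hd hO hδε hδ hβ
        (ρ := min η ‖ζ α₂ - ζ α₁‖ / 2) ⟨by linarith, by linarith⟩
      exact (Set.disjoint_left.1 hs.disjoint h1 h2).elim
    · exact hside.2
  by_contra hnot
  -- The infimum of `S` is the first exit from `U`. The cutoff `min η ρ / 2` excludes `r = 0`, a
  -- curve point and so outside `U`, while `hback` covers the values below the cutoff.
  set S : Set ℝ := {r | r ∈ Icc 0 ρ ∧ min η ρ / 2 ≤ r ∧ ζ β - r • e ∉ U} with hS
  have hSc : IsClosed S := by
    have h1 : Continuous fun r : ℝ => ζ β - r • e := by fun_prop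
    exact isClosed_Icc.inter ((isClosed_le continuous_const continuous_id).inter
      (hs.isOpen_left.isClosed_compl.preimage h1))
  have hSne : S.Nonempty := ⟨ρ, ⟨hρ.1.le, le_rfl⟩, by
    have := min_le_right η ρ; linarith [hρ.1], hnot⟩
  have hSb : BddBelow S := ⟨0, fun r hr => hr.1.1⟩
  obtain ⟨⟨-, h1⟩, h2, h3⟩ := hSc.csInf_mem hSne hSb
  set r := sInf S with hr
  have hr0 : 0 < r := lt_of_lt_of_le (by have := lt_min hη hρ.1; linarith) h2
  have hbefore : ∀ q ∈ Ioo 0 r, ζ β - q • e ∈ U := by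
    intro q hq
    by_contra hqU
    have hq' : min η ρ / 2 ≤ q := by
      by_contra! hlt
      refine hqU (hback q ⟨hq.1, ?_⟩)
      have := min_le_left η ρ
      linarith
    have : r ≤ q := csInf_le hSb ⟨⟨hq.1.le, hq.2.le.trans h1⟩, hq', hqU⟩
    exact absurd hq.2 (not_lt.2 this)
  have hcl : ζ β - r • e ∈ closure U := by
    have h4 : ContinuousWithinAt (fun q : ℝ => ζ β - q • e) (Ioo 0 r) r := by
      have : Continuous fun q : ℝ => ζ β - q • e := by fun_prop
      exact this.continuousWithinAt
    refine h4.mem_closure ?_ hbefore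
    rw [closure_Ioo hr0.ne]; exact right_mem_Icc.2 hr0.le
  rw [hs.closure_left] at hcl
  obtain ⟨γ, hγ⟩ := hcl.resolve_left h3
  have hne : ‖ζ β - ζ γ‖ = r := by
    rw [hγ, sub_sub_cancel, norm_smul, hen, mul_one, Real.norm_of_nonneg hr0.le]
  have hrd : r < δ := h1.trans_lt hρ.2
  -- The segment can leave `U` only by returning to the curve. A return to the same arc is excluded
  -- by monotonicity of the `perp e` coordinate. A return to another arc gives an admissible chord
  -- avoiding `V` and shorter than `δ ≤ c`.
  by_cases hbg : |β - γ| < ε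
  · have h5 := abs_sub_le γ β α₁
    rw [abs_sub_comm γ β] at h5
    have := h.eq_of_inner_perp_eq hen hort (β := γ) (γ := β) (by linarith) (by linarith) (by
      rw [hγ, inner_sub_left, inner_smul_left, inner_perp_self]; simp)
    rw [this, sub_self, norm_zero] at hne
    exact hr0.ne hne
  · push Not at hbg
    have h6 := h.four_mul_le_inv hε hεM
    have h7 := h.dist_le_of_norm_lt (α := β) (β := γ) (by rw [hne]; linarith [h.lt_one_of_le hεM])
    have h8 := hlong β γ ⟨hbg, by linarith⟩ (by
      rw [segment_eq_image', Set.disjoint_left]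
      rintro _ ⟨s, hs1, rfl⟩ hV
      have hx : ζ β + s • (ζ γ - ζ β) = ζ β - (s * r) • e := by rw [hγ]; module
      simp only [hx] at hV
      rcases hs1.1.eq_or_lt with h0 | h0
      · rw [← h0, zero_mul, zero_smul, sub_zero] at hV
        exact Set.disjoint_left.1 hs.disjoint_right hV (mem_range_self _)
      · rcases hs1.2.eq_or_lt with h9 | h9
        · rw [h9, one_mul, ← hγ] at hV
          exact Set.disjoint_left.1 hs.disjoint_right hV (mem_range_self _)
        · exact Set.disjoint_left.1 hs.disjoint (hbefore (s * r) ⟨by positivity, by nlinarith⟩) hV)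
    rw [hne] at h8
    linarith

/-- The tangents of a minimal pair point in opposite directions. -/
theorem inner_deriv_neg (hp : IsMinimalPair ζ ε α₁ α₂) (h : IsRegularCurve M ζ)
    (hs : IsSplitting ζ U V) (hε : 0 < ε)
    (hO : openSegment ℝ (ζ α₁) (ζ α₂) ⊆ V) :
    inner ℝ (deriv ζ α₁) (deriv ζ α₂) < (0 : ℝ) := by
  set e := direction ζ α₁ α₂ with he
  have hM := h.pos
  have hen : ‖e‖ = 1 := hp.norm_direction h hε
  have hpos := hp.norm_pos h hε
  have ho₁ := hp.inner_deriv_eq_zero h hε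
  have ho₂ : inner ℝ (deriv ζ α₂) e = (0 : ℝ) := by
    have := hp.symm.inner_deriv_eq_zero h hε
    rw [direction_comm, inner_neg_right] at this
    linarith
  have hm₁ : ∀ ρ ∈ Ioo 0 ‖ζ α₂ - ζ α₁‖, ζ α₁ + ρ • e ∈ V := fun ρ hρ =>
    hp.mem_right_of_openSegment h hε hO hρ
  have hm₂ : ∀ ρ ∈ Ioo 0 ‖ζ α₂ - ζ α₁‖, ζ α₂ - ρ • e ∈ V := fun ρ hρ => by
    have := hp.symm.mem_right_of_openSegment (V := V) h hε (by rwa [openSegment_symm])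
      (ρ := ρ) (by rwa [norm_sub_rev])
    rw [direction_comm] at this
    simpa [sub_eq_add_neg] using this
  have e₁ := eq_smul_perp_of_inner_eq_zero hen ho₁
  have e₂ := eq_smul_perp_of_inner_eq_zero hen ho₂
  set a := (inner ℝ (deriv ζ α₁) (perp e) : ℝ) with ha
  set b := (inner ℝ (deriv ζ α₂) (perp e) : ℝ) with hb
  have hab : inner ℝ (deriv ζ α₁) (deriv ζ α₂) = a * b := by
    rw [e₁, e₂, inner_smul_left, inner_smul_right, inner_perp_perp, real_inner_self_eq_norm_sq,
      hen]; simp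
  have hnz : ∀ γ, deriv ζ γ ≠ 0 := fun γ h0 => by
    have := h.speed γ
    rw [h0, norm_zero] at this
    linarith [inv_pos.2 hM]
  have ha0 : a ≠ 0 := fun h0 => hnz α₁ (by rw [e₁, h0, zero_smul])
  have hb0 : b ≠ 0 := fun h0 => hnz α₂ (by rw [e₂, h0, zero_smul])
  -- The left normals at the two ends are `-(a • e)` and `-(b • e)`. If `a` and `b` have the same
  -- sign they point the same way along `e`, whereas `V` lies ahead of `α₁` along `e` and ahead of
  -- `α₂` along `-e`. So at one of the ends a side which should be in `U` is in `V`; `s` is the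
  -- common sign.
  have key : ∀ (s a b η₁ η₂ : ℝ), (s = 1 ∨ s = -1) → 0 < η₁ → 0 < η₂ → 0 < a * s → 0 < b * s →
      (∀ ρ ∈ Ioo 0 η₁, ζ α₁ + (s * ρ * a) • e ∈ U ∨ ζ α₂ - (s * ρ * b) • e ∈ U) → False := by
    intro s a b η₁ η₂ hs1 hη₁ hη₂ has hbs hU
    set q := min (η₁ / 2) (min (‖ζ α₂ - ζ α₁‖ / (2 * (a * s))) (‖ζ α₂ - ζ α₁‖ / (2 * (b * s))))
      with hq
    have hq0 : 0 < q := by positivity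
    have q1 : q ≤ η₁ / 2 := min_le_left _ _
    have q2 : q ≤ ‖ζ α₂ - ζ α₁‖ / (2 * (a * s)) := (min_le_right _ _).trans (min_le_left _ _)
    have q3 : q ≤ ‖ζ α₂ - ζ α₁‖ / (2 * (b * s)) := (min_le_right _ _).trans (min_le_right _ _)
    rw [le_div_iff₀ (by positivity)] at q2 q3
    have q4 : 0 < q * (a * s) := by positivity
    have q5 : 0 < q * (b * s) := by positivity
    rcases hU q ⟨hq0, by linarith⟩ with h1 | h1
    · exact Set.disjoint_left.1 hs.disjoint h1 (hm₁ _ ⟨by linarith, by linarith⟩)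
    · exact Set.disjoint_left.1 hs.disjoint h1 (hm₂ _ ⟨by linarith, by linarith⟩)
  rw [hab]
  by_contra! hnn
  have habpos : 0 < a * b := lt_of_le_of_ne hnn (mul_ne_zero ha0 hb0).symm
  have p₁ : perp (deriv ζ α₁) = -(a • e) := by
    rw [e₁, ← perpL_apply, map_smul, perpL_apply, perp_perp, smul_neg]
  have p₂ : perp (deriv ζ α₂) = -(b • e) := by
    rw [e₂, ← perpL_apply, map_smul, perpL_apply, perp_perp, smul_neg]
  rcases h.normal_side hs with hside | hside
  · obtain ⟨η₁, hη₁, h1, -⟩ := hside α₁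
    obtain ⟨η₂, hη₂, h2, -⟩ := hside α₂
    rcases lt_or_gt_of_ne ha0 with ha' | ha'
    · have hb' : b < 0 := by nlinarith
      refine key (-1) a b η₁ η₂ (Or.inr rfl) hη₁ hη₂ (by linarith) (by linarith) fun ρ hρ =>
        Or.inl ?_
      have := h1 ρ hρ
      rw [p₁] at this
      convert this using 1; module
    · have hb' : 0 < b := by nlinarith
      refine key 1 a b η₂ η₁ (Or.inl rfl) hη₂ hη₁ (by linarith) (by linarith) fun ρ hρ =>
        Or.inr ?_
      have := h2 ρ hρ
      rw [p₂] at this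
      convert this using 1; module
  · obtain ⟨η₁, hη₁, -, h1⟩ := hside α₁
    obtain ⟨η₂, hη₂, -, h2⟩ := hside α₂
    rcases lt_or_gt_of_ne ha0 with ha' | ha'
    · have hb' : b < 0 := by nlinarith
      refine key (-1) a b η₂ η₁ (Or.inr rfl) hη₂ hη₁ (by linarith) (by linarith) fun ρ hρ =>
        Or.inr ?_
      have := h2 ρ hρ
      rw [p₂] at this
      convert this using 1; module
    · have hb' : 0 < b := by nlinarith
      refine key 1 a b η₁ η₂ (Or.inl rfl) hη₁ hη₂ (by linarith) (by linarith) fun ρ hρ =>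
        Or.inl ?_
      have := h1 ρ hρ
      rw [p₁] at this
      convert this using 1; module

end IsMinimalPair

/-! ### Calculus of `C^n` bounds on the line -/

namespace CkNormLE

variable {s t : Set ℝ} {f g : ℝ → ℝ} {n : ℕ} {B B' : ℝ}

theorem mono_const (h : CkNormLE n f s B) (hB : B ≤ B') : CkNormLE n f s B' :=
  ⟨h.1, fun k hk x hx => (h.2 k hk x hx).trans hB⟩

theorem mono_order {m : ℕ} (h : CkNormLE n f s B) (hm : m ≤ n) : CkNormLE m f s B :=
  ⟨h.1.of_le (by exact_mod_cast hm), fun k hk x hx => h.2 k (hk.trans hm) x hx⟩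

theorem mono_set (h : CkNormLE n f s B) (hs : IsOpen s) (ht : IsOpen t) (hts : t ⊆ s) :
    CkNormLE n f t B :=
  ⟨h.1.mono hts, fun k hk x hx => by
    have := h.2 k hk x (hts hx)
    rwa [iteratedFDerivWithin_of_isOpen k hs (hts hx), ← iteratedFDerivWithin_of_isOpen k ht hx]
      at this⟩

theorem congr (h : CkNormLE n f s B) (hfg : EqOn g f s) : CkNormLE n g s B :=
  ⟨h.1.congr hfg, fun k hk x hx => by
    rw [iteratedFDerivWithin_congr hfg hx]; exact h.2 k hk x hx⟩

theorem abs_le (h : CkNormLE n f s B) {x : ℝ} (hx : x ∈ s) : |f x| ≤ B := by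
  simpa using h.2 0 (Nat.zero_le _) x hx

theorem zero_iff (hf : ContinuousOn f s) (hB : ∀ x ∈ s, |f x| ≤ B) : CkNormLE 0 f s B := by
  refine ⟨by simpa using hf, fun k hk x hx => ?_⟩
  obtain rfl := Nat.le_zero.1 hk
  simpa using hB x hx

/-- With `deriv_of_succ`, this trades one order of a `C^n` bound for a pointwise bound and a bound
on `deriv f`, the form in which the inductions below proceed. Openness identifies derivatives within
`s` with ordinary ones. -/
theorem succ (hs : IsOpen s) (hd : DifferentiableOn ℝ f s) (hB : ∀ x ∈ s, |f x| ≤ B)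
    (h : CkNormLE n (deriv f) s B) : CkNormLE (n + 1) f s B := by
  refine ⟨?_, fun k hk x hx => ?_⟩
  · push_cast
    exact (contDiffOn_succ_iff_deriv_of_isOpen hs).2 ⟨hd, by simp, h.1⟩
  · rcases k with _ | k
    · simpa using hB x hx
    · rw [norm_iteratedFDerivWithin_eq_norm_iteratedDerivWithin, iteratedDerivWithin_succ',
        iteratedDerivWithin_congr (fun y hy => derivWithin_of_isOpen hs hy) hx,
        ← norm_iteratedFDerivWithin_eq_norm_iteratedDerivWithin]
      exact h.2 k (by omega) x hx

theorem deriv_of_succ (hs : IsOpen s) (h : CkNormLE (n + 1) f s B) : CkNormLE n (deriv f) s B := by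
  refine ⟨?_, fun k hk x hx => ?_⟩
  · have := h.1
    push_cast at this
    exact ((contDiffOn_succ_iff_deriv_of_isOpen hs).1 this).2.2
  · have := h.2 (k + 1) (by omega) x hx
    rwa [norm_iteratedFDerivWithin_eq_norm_iteratedDerivWithin, iteratedDerivWithin_succ',
        iteratedDerivWithin_congr (fun y hy => derivWithin_of_isOpen hs hy) hx,
        ← norm_iteratedFDerivWithin_eq_norm_iteratedDerivWithin] at this

theorem neg (h : CkNormLE n f s B) (hs : IsOpen s) : CkNormLE n (fun x => -f x) s B := by
  refine ⟨h.1.neg, fun k hk x hx => ?_⟩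
  have := iteratedFDerivWithin_neg_apply (𝕜 := ℝ) (i := k) (f := f) hs.uniqueDiffOn hx
  rw [show (fun x => -f x) = -f from rfl, this, norm_neg]
  exact h.2 k hk x hx

theorem mul (hs : IsOpen s) (hf : CkNormLE n f s B) (hg : CkNormLE n g s B') (hB : 0 ≤ B) (hB' : 0 ≤ B') :
    CkNormLE n (fun x => f x * g x) s (2 ^ n * (B * B')) := by
  refine ⟨hf.1.mul hg.1, fun k hk x hx => ?_⟩
  refine (norm_iteratedFDerivWithin_mul_le hf.1 hg.1 hs.uniqueDiffOn hx
    (n := k) (by exact_mod_cast hk)).trans ?_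
  calc _ ≤ ∑ i ∈ Finset.range (k + 1), (k.choose i : ℝ) * B * B' := by
        refine Finset.sum_le_sum fun i hi => ?_
        have hi' : i ≤ k := Nat.lt_succ_iff.1 (Finset.mem_range.1 hi)
        have h1 := hf.2 i (hi'.trans hk) x hx
        have h2 := hg.2 (k - i) ((Nat.sub_le _ _).trans hk) x hx
        gcongr
    _ = 2 ^ k * (B * B') := by
        simp_rw [mul_assoc]
        rw [← Finset.sum_mul]
        congr 1
        exact_mod_cast Nat.sum_range_choose k
    _ ≤ _ := by gcongr; norm_num

/-- The Faà di Bruno estimate asks for the `i`-th power of a constant as bound on the `i`-th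
derivative of the inner function; the uniform bound `B'` suffices because `1 ≤ B'`. -/
theorem comp (hs : IsOpen s) (ht : IsOpen t) (hg : CkNormLE n g t B) (hf : CkNormLE n f s B')
    (hst : MapsTo f s t) (hB : 0 ≤ B) (hB' : 1 ≤ B') :
    CkNormLE n (g ∘ f) s (n.factorial * B * B' ^ n) := by
  refine ⟨hg.1.comp hf.1 hst, fun k hk x hx => ?_⟩
  refine (norm_iteratedFDerivWithin_comp_le hg.1 hf.1 (by exact_mod_cast hk) ht.uniqueDiffOn
    hs.uniqueDiffOn hst hx (C := B) (D := B') (fun i hi => hg.2 i (hi.trans hk) _ (hst hx))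
    (fun i hi hik => ?_)).trans ?_
  · exact (hf.2 i (hik.trans hk) x hx).trans (le_self_pow₀ hB' (by omega))
  · have : (k.factorial : ℝ) ≤ n.factorial := by exact_mod_cast Nat.factorial_le hk
    gcongr

/-- Bound for the reciprocal of a function which is bounded below. -/
theorem exists_inv (n : ℕ) (B : ℝ) (hB : 0 < B) : ∃ Q, 1 ≤ Q ∧ ∀ (κ : ℝ → ℝ) (t : Set ℝ), IsOpen t →
    CkNormLE n κ t B → (∀ x ∈ t, B⁻¹ ≤ |κ x|) → CkNormLE n (fun x => (κ x)⁻¹) t Q := by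
  induction n with
  | zero =>
    refine ⟨max 1 B, le_max_left _ _, fun κ t _ hκ hlow => zero_iff ?_ fun x hx => ?_⟩
    · exact hκ.1.continuousOn.inv₀ fun x hx h0 => by
        have := hlow x hx; rw [h0, abs_zero] at this; linarith [inv_pos.2 hB]
    · rw [abs_inv]
      refine le_trans ?_ (le_max_right _ _)
      exact inv_le_of_inv_le₀ hB (hlow x hx)
  | succ n ih =>
    obtain ⟨Q, hQ, hQn⟩ := ih
    -- The derivative of the reciprocal is `-κ'` times two copies of the reciprocal: two uses of the
    -- product bound at order `n`.
    refine ⟨max Q (2 ^ n * (B * (2 ^ n * (Q * Q)))), le_max_of_le_left hQ,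
      fun κ t ht hκ hlow => ?_⟩
    have h1 := hQn κ t ht (hκ.mono_order (Nat.le_succ n)) hlow
    have hne : ∀ x ∈ t, κ x ≠ 0 := fun x hx h0 => by
      have := hlow x hx; rw [h0, abs_zero] at this; linarith [inv_pos.2 hB]
    have hdκ : ∀ x ∈ t, DifferentiableAt ℝ κ x := fun x hx =>
      (hκ.1.differentiableOn (by simp)).differentiableAt (ht.mem_nhds hx)
    have hder : ∀ x ∈ t, HasDerivAt (fun x => (κ x)⁻¹) (-(deriv κ x) / κ x ^ 2) x := fun x hx =>
      (hdκ x hx).hasDerivAt.fun_inv (hne x hx)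
    refine succ ht (fun x hx => (hder x hx).differentiableAt.differentiableWithinAt)
      (fun x hx => (h1.abs_le hx).trans (le_max_left _ _)) ?_
    have h2 := ((hκ.deriv_of_succ ht).neg ht).mul ht (h1.mul ht h1 (by linarith) (by linarith)) hB.le
      (by positivity)
    refine (h2.congr fun x hx => ?_).mono_const (le_max_right _ _)
    rw [(hder x hx).deriv, div_eq_mul_inv, pow_two, mul_inv]

/-- Bound for the solution of an autonomous equation. -/
theorem exists_of_hasDerivAt_comp (n : ℕ) (Q : ℝ) (hQ : 1 ≤ Q) : ∃ C, 1 ≤ C ∧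
    ∀ (q β : ℝ → ℝ) (s t : Set ℝ), IsOpen s → IsOpen t → CkNormLE n q t Q → MapsTo β s t →
    (∀ x ∈ s, |β x| ≤ 1) → (∀ x ∈ s, HasDerivAt β (q (β x)) x) → CkNormLE (n + 1) β s C := by
  induction n with
  | zero =>
    refine ⟨Q, hQ, fun q β s t hs ht hq hst hβ hder => ?_⟩
    refine succ hs (fun x hx => (hder x hx).differentiableAt.differentiableWithinAt)
      (fun x hx => (hβ x hx).trans hQ) ?_
    have hc : CkNormLE 0 (q ∘ β) s Q := zero_iff
      (hq.1.continuousOn.comp (fun x hx => (hder x hx).continuousAt.continuousWithinAt) hst)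
      (fun x hx => hq.abs_le (hst hx))
    exact hc.congr fun x hx => (hder x hx).deriv
  | succ n ih =>
    obtain ⟨C, hC, hCn⟩ := ih
    refine ⟨max C ((n + 1).factorial * Q * C ^ (n + 1)), le_max_of_le_left hC,
      fun q β s t hs ht hq hst hβ hder => ?_⟩
    -- Bootstrap: a `C^(n+1)` bound on `β` gives one on `q ∘ β`, which is the derivative of `β`.
    have h1 := hCn q β s t hs ht (hq.mono_order (Nat.le_succ n)) hst hβ hder
    refine succ hs (fun x hx => (hder x hx).differentiableAt.differentiableWithinAt)
      (fun x hx => (hβ x hx).trans (hC.trans (le_max_left _ _))) ?_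
    refine ((comp hs ht hq h1 hst (by linarith) hC).congr fun x hx => ?_).mono_const
      (le_max_right _ _)
    exact (hder x hx).deriv

end CkNormLE

/-! ### Local inverses and graphs -/

/-- Quantitative inverse function theorem on the line. -/
theorem exists_local_inverse {h : ℝ → ℝ} {L r s : ℝ} (hL : 0 < L) (hs : s = 1 ∨ s = -1)
    (hd : Differentiable ℝ h) (h0 : h 0 = 0) (hlow : ∀ b, |b| ≤ r → L⁻¹ ≤ s * deriv h b) :
    ∃ β : ℝ → ℝ, ∀ ρ, |ρ| < r / L → |β ρ| ≤ L * |ρ| ∧ h (β ρ) = ρ ∧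
      HasDerivAt β (deriv h (β ρ))⁻¹ ρ := by
  have hsh : Continuous fun x => s * h x := continuous_const.mul hd.continuous
  have hexp : ∀ a b, |a| ≤ r → |b| ≤ r → a ≤ b → L⁻¹ * (b - a) ≤ s * h b - s * h a := by
    intro a b ha hb hab
    refine Convex.mul_sub_le_image_sub_of_le_deriv (D := Icc (-r) r) (f := fun x => s * h x)
      (convex_Icc _ _) hsh.continuousOn
      (hd.const_mul s).differentiableOn (fun x hx => ?_) a (abs_le.1 ha) b (abs_le.1 hb)
      hab
    rw [deriv_const_mul _ (hd x)]
    have hx' : x ∈ Icc (-r) r := interior_subset hx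
    exact hlow x (abs_le.2 hx')
  have hss : s * s = 1 := by rcases hs with rfl | rfl <;> norm_num
  have hex : ∀ ρ, |ρ| < r / L → ∃ b, |b| ≤ L * |ρ| ∧ h b = ρ := by
    intro ρ hρ
    have hLr : L * |ρ| ≤ r := by rw [lt_div_iff₀ hL] at hρ; linarith
    have hn : 0 ≤ L * |ρ| := by positivity
    have h1 := hexp 0 (L * |ρ|) (by rw [abs_zero]; linarith) (by rwa [abs_of_nonneg hn]) hn
    have h2 := hexp (-(L * |ρ|)) 0 (by rwa [abs_neg, abs_of_nonneg hn])
      (by rw [abs_zero]; linarith) (by linarith)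
    have h3 : L⁻¹ * (L * |ρ|) = |ρ| := by field_simp
    rw [h0] at h1 h2
    have hsr : |s * ρ| = |ρ| := by rcases hs with rfl | rfl <;> simp
    have h4 := abs_le.1 hsr.le
    -- Monotonicity with slope at least `L⁻¹` makes `s * h` cover `[-|ρ|, |ρ|]` on the interval of
    -- radius `L * |ρ|`, which also yields the bound on `β ρ`.
    obtain ⟨b, hb, hbρ⟩ := intermediate_value_Icc (a := -(L * |ρ|)) (b := L * |ρ|)
      (f := fun x => s * h x) (by linarith) hsh.continuousOn
      (show s * ρ ∈ Icc (s * h (-(L * |ρ|))) (s * h (L * |ρ|)) from ⟨by linarith, by linarith⟩)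
    refine ⟨b, abs_le.2 hb, ?_⟩
    have := congrArg (s * ·) hbρ
    simpa [← mul_assoc, hss] using this
  choose! β hβ using hex
  refine ⟨β, fun ρ hρ => ⟨(hβ ρ hρ).1, (hβ ρ hρ).2, ?_⟩⟩
  have hin : ∀ x, |x| < r / L → |β x| ≤ r := fun x hx => by
    refine (hβ x hx).1.trans ?_
    rw [lt_div_iff₀ hL] at hx; linarith
  have hlip : ∀ x, |x| < r / L → |β x - β ρ| ≤ L * |x - ρ| := by
    intro x hx
    have hsr : |s * x - s * ρ| = |x - ρ| := by
      rw [← mul_sub, abs_mul]; rcases hs with rfl | rfl <;> simp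
    have key : ∀ u v : ℝ, L⁻¹ * u ≤ v → u ≤ L * v := fun u v huv => by
      rwa [inv_mul_le_iff₀ hL] at huv
    rcases le_total (β x) (β ρ) with hle | hle
    · have h1 := key _ _ (hexp _ _ (hin x hx) (hin ρ hρ) hle)
      rw [(hβ x hx).2, (hβ ρ hρ).2] at h1
      rw [abs_sub_comm, abs_of_nonneg (by linarith), ← hsr, abs_sub_comm]
      exact h1.trans (by gcongr; exact le_abs_self _)
    · have h1 := key _ _ (hexp _ _ (hin ρ hρ) (hin x hx) hle)
      rw [(hβ x hx).2, (hβ ρ hρ).2] at h1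
      rw [abs_of_nonneg (by linarith), ← hsr]
      exact h1.trans (by gcongr; exact le_abs_self _)
  have hev : ∀ᶠ x in 𝓝 ρ, |x| < r / L := by
    have : ContinuousAt (fun x : ℝ => |x|) ρ := by fun_prop
    exact this.eventually_lt continuousAt_const hρ
  have hcont : ContinuousAt β ρ := by
    rw [ContinuousAt, tendsto_iff_dist_tendsto_zero]
    have h1 : Tendsto (fun x => L * |x - ρ|) (𝓝 ρ) (𝓝 0) := by
      have : Continuous fun x => L * |x - ρ| := by fun_prop
      simpa using this.tendsto ρ
    refine squeeze_zero' (Eventually.of_forall fun x => dist_nonneg) ?_ h1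
    filter_upwards [hev] with x hx
    rw [Real.dist_eq]; exact hlip x hx
  refine HasDerivAt.of_local_left_inverse hcont (hd _).hasDerivAt ?_ ?_
  · intro hz
    have := hlow _ (hin ρ hρ)
    rw [hz, mul_zero] at this
    linarith [inv_pos.2 hL]
  · filter_upwards [hev] with x hx using (hβ x hx).2

/-- Scalar components of a shifted regular curve satisfy the bounds of the curve. -/
theorem IsRegularCurve.ckNormLE_component {M : ℝ} {ζ : ℝ → Plane} (h : IsRegularCurve M ζ)
    {w : Plane} (hw : ‖w‖ = 1) (α : ℝ) (m : Plane) {t : Set ℝ} (ht : IsOpen t) {B : ℝ} (hMB : M ≤ B)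
    (hB : ∀ b ∈ t, |(inner ℝ (ζ (α + b) - m) w : ℝ)| ≤ B) :
    CkNormLE 4 (fun b => (inner ℝ (ζ (α + b) - m) w : ℝ)) t B := by
  have hder : ∀ k, k ≤ 3 → ∀ b, HasDerivAt (iteratedDeriv k ζ) (iteratedDeriv (k + 1) ζ b) b := by
    intro k hk b
    rw [iteratedDeriv_succ]
    refine ((h.contDiff.differentiable_iteratedDeriv k ?_) b).hasDerivAt
    exact_mod_cast Nat.lt_of_le_of_lt hk (by norm_num)
  have hder' : ∀ k, k ≤ 3 → ∀ b, HasDerivAt (fun b => (inner ℝ (iteratedDeriv k ζ (α + b)) w : ℝ))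
      (inner ℝ (iteratedDeriv (k + 1) ζ (α + b)) w) b := by
    intro k hk b
    have h1 := (hder k hk (α + b)).scomp b ((hasDerivAt_id b).const_add α)
    have h2 := h1.inner ℝ (hasDerivAt_const b w)
    simpa using h2
  have hbd : ∀ k, 1 ≤ k → k ≤ 4 → ∀ b, |(inner ℝ (iteratedDeriv k ζ (α + b)) w : ℝ)| ≤ B := by
    intro k hk1 hk4 b
    refine (abs_real_inner_le_norm _ _).trans ?_
    rw [hw, mul_one]
    exact (h.deriv_le k hk1 hk4 _).trans hMB
  have h4 : CkNormLE 0 (fun b => (inner ℝ (iteratedDeriv 4 ζ (α + b)) w : ℝ)) t B := by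
    refine CkNormLE.zero_iff ?_ fun b _ => hbd 4 (by norm_num) le_rfl b
    have := h.contDiff.continuous_iteratedDeriv 4 (by norm_num)
    exact Continuous.continuousOn (by fun_prop)
  have step : ∀ n k, 1 ≤ k → k ≤ 3 →
      CkNormLE n (fun b => (inner ℝ (iteratedDeriv (k + 1) ζ (α + b)) w : ℝ)) t B →
      CkNormLE (n + 1) (fun b => (inner ℝ (iteratedDeriv k ζ (α + b)) w : ℝ)) t B := by
    intro n k hk1 hk3 hk
    refine CkNormLE.succ ht (fun b _ => (hder' k hk3 b).differentiableAt.differentiableWithinAt)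
      (fun b _ => hbd k hk1 (by omega) b) (hk.congr fun b _ => (hder' k hk3 b).deriv)
  have h1 := step 2 1 le_rfl (by norm_num) (step 1 2 (by norm_num) (by norm_num)
    (step 0 3 (by norm_num) le_rfl h4))
  have hder0 : ∀ b, HasDerivAt (fun b => (inner ℝ (ζ (α + b) - m) w : ℝ))
      (inner ℝ (iteratedDeriv 1 ζ (α + b)) w) b := fun b => by
    have := hder' 0 (by norm_num) b
    simp only [iteratedDeriv_zero, zero_add] at this
    simpa only [inner_sub_left] using this.sub_const (inner ℝ m w)
  exact CkNormLE.succ ht (fun b _ => (hder0 b).differentiableAt.differentiableWithinAt) hB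
    (h1.congr fun b _ => (hder0 b).deriv)

/-- Near a point where its tangent is orthogonal to `e`, a regular curve is a graph over the line
through `m` orthogonal to `e`, with quantitative bounds. -/
theorem exists_graph (M : ℝ) (hM1 : 1 ≤ M) : ∃ C, 1 ≤ C ∧ ∀ (ζ : ℝ → Plane), IsRegularCurve M ζ →
    ∀ (α : ℝ) (e τ m : Plane), ‖e‖ = 1 → (τ = perp e ∨ τ = -perp e) →
    inner ℝ (deriv ζ α) e = (0 : ℝ) → inner ℝ (ζ α - m) τ = (0 : ℝ) →
    |(inner ℝ (ζ α - m) e : ℝ)| ≤ 1 →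
    ∃ (β f : ℝ → ℝ) (s : ℝ), (s = 1 ∨ s = -1) ∧ inner ℝ (deriv ζ α) τ = s * ‖deriv ζ α‖ ∧
      β 0 = 0 ∧ f 0 = inner ℝ (ζ α - m) e ∧ deriv f 0 = 0 ∧
      CkNormLE 4 β (Ioo (-(1 / (4 * M ^ 3))) (1 / (4 * M ^ 3))) C ∧
      CkNormLE 4 f (Ioo (-(1 / (4 * M ^ 3))) (1 / (4 * M ^ 3))) C ∧
      ∀ ρ ∈ Ioo (-(1 / (4 * M ^ 3))) (1 / (4 * M ^ 3)),
        |β ρ| ≤ 2 * M * |ρ| ∧ ζ (α + β ρ) = m + ρ • τ + f ρ • e ∧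
        |f ρ - f 0| ≤ M * (2 * M * |ρ|) ^ 2 ∧
        deriv β ρ = (inner ℝ (deriv ζ (α + β ρ)) τ)⁻¹ ∧
        1 / (2 * M) ≤ s * inner ℝ (deriv ζ (α + β ρ)) τ := by
  -- The inverse `β` of the coordinate `H` along `τ` solves `β' = (H')⁻¹ ∘ β`. So `Q` bounds the
  -- reciprocal of `H'`, `C` bounds `β`, and the factorial term in the maximum bounds the
  -- composition of the height with `β`.
  obtain ⟨Q, hQ, hQinv⟩ := CkNormLE.exists_inv 3 (2 * M) (by linarith)
  obtain ⟨C, hC, hCβ⟩ := CkNormLE.exists_of_hasDerivAt_comp 3 Q hQ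
  refine ⟨max C (Nat.factorial 4 * (2 * M) * C ^ 4), le_max_of_le_left hC, ?_⟩
  intro ζ h α e τ m he hτ ho hoff hheight
  have hM := h.pos
  have hτn : ‖τ‖ = 1 := by rcases hτ with rfl | rfl <;> simp [norm_perp, he]
  have hτe : inner ℝ e τ = (0 : ℝ) := by
    rcases hτ with rfl | rfl <;> simp [inner_perp_self]
  have hexpand : ∀ x : Plane, x = (inner ℝ x τ : ℝ) • τ + (inner ℝ x e : ℝ) • e := by
    intro x
    conv_lhs => rw [plane_expand he x]
    rcases hτ with rfl | rfl <;> simp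
  obtain ⟨s, hs, hsα, hsβ⟩ : ∃ s : ℝ, (s = 1 ∨ s = -1) ∧
      inner ℝ (deriv ζ α) τ = s * ‖deriv ζ α‖ ∧
      ∀ β, |β - α| ≤ 1 / (2 * M ^ 2) → 1 / (2 * M) ≤ s * inner ℝ (deriv ζ β) τ := by
    obtain ⟨s, hs, h1, h2⟩ := h.exists_sign he ho
    rcases hτ with rfl | rfl
    · exact ⟨s, hs, h1, h2⟩
    · refine ⟨-s, by rcases hs with rfl | rfl <;> simp, ?_, fun β hβ => ?_⟩
      · rw [inner_neg_right, h1]; ring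
      · rw [inner_neg_right]; have := h2 β hβ; linarith
  -- Within `r` of `α` the derivative of the coordinate along `τ` is at least `1 / (2 * M)` in
  -- absolute value; `r₀ = r / (2 * M)` is then the radius on which the inverse is defined.
  set r : ℝ := 1 / (2 * M ^ 2) with hr
  set r₀ : ℝ := 1 / (4 * M ^ 3) with hr₀
  have hr1 : r ≤ 1 := by
    rw [hr, div_le_one (by positivity)]; nlinarith
  have hrr : r / (2 * M) = r₀ := by rw [hr, hr₀]; field_simp; norm_num
  set H : ℝ → ℝ := fun b => inner ℝ (ζ (α + b) - m) τ with hH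
  have hderw : ∀ (w : Plane) b, HasDerivAt (fun b => (inner ℝ (ζ (α + b) - m) w : ℝ))
      (inner ℝ (deriv ζ (α + b)) w) b := by
    intro w b
    have h1 := (h.hasDerivAt (α + b)).scomp b ((hasDerivAt_id b).const_add α)
    simpa using (h1.sub_const m).inner ℝ (hasDerivAt_const b w)
  have hHd : ∀ b, deriv H b = inner ℝ (deriv ζ (α + b)) τ := fun b => (hderw τ b).deriv
  have hLinv : (2 * M)⁻¹ = 1 / (2 * M) := (one_div _).symm
  have hlow : ∀ b, |b| ≤ r → (2 * M)⁻¹ ≤ s * deriv H b := fun b hb => by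
    rw [hHd, hLinv]; exact hsβ _ (by simpa using hb)
  obtain ⟨β, hβ⟩ := exists_local_inverse (h := H) (L := 2 * M) (r := r) (by linarith) hs
    (fun b => (hderw τ b).differentiableAt) (by simpa [hH] using hoff) hlow
  rw [hrr] at hβ
  set I := Ioo (-r₀) r₀ with hI
  have hIabs : ∀ ρ ∈ I, |ρ| < r₀ := fun ρ hρ => abs_lt.2 hρ
  have hr₀pos : 0 < r₀ := by positivity
  have h0I : (0 : ℝ) ∈ I := ⟨by linarith, hr₀pos⟩
  have hβr : ∀ ρ ∈ I, |β ρ| < r := fun ρ hρ => by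
    refine (hβ ρ (hIabs ρ hρ)).1.trans_lt ?_
    have := hIabs ρ hρ
    rw [← hrr, lt_div_iff₀ (by linarith)] at this
    linarith
  have hβ0 : β 0 = 0 := by
    have := (hβ 0 (hIabs 0 h0I)).1
    simpa using this
  have hmaps : MapsTo β I (Ioo (-r) r) := fun ρ hρ => abs_lt.1 (hβr ρ hρ)
  have hcomp : ∀ w : Plane, ‖w‖ = 1 → |(inner ℝ (ζ α - m) w : ℝ)| ≤ 1 →
      CkNormLE 4 (fun b => (inner ℝ (ζ (α + b) - m) w : ℝ)) (Ioo (-r) r) (2 * M) := by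
    intro w hw hwα
    refine h.ckNormLE_component hw α m isOpen_Ioo (by linarith) fun b hb => ?_
    have h1 : |(inner ℝ (ζ (α + b) - ζ α) w : ℝ)| ≤ M * 1 := by
      refine (abs_real_inner_le_norm _ _).trans ?_
      rw [hw, mul_one]
      refine (h.chord_le _ _).trans ?_
      have : |b| ≤ r := (abs_lt.2 hb).le
      gcongr
      simpa using this.trans hr1
    have h2 : ζ (α + b) - m = (ζ (α + b) - ζ α) + (ζ α - m) := by module
    rw [h2, inner_add_left]
    refine (abs_add_le _ _).trans ?_
    linarith
  have hH4 := hcomp τ hτn (by rw [hoff]; simp)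
  have hk4 := hcomp e he hheight
  have hq := hQinv (deriv H) (Ioo (-r) r) isOpen_Ioo (hH4.deriv_of_succ isOpen_Ioo) (by
    intro b hb
    refine (hlow b (abs_lt.2 hb).le).trans ?_
    rcases hs with rfl | rfl
    · rw [one_mul]; exact le_abs_self _
    · rw [neg_one_mul]; exact neg_le_abs _)
  have hβ4 := hCβ _ β I _ isOpen_Ioo isOpen_Ioo hq hmaps
    (fun ρ hρ => (hβr ρ hρ).le.trans hr1) (fun ρ hρ => (hβ ρ (hIabs ρ hρ)).2.2)
  have hf4 := CkNormLE.comp isOpen_Ioo isOpen_Ioo hk4 hβ4 hmaps (by linarith) hC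
  set f : ℝ → ℝ := (fun b => (inner ℝ (ζ (α + b) - m) e : ℝ)) ∘ β with hf
  have hf0 : f 0 = inner ℝ (ζ α - m) e := by simp [hf, hβ0]
  refine ⟨β, f, s, hs, hsα, hβ0, hf0, ?_, hβ4.mono_const (le_max_left _ _),
    hf4.mono_const (le_max_right _ _), fun ρ hρ => ?_⟩
  · have h1 := (hderw e (β 0)).comp 0 (hβ 0 (hIabs 0 h0I)).2.2
    rw [h1.deriv, hβ0, add_zero, ho, zero_mul]
  · obtain ⟨h1, h2, h3⟩ := hβ ρ (hIabs ρ hρ)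
    refine ⟨h1, ?_, ?_, by rw [h3.deriv, hHd], hsβ _ (by simpa using (hβr ρ hρ).le)⟩
    · have h4 := hexpand (ζ (α + β ρ) - m)
      rw [show (inner ℝ (ζ (α + β ρ) - m) τ : ℝ) = ρ from h2,
        show (inner ℝ (ζ (α + β ρ) - m) e : ℝ) = f ρ from rfl] at h4
      rw [add_assoc, ← h4]; module
    · have h5 : f ρ - f 0
          = inner ℝ (ζ (α + β ρ) - ζ α - (α + β ρ - α) • deriv ζ α) e := by
        rw [hf0]
        simp only [hf, Function.comp, inner_sub_left, inner_smul_left, ho]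
        simp
      rw [h5]
      refine (abs_real_inner_le_norm _ _).trans ?_
      rw [he, mul_one]
      refine (h.norm_sub_sub_le _ _).trans ?_
      rw [add_sub_cancel_left]
      gcongr

/-- Near `α`, the curve `ζ` is the graph of `f` over the line through `m` in the direction `τ`, with
parameter `α + β`. -/
structure IsLocalGraph (M : ℝ) (ζ : ℝ → Plane) (α : ℝ) (e τ m : Plane) (β f : ℝ → ℝ) : Prop where
  param_le : ∀ ρ, |ρ| < 1 / (4 * M ^ 3) → |β ρ| ≤ 2 * M * |ρ|
  eq : ∀ ρ, |ρ| < 1 / (4 * M ^ 3) → ζ (α + β ρ) = m + ρ • τ + f ρ • e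
  height_le : ∀ ρ, |ρ| < 1 / (4 * M ^ 3) → |f ρ - f 0| ≤ M * (2 * M * |ρ|) ^ 2
  continuousOn : ContinuousOn f (Ioo (-(1 / (4 * M ^ 3))) (1 / (4 * M ^ 3)))

theorem plane_expand' {e τ : Plane} (he : ‖e‖ = 1) (hτ : τ = perp e ∨ τ = -perp e) (x : Plane) :
    x = (inner ℝ x τ : ℝ) • τ + (inner ℝ x e : ℝ) • e := by
  conv_lhs => rw [plane_expand he x]
  rcases hτ with rfl | rfl <;> simp

theorem inner_frame {e τ : Plane} (he : ‖e‖ = 1) (hτ : τ = perp e ∨ τ = -perp e) (a b : ℝ) :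
    inner ℝ (a • τ + b • e) τ = a ∧ inner ℝ (a • τ + b • e) e = b := by
  have h1 : inner ℝ e (perp e) = (0 : ℝ) := inner_perp_self e
  have h2 : inner ℝ (perp e) e = (0 : ℝ) := by rw [real_inner_comm, h1]
  rcases hτ with rfl | rfl <;>
    simp [inner_add_left, inner_smul_left, norm_perp, he, h1, h2]

namespace IsLocalGraph

variable {M : ℝ} {ζ : ℝ → Plane} {α : ℝ} {e τ m : Plane} {β f : ℝ → ℝ}

/-- A point of the curve on the graph has the corresponding parameter. -/
theorem eq_param (hg : IsLocalGraph M ζ α e τ m β f) (h : IsRegularCurve M ζ) (he : ‖e‖ = 1)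
    (hτ : τ = perp e ∨ τ = -perp e) {γ : ℝ}
    (hX : |(inner ℝ (ζ γ - m) τ : ℝ)| < 1 / (4 * M ^ 3))
    (hY : inner ℝ (ζ γ - m) e = f (inner ℝ (ζ γ - m) τ)) :
    γ = α + β (inner ℝ (ζ γ - m) τ) := by
  apply h.injective
  rw [hg.eq _ hX]
  have := plane_expand' he hτ (ζ γ - m)
  rw [hY] at this
  rw [add_assoc, ← this]; module

end IsLocalGraph

/-! ### The gap and the region between the two graphs of a minimal pair. -/

namespace IsMinimalPair

variable {M ε δ : ℝ} {ζ : ℝ → Plane} {U V : Set Plane} {α₁ α₂ : ℝ} {τ m : Plane}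
  {β₁ β₂ f₁ f₂ : ℝ → ℝ}

/-- The vertical gap between the two graphs of a minimal pair is at least the distance of the pair. -/
theorem le_gap (hp : IsMinimalPair ζ ε α₁ α₂) (h : IsRegularCurve M ζ) (hε : 0 < ε)
    (hεM : ε ≤ 1 / (16 * M ^ 2))
    (hg₁ : IsLocalGraph M ζ α₁ (direction ζ α₁ α₂) τ m β₁ f₁)
    (hg₂ : IsLocalGraph M ζ α₂ (direction ζ α₁ α₂) τ m β₂ f₂)
    (hf₁ : f₁ 0 = -(‖ζ α₂ - ζ α₁‖ / 2)) (hf₂ : f₂ 0 = ‖ζ α₂ - ζ α₁‖ / 2)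
    (hδM : δ ≤ 1 / (128 * M ^ 4)) (hδε : δ ≤ ε / (16 * M)) {ρ : ℝ} (hρ : |ρ| < δ) :
    ‖ζ α₂ - ζ α₁‖ ≤ f₂ ρ - f₁ ρ := by
  have hM := h.pos
  have hpos := hp.norm_pos h hε
  have hδr : δ < 1 / (4 * M ^ 3) := by
    refine hδM.trans_lt ?_
    apply one_div_lt_one_div_of_lt (by positivity)
    have : M ^ 3 * 1 ≤ M ^ 3 * M := by gcongr; exact h.one_le
    nlinarith [pow_pos hM 3]
  -- The two graph points over the same `x` have parameters within `ε / 8` of `α₁` and `α₂`, so they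
  -- still compete in the minimization. The sign of the gap follows by continuity: it is positive at
  -- 0 and cannot vanish.
  have habs : ∀ x, |x| < δ → ‖ζ α₂ - ζ α₁‖ ≤ |f₂ x - f₁ x| := by
    intro x hx
    have hxr := hx.trans hδr
    have h1 : ζ (α₁ + β₁ x) - ζ (α₂ + β₂ x) = (f₁ x - f₂ x) • direction ζ α₁ α₂ := by
      rw [hg₁.eq x hxr, hg₂.eq x hxr]; module
    have h2 : ‖ζ (α₁ + β₁ x) - ζ (α₂ + β₂ x)‖ = |f₂ x - f₁ x| := by
      rw [h1, norm_smul, hp.norm_direction h hε, mul_one, Real.norm_eq_abs, abs_sub_comm]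
    rw [← h2, norm_sub_rev (ζ α₂)]
    have h3 : 2 * M * |x| ≤ ε / 8 := by
      calc 2 * M * |x| ≤ 2 * M * (ε / (16 * M)) := by gcongr; exact hx.le.trans hδε
        _ = ε / 8 := by field_simp; norm_num
    have b1 := (hg₁.param_le x hxr).trans h3
    have b2 := (hg₂.param_le x hxr).trans h3
    have h5 : |α₁ + β₁ x - (α₂ + β₂ x) - (α₁ - α₂)| ≤ ε / 4 := by
      rw [show α₁ + β₁ x - (α₂ + β₂ x) - (α₁ - α₂) = β₁ x - β₂ x by ring]
      have := abs_sub (β₁ x) (β₂ x); linarith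
    have h6 := abs_sub_abs_le_abs_sub (α₁ + β₁ x - (α₂ + β₂ x)) (α₁ - α₂)
    have h7 := abs_sub_abs_le_abs_sub (α₁ - α₂) (α₁ + β₁ x - (α₂ + β₂ x))
    rw [abs_sub_comm (α₁ - α₂)] at h7
    have h8 := hp.scale
    have h9 := h.four_mul_le_inv hε hεM
    have h10 := h.lt_one_of_le hεM
    exact hp.le _ _ ⟨by linarith [h8.1], by linarith [h8.2, h.one_le]⟩
  have hδ0 : 0 < δ := (abs_nonneg ρ).trans_lt hρ
  have hcont : ContinuousOn (fun x => f₂ x - f₁ x) (Ioo (-δ) δ) :=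
    (hg₂.continuousOn.sub hg₁.continuousOn).mono (Ioo_subset_Ioo (by linarith) hδr.le)
  have hposg : ∀ x ∈ Ioo (-δ) δ, 0 < f₂ x - f₁ x := by
    by_contra! hc
    obtain ⟨x, hx, hx0⟩ := hc
    obtain ⟨y, hy, hy0⟩ := isPreconnected_Ioo.intermediate_value hx
      (show (0 : ℝ) ∈ Ioo (-δ) δ from ⟨by linarith, hδ0⟩) hcont
      (show (0 : ℝ) ∈ Icc _ _ from ⟨hx0, by simp only [hf₁, hf₂]; linarith⟩)
    have := habs y (abs_lt.2 hy)
    simp only at hy0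
    rw [hy0, abs_zero] at this
    linarith
  have := habs ρ hρ
  rwa [abs_of_pos (hposg ρ (abs_lt.1 hρ))] at this

set_option maxHeartbeats 1000000 in
/-- No part of the curve enters the region between the two graphs of a minimal pair. -/
theorem notMem_between (hp : IsMinimalPair ζ ε α₁ α₂) (h : IsRegularCurve M ζ) (hε : 0 < ε)
    (hεM : ε ≤ 1 / (16 * M ^ 2)) (hτ : τ = perp (direction ζ α₁ α₂) ∨ τ = -perp (direction ζ α₁ α₂))
    (hm : m = midpoint ℝ (ζ α₁) (ζ α₂))
    (hg₁ : IsLocalGraph M ζ α₁ (direction ζ α₁ α₂) τ m β₁ f₁)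
    (hg₂ : IsLocalGraph M ζ α₂ (direction ζ α₁ α₂) τ m β₂ f₂)
    (hf₁ : f₁ 0 = -(‖ζ α₂ - ζ α₁‖ / 2)) (hf₂ : f₂ 0 = ‖ζ α₂ - ζ α₁‖ / 2)
    (hδM : δ ≤ 1 / (128 * M ^ 4)) (hδε : δ ≤ ε / (16 * M)) (hd : ‖ζ α₂ - ζ α₁‖ ≤ δ / (8 * M))
    (γ : ℝ) (hX : |(inner ℝ (ζ γ - m) τ : ℝ)| < δ)
    (hY : inner ℝ (ζ γ - m) (direction ζ α₁ α₂) ∈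
      Ioo (f₁ (inner ℝ (ζ γ - m) τ)) (f₂ (inner ℝ (ζ γ - m) τ))) : False := by
  set e := direction ζ α₁ α₂ with hedef
  set d := ‖ζ α₂ - ζ α₁‖ with hddef
  have hM := h.pos
  have hM1 := h.one_le
  have hpos : 0 < d := hp.norm_pos h hε
  have he : ‖e‖ = 1 := hp.norm_direction h hε
  have hτn : ‖τ‖ = 1 := by rcases hτ with rfl | rfl <;> simp [norm_perp, he]
  have hδ0 : 0 < δ := (abs_nonneg _).trans_lt hX
  have hM4 : δ * (128 * M ^ 4) ≤ 1 := by rwa [le_div_iff₀ (by positivity)] at hδM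
  have hMε : δ * (16 * M) ≤ ε := by rwa [le_div_iff₀ (by positivity)] at hδε
  have hdM : d * (8 * M) ≤ δ := by rwa [le_div_iff₀ (by positivity)] at hd
  have hM34 : M ^ 3 ≤ M ^ 4 := pow_le_pow_right₀ hM1 (by norm_num)
  have hM24 : M ^ 2 ≤ M ^ 4 := pow_le_pow_right₀ hM1 (by norm_num)
  have hM14 : M ≤ M ^ 4 := le_self_pow₀ hM1 (by norm_num)
  -- Twice `δ`, because following the curve for a parameter length `δ` from a point with `|X| < δ`
  -- may drift that far sideways, and the graphs must be defined there.
  have hδr : 2 * δ < 1 / (4 * M ^ 3) := by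
    rw [lt_div_iff₀ (by positivity)]
    have : δ * M ^ 3 ≤ δ * M ^ 4 := by gcongr
    linarith [mul_pos hδ0 (pow_pos hM 3)]
  have hδ1 : δ ≤ 1 / (2 * M ^ 2) := by
    rw [le_div_iff₀ (by positivity)]
    have : δ * M ^ 2 ≤ δ * M ^ 4 := by gcongr
    linarith [mul_pos hδ0 (pow_pos hM 2)]
  have hMδ1 : M * δ ≤ 1 := by
    have : δ * M ≤ δ * M ^ 4 := by gcongr
    linarith [mul_pos hδ0 hM]
  have hδεle : δ ≤ ε / 16 := by nlinarith
  have hεM' : ε ≤ 1 / (2 * M ^ 2) := hεM.trans (by gcongr; norm_num)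
  set X : ℝ → ℝ := fun γ => inner ℝ (ζ γ - m) τ with hXdef
  set Y : ℝ → ℝ := fun γ => inner ℝ (ζ γ - m) e with hYdef
  have hXc : Continuous X := by have := h.continuous; fun_prop
  have hYc : Continuous Y := by have := h.continuous; fun_prop
  have hder : ∀ w γ, HasDerivAt (fun γ => (inner ℝ (ζ γ - m) w : ℝ)) (inner ℝ (deriv ζ γ) w) γ := by
    intro w γ
    simpa using ((h.hasDerivAt γ).sub_const m).inner ℝ (hasDerivAt_const γ w)
  have hgap : ∀ ρ, |ρ| < δ → d ≤ f₂ ρ - f₁ ρ := fun ρ hρ =>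
    hp.le_gap h hε hεM hg₁ hg₂ hf₁ hf₂ hδM hδε hρ
  have ho₁ : inner ℝ (deriv ζ α₁) e = (0 : ℝ) := hp.inner_deriv_eq_zero h hε
  have ho₂ : inner ℝ (deriv ζ α₂) e = (0 : ℝ) := by
    have := hp.symm.inner_deriv_eq_zero h hε
    rw [direction_comm, inner_neg_right] at this
    linarith
  -- points strictly between the graphs have parameters away from `α₁` and `α₂`
  have hnear : ∀ (α : ℝ) (β f : ℝ → ℝ), IsLocalGraph M ζ α e τ m β f →
      inner ℝ (deriv ζ α) e = (0 : ℝ) → ∀ γ, |X γ| < δ → Y γ ≠ f (X γ) → ε ≤ |γ - α| := by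
    intro α β f hg ho γ hXγ hne
    by_contra! hlt
    have hXr : |X γ| < 1 / (4 * M ^ 3) := by linarith
    have hb := hg.param_le _ hXr
    have h1 : 2 * M * |X γ| ≤ 2 * M * δ := by gcongr
    have hcoord : (inner ℝ (ζ (α + β (X γ)) - m) τ : ℝ) = X γ ∧
        (inner ℝ (ζ (α + β (X γ)) - m) e : ℝ) = f (X γ) := by
      have h2 : ζ (α + β (X γ)) - m = X γ • τ + f (X γ) • e := by rw [hg.eq _ hXr]; module
      rw [h2]; exact inner_frame he hτ _ _
    have h3 : γ = α + β (X γ) := by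
      refine h.eq_of_inner_perp_eq he ho (hlt.le.trans hεM') ?_ ?_
      · rw [add_sub_cancel_left]; linarith
      · have h4 : (inner ℝ (ζ γ) τ : ℝ) = inner ℝ (ζ (α + β (X γ))) τ := by
          have := hcoord.1
          simp only [hXdef, inner_sub_left] at this ⊢
          linarith
        rcases hτ with h5 | h5 <;> rw [h5] at h4
        · exact h4
        · simpa only [inner_neg_right, neg_inj] using h4
    refine hne ?_
    rw [← hcoord.2, ← h3]
  -- points on the graphs have parameters close to `α₁` and `α₂`
  have hclose : ∀ (α : ℝ) (β f : ℝ → ℝ), IsLocalGraph M ζ α e τ m β f →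
      ∀ γ, |X γ| ≤ 2 * δ → Y γ = f (X γ) → |γ - α| ≤ ε / 4 := by
    intro α β f hg γ hXγ hYγ
    have h1 := hg.eq_param h he hτ (hXγ.trans_lt hδr) hYγ
    have h2 := hg.param_le (X γ) (hXγ.trans_lt hδr)
    have h3 : 2 * M * |X γ| ≤ 2 * M * (2 * δ) := by gcongr
    rw [h1, add_sub_cancel_left]
    exact h2.trans (by linarith)
  -- a point between the graphs of minimal horizontal distance to the center
  set Λ : Set ℝ := {x | ((|X x| ≤ |X γ| ∧ f₁ (X x) ≤ Y x) ∧ Y x ≤ f₂ (X x)) ∧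
    (ε / 2 ≤ |x - α₁| ∧ ε / 2 ≤ |x - α₂|)} with hΛ
  have hband : IsClosed {x | |X x| ≤ |X γ|} := isClosed_le (by fun_prop) continuous_const
  have hcon : ∀ f : ℝ → ℝ, ContinuousOn f (Ioo (-(1 / (4 * M ^ 3))) (1 / (4 * M ^ 3))) →
      ContinuousOn (fun x => f (X x)) {x | |X x| ≤ |X γ|} := by
    intro f hf
    refine hf.comp hXc.continuousOn fun x hx => ?_
    have : |X x| ≤ |X γ| := hx
    exact abs_lt.1 (by linarith)
  have hΛc : IsClosed Λ := by
    have h1 := hband.isClosed_le (hcon f₁ hg₁.continuousOn) hYc.continuousOn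
    have h2 := h1.isClosed_le (hYc.continuousOn (s := _))
      ((hcon f₂ hg₂.continuousOn).mono fun x hx => hx.1)
    have h3 : ∀ α : ℝ, IsClosed {x : ℝ | ε / 2 ≤ |x - α|} := fun α =>
      isClosed_le continuous_const (by fun_prop)
    exact h2.inter ((h3 α₁).inter (h3 α₂))
  have hfbd : ∀ (α : ℝ) (β f : ℝ → ℝ), IsLocalGraph M ζ α e τ m β f → ∀ ρ, |ρ| ≤ 2 * δ →
      |f ρ - f 0| ≤ δ / (8 * M) := by
    intro α β f hg ρ hρ
    refine (hg.height_le ρ (hρ.trans_lt hδr)).trans ?_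
    calc M * (2 * M * |ρ|) ^ 2 ≤ M * (2 * M * (2 * δ)) ^ 2 := by gcongr
      _ = (δ * (128 * M ^ 4)) * (δ / (8 * M)) := by field_simp; ring
      _ ≤ 1 * (δ / (8 * M)) := by gcongr
      _ = _ := one_mul _
  have hΛb : Bornology.IsBounded Λ := by
    refine (Metric.isBounded_closedBall (x := γ) (r := 4 * M)).subset fun x hx => ?_
    by_contra hfar
    rw [Metric.mem_closedBall, not_le, Real.dist_eq] at hfar
    have h1 := h.le_norm_sub_of_far hfar.le
    have hb : ∀ y, |X y| ≤ δ → f₁ (X y) ≤ Y y → Y y ≤ f₂ (X y) → |Y y| ≤ d / 2 + δ := by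
      intro y h2 h3 h4
      have l1 := abs_le.1 (hfbd α₁ β₁ f₁ hg₁ (X y) (by linarith))
      have l2 := abs_le.1 (hfbd α₂ β₂ f₂ hg₂ (X y) (by linarith))
      have l3 : δ / (8 * M) ≤ δ := div_le_self hδ0.le (by linarith)
      rw [hf₁] at l1
      rw [hf₂] at l2
      rw [abs_le]
      constructor <;> linarith
    have h2 := hb x (hx.1.1.1.trans hX.le) hx.1.1.2 hx.1.2
    have h3 := hb γ hX.le hY.1.le hY.2.le
    have h4 : ‖ζ x - ζ γ‖ ≤ (|X x| + |Y x|) + (|X γ| + |Y γ|) := by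
      have hn : ∀ y, ‖ζ y - m‖ ≤ |X y| + |Y y| := by
        intro y
        conv_lhs => rw [plane_expand' he hτ (ζ y - m)]
        refine (norm_add_le _ _).trans ?_
        rw [norm_smul, norm_smul, hτn, he, mul_one, mul_one, Real.norm_eq_abs, Real.norm_eq_abs]
      rw [← sub_sub_sub_cancel_right _ _ m]
      exact (norm_sub_le _ _).trans (add_le_add (hn x) (hn γ))
    have h5 : |X x| ≤ |X γ| := hx.1.1.1
    have h6 : δ ≤ 1 / 16 := by have := h.lt_one_of_le hεM; linarith
    have h7 : d ≤ δ := by nlinarith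
    have h8 : |X γ| < δ := hX
    linarith
  have hγΛ : γ ∈ Λ := by
    have h1 := hnear α₁ β₁ f₁ hg₁ ho₁ γ hX hY.1.ne'
    have h2 := hnear α₂ β₂ f₂ hg₂ ho₂ γ hX hY.2.ne
    exact ⟨⟨⟨le_rfl, hY.1.le⟩, hY.2.le⟩, by linarith, by linarith⟩
  have hΛk : IsCompact Λ := Metric.isCompact_of_isClosed_isBounded hΛc hΛb
  obtain ⟨c, hcΛ, hcmin⟩ := hΛk.exists_isMinOn ⟨γ, hγΛ⟩
    (f := fun x => |X x|) (by fun_prop)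
  have hcX : |X c| < δ := hcΛ.1.1.1.trans_lt hX
  have hne₁ : Y c ≠ f₁ (X c) := fun heq => by
    have := hclose α₁ β₁ f₁ hg₁ c (by linarith) heq
    linarith [hcΛ.2.1]
  have hne₂ : Y c ≠ f₂ (X c) := fun heq => by
    have := hclose α₂ β₂ f₂ hg₂ c (by linarith) heq
    linarith [hcΛ.2.2]
  have hc₁ : f₁ (X c) < Y c := lt_of_le_of_ne hcΛ.1.1.2 (Ne.symm hne₁)
  have hc₂ : Y c < f₂ (X c) := lt_of_le_of_ne hcΛ.1.2 hne₂
  have hfar₁ := hnear α₁ β₁ f₁ hg₁ ho₁ c hcX hne₁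
  have hfar₂ := hnear α₂ β₂ f₂ hg₂ ho₂ c hcX hne₂
  have hcat : ∀ f : ℝ → ℝ, ContinuousOn f (Ioo (-(1 / (4 * M ^ 3))) (1 / (4 * M ^ 3))) →
      ContinuousAt (fun x => f (X x)) c := by
    intro f hf
    have h1 : ContinuousAt f (X c) := hf.continuousAt (Ioo_mem_nhds
      (abs_lt.1 (show |X c| < 1 / (4 * M ^ 3) by linarith)).1
      (abs_lt.1 (show |X c| < 1 / (4 * M ^ 3) by linarith)).2)
    exact ContinuousAt.comp (f := X) h1 hXc.continuousAt
  -- At `c` all constraints except the band `|X| ≤ |X γ|` hold strictly, and outside the band `|X|`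
  -- is larger anyway; so `c` is an unconstrained local minimizer.
  have hloc : IsLocalMin (fun x => X x ^ 2) c := by
    have e1 := (hcat f₁ hg₁.continuousOn).eventually_lt hYc.continuousAt hc₁
    have e2 := hYc.continuousAt.eventually_lt (hcat f₂ hg₂.continuousOn) hc₂
    have e3 : ∀ α, ε ≤ |c - α| → ∀ᶠ x in 𝓝 c, ε / 2 < |x - α| := fun α hα => by
      have : ContinuousAt (fun x : ℝ => |x - α|) c := by fun_prop
      exact continuousAt_const.eventually_lt this (by linarith)
    filter_upwards [e1, e2, e3 α₁ hfar₁, e3 α₂ hfar₂] with x h1 h2 h3 h4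
    rw [sq_le_sq]
    by_cases hx : |X x| ≤ |X γ|
    · exact hcmin (show x ∈ Λ from ⟨⟨⟨hx, h1.le⟩, h2.le⟩, h3.le, h4.le⟩)
    · exact hcΛ.1.1.1.trans (not_le.1 hx).le
  have hcrit := hloc.hasDerivAt_eq_zero ((hder τ c).pow 2)
  -- If `X c = 0`, the point `ζ c` lies on the open chord, which misses the curve.
  have hX0 : X c ≠ 0 := by
    intro hz
    have h1 := hc₁
    have h2 := hc₂
    rw [hz, hf₁] at h1
    rw [hz, hf₂] at h2
    refine Set.disjoint_left.1 (hp.disjoint_openSegment h hε hεM ?_) ?_ (mem_range_self c)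
    · rw [norm_sub_rev]
      have := h.lt_one_of_le hεM
      have : d ≤ δ := by nlinarith
      exact this.trans (by linarith)
    · have h3 : ζ c = ζ α₁ + (Y c + d / 2) • e := by
        have h4 := plane_expand' he hτ (ζ c - m)
        rw [show (inner ℝ (ζ c - m) τ : ℝ) = 0 from hz, zero_smul, zero_add] at h4
        have h5 : m = ζ α₁ + (d / 2) • e := by
          have h6 := hp.norm_smul_direction h hε
          rw [hm, midpoint_eq_smul_add, ← sub_eq_zero]
          rw [← sub_eq_zero] at h6
          have : (⅟2 : ℝ) • (ζ α₁ + ζ α₂) - (ζ α₁ + (d / 2) • e)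
              = -(1 / 2 : ℝ) • (d • e - (ζ α₂ - ζ α₁)) := by
            rw [invOf_eq_inv]; module
          rw [this, h6, smul_zero]
        rw [add_smul, add_comm (Y c • e), ← add_assoc, ← h5, ← h4]; module
      rw [h3]
      exact hp.mem_right_of_openSegment h hε Subset.rfl ⟨by linarith, by linarith⟩
  have hX' : inner ℝ (deriv ζ c) τ = (0 : ℝ) := by
    have h1 : (2 : ℝ) * X c * inner ℝ (deriv ζ c) τ = 0 := by simpa using hcrit
    exact (mul_eq_zero.1 h1).resolve_left (mul_ne_zero two_ne_zero hX0)
  -- following the curve vertically from this point one crosses the upper graph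
  have hY' : M⁻¹ ≤ |(inner ℝ (deriv ζ c) e : ℝ)| := by
    have h1 := plane_expand' he hτ (deriv ζ c)
    rw [hX', zero_smul, zero_add] at h1
    have h2 := h.speed c
    rw [h1, norm_smul, he, mul_one, Real.norm_eq_abs] at h2
    exact h2
  obtain ⟨s, hs, hsY⟩ : ∃ s : ℝ, |s| = 1 ∧ M⁻¹ ≤ s * inner ℝ (deriv ζ c) e := by
    rcases abs_choice (inner ℝ (deriv ζ c) e : ℝ) with h1 | h1
    · exact ⟨1, by simp, by rw [one_mul, ← h1]; exact hY'⟩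
    · exact ⟨-1, by simp, by rw [neg_one_mul, ← h1]; exact hY'⟩
  have hstep : ∀ (w : Plane), ‖w‖ = 1 → ∀ b, 0 ≤ b →
      |(inner ℝ (ζ (c + s * b) - m) w : ℝ) - inner ℝ (ζ c - m) w
        - b * (s * inner ℝ (deriv ζ c) w)| ≤ M * b ^ 2 := by
    intro w hw b hb
    have h1 : (inner ℝ (ζ (c + s * b) - m) w : ℝ) - inner ℝ (ζ c - m) w
        - b * (s * inner ℝ (deriv ζ c) w)
        = inner ℝ (ζ (c + s * b) - ζ c - (c + s * b - c) • deriv ζ c) w := by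
      simp only [inner_sub_left, inner_smul_left]
      simp; ring
    rw [h1]
    refine (abs_real_inner_le_norm _ _).trans ?_
    rw [hw, mul_one]
    refine (h.norm_sub_sub_le _ _).trans ?_
    rw [add_sub_cancel_left, abs_mul, hs, one_mul, sq_abs]
  have hXb : ∀ b ∈ Icc 0 δ, |X (c + s * b)| ≤ 2 * δ := by
    intro b hb
    have h1 := hstep τ hτn b hb.1
    rw [hX', mul_zero, mul_zero, sub_zero] at h1
    have h2 := abs_sub_abs_le_abs_sub (X (c + s * b)) (X c)
    have h3 : M * b ^ 2 ≤ δ := by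
      calc M * b ^ 2 ≤ M * δ ^ 2 := by have := hb.1; have := hb.2; gcongr
        _ = (M * δ) * δ := by ring
        _ ≤ 1 * δ := by gcongr
        _ = δ := one_mul _
    linarith
  have hcontφ : ContinuousOn (fun b => Y (c + s * b) - f₂ (X (c + s * b))) (Icc 0 δ) := by
    refine ContinuousOn.sub (Continuous.continuousOn (by fun_prop)) ?_
    refine hg₂.continuousOn.comp (Continuous.continuousOn (by fun_prop)) fun b hb => ?_
    exact abs_lt.1 ((hXb b hb).trans_lt hδr)
  -- In units of `δ / (8 * M)`: the height gains 8 to first order and loses at most 1 to second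
  -- order. The graphs deviate by at most 1 each from their values at 0, and those values are `d ≤ δ
  -- / (8 * M)` apart.
  have hend : f₂ (X (c + s * δ)) ≤ Y (c + s * δ) := by
    have h1 := (abs_le.1 (hstep e he δ hδ0.le)).1
    have h2 := (abs_le.1 (hfbd α₂ β₂ f₂ hg₂ _ (hXb δ ⟨hδ0.le, le_rfl⟩))).2
    have h3 := (abs_le.1 (hfbd α₁ β₁ f₁ hg₁ (X c) (by linarith))).1
    rw [hf₂] at h2
    rw [hf₁] at h3
    have h4 : δ * M⁻¹ ≤ δ * (s * inner ℝ (deriv ζ c) e) := by gcongr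
    have h5 : M * δ ^ 2 ≤ δ / (8 * M) := by
      calc M * δ ^ 2 = (δ * (8 * M ^ 2)) * (δ / (8 * M)) := by field_simp
        _ ≤ 1 * (δ / (8 * M)) := by
            gcongr
            have : δ * M ^ 2 ≤ δ * M ^ 4 := by gcongr
            linarith [mul_pos hδ0 (pow_pos hM 2)]
        _ = _ := one_mul _
    have h6 : δ * M⁻¹ = 8 * (δ / (8 * M)) := by field_simp
    have h7 : 0 < δ / (8 * M) := by positivity
    change f₂ (X (c + s * δ)) ≤ (inner ℝ (ζ (c + s * δ) - m) e : ℝ)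
    have h8 : (inner ℝ (ζ c - m) e : ℝ) = Y c := rfl
    rw [h8] at h1
    linarith
  obtain ⟨b, hb, hb0⟩ := intermediate_value_Icc hδ0.le hcontφ
    (show (0 : ℝ) ∈ Icc _ _ from ⟨by simpa using hc₂.le, by linarith⟩)
  -- A crossing of the upper graph has parameter within `ε / 4` of `α₂`. But `c` is at least `ε`
  -- away from `α₂`, and `b ≤ δ ≤ ε / 16`.
  have h1 := hclose α₂ β₂ f₂ hg₂ (c + s * b) (hXb b hb) (by linarith)
  have h2 := abs_sub_le c (c + s * b) α₂
  have h3 : |c - (c + s * b)| = b := by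
    rw [sub_add_cancel_left, abs_neg, abs_mul, hs, one_mul, abs_of_nonneg hb.1]
  linarith [hb.2]

/-- The region between the two graphs of a minimal pair lies in the inner region. -/
theorem mem_right_between (hp : IsMinimalPair ζ ε α₁ α₂) (h : IsRegularCurve M ζ)
    (hs : IsSplitting ζ U V) (hε : 0 < ε) (hεM : ε ≤ 1 / (16 * M ^ 2))
    (hO : openSegment ℝ (ζ α₁) (ζ α₂) ⊆ V)
    (hτ : τ = perp (direction ζ α₁ α₂) ∨ τ = -perp (direction ζ α₁ α₂))
    (hm : m = midpoint ℝ (ζ α₁) (ζ α₂))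
    (hg₁ : IsLocalGraph M ζ α₁ (direction ζ α₁ α₂) τ m β₁ f₁)
    (hg₂ : IsLocalGraph M ζ α₂ (direction ζ α₁ α₂) τ m β₂ f₂)
    (hf₁ : f₁ 0 = -(‖ζ α₂ - ζ α₁‖ / 2)) (hf₂ : f₂ 0 = ‖ζ α₂ - ζ α₁‖ / 2)
    (hδM : δ ≤ 1 / (128 * M ^ 4)) (hδε : δ ≤ ε / (16 * M)) (hd : ‖ζ α₂ - ζ α₁‖ ≤ δ / (8 * M))
    {ρ y : ℝ} (hρ : |ρ| < δ) (hy : y ∈ Ioo (f₁ ρ) (f₂ ρ)) :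
    m + ρ • τ + y • direction ζ α₁ α₂ ∈ V := by
  set e := direction ζ α₁ α₂ with hedef
  have he : ‖e‖ = 1 := hp.norm_direction h hε
  have hM := h.pos
  have hδ0 : 0 < δ := (abs_nonneg _).trans_lt hρ
  have hδr : δ ≤ 1 / (4 * M ^ 3) := by
    refine hδM.trans ?_
    apply one_div_le_one_div_of_le (by positivity)
    have : M ^ 3 ≤ M ^ 4 := pow_le_pow_right₀ h.one_le (by norm_num)
    nlinarith [pow_pos hM 3]
  have hsub : Ioo (-δ) δ ⊆ Ioo (-(1 / (4 * M ^ 3))) (1 / (4 * M ^ 3)) :=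
    Ioo_subset_Ioo (by linarith) hδr
  -- The relative height in `(0, 1)` turns the region between the graphs into the image of a
  -- rectangle, hence a connected set; it misses the curve and contains `m ∈ V`.
  set g : ℝ × ℝ → Plane := fun p => m + p.1 • τ + (f₁ p.1 + p.2 * (f₂ p.1 - f₁ p.1)) • e with hg
  have hgc : ContinuousOn g (Ioo (-δ) δ ×ˢ Ioo 0 1) := by
    have c1 : ContinuousOn (fun p : ℝ × ℝ => f₁ p.1) (Ioo (-δ) δ ×ˢ Ioo 0 1) :=
      (hg₁.continuousOn.mono hsub).comp continuousOn_fst fun p hp => hp.1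
    have c2 : ContinuousOn (fun p : ℝ × ℝ => f₂ p.1) (Ioo (-δ) δ ×ˢ Ioo 0 1) :=
      (hg₂.continuousOn.mono hsub).comp continuousOn_fst fun p hp => hp.1
    exact (continuousOn_const.add (continuousOn_fst.smul continuousOn_const)).add
      ((c1.add (continuousOn_snd.mul (c2.sub c1))).smul continuousOn_const)
  have hK : IsPreconnected (g '' (Ioo (-δ) δ ×ˢ Ioo 0 1)) :=
    (isPreconnected_Ioo.prod isPreconnected_Ioo).image _ hgc
  have hmV : m ∈ V := by
    rw [hm]
    exact hO (by
      rw [openSegment_eq_image_lineMap]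
      exact ⟨1 / 2, by norm_num, by rw [midpoint, invOf_eq_inv, one_div]⟩)
  have hgap : 0 < f₂ ρ - f₁ ρ := by linarith [hy.1, hy.2]
  have hmem : m + ρ • τ + y • e ∈ g '' (Ioo (-δ) δ ×ˢ Ioo 0 1) := by
    refine ⟨(ρ, (y - f₁ ρ) / (f₂ ρ - f₁ ρ)), ⟨abs_lt.1 hρ, div_pos (by linarith [hy.1]) hgap, ?_⟩, ?_⟩
    · rw [div_lt_one hgap]; linarith [hy.2]
    · simp only [hg]
      rw [div_mul_cancel₀ _ hgap.ne']; congr 2; ring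
  refine hs.symm.subset_left hK ?_ ⟨m, ⟨(0, 1 / 2), ⟨⟨by simpa using hδ0, hδ0⟩, by norm_num⟩, ?_⟩, hmV⟩ hmem
  · rw [Set.disjoint_left]
    rintro _ ⟨⟨x, r⟩, ⟨hx, hr⟩, rfl⟩ ⟨γ, hγ⟩
    have h1 : ζ γ - m = x • τ + (f₁ x + r * (f₂ x - f₁ x)) • e := by rw [hγ, hg]; module
    obtain ⟨h2, h3⟩ := inner_frame he hτ x (f₁ x + r * (f₂ x - f₁ x))
    rw [← h1] at h2 h3
    have hgx := hp.le_gap h hε hεM hg₁ hg₂ hf₁ hf₂ hδM hδε (abs_lt.2 hx)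
    have hpos := hp.norm_pos h hε
    have hr1 : 0 < r := hr.1
    have hr2 : r < 1 := hr.2
    refine hp.notMem_between h hε hεM hτ hm hg₁ hg₂ hf₁ hf₂ hδM hδε hd γ ?_ ?_
    · rw [h2]; exact abs_lt.2 hx
    · rw [h2, h3]; constructor <;> nlinarith
  · simp only [hg, hf₁, hf₂]
    module

end IsMinimalPair

/-! ### Mean value inequality over discs -/

/-- Mean value property on a circle, with angles in `(-π, π)` to match the target of polar
coordinates. -/
theorem integral_angle_eq {W : ℂ → ℂ} {c : ℂ} (hW : DifferentiableOn ℂ W (Metric.ball c 2)) {r : ℝ}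
    (hr : r ∈ Ioo (0 : ℝ) 1) :
    ∫ θ in Ioo (-Real.pi) Real.pi, W (c + r * (Real.cos θ + Real.sin θ * Complex.I))
      = (2 * Real.pi : ℝ) • W c := by
  have hpi := Real.pi_pos
  have hd : DiffContOnCl ℂ W (Metric.ball c |r|) := by
    rw [abs_of_pos hr.1]
    have hsub : Metric.closedBall c r ⊆ Metric.ball c 2 :=
      Metric.closedBall_subset_ball (by linarith [hr.2])
    refine DifferentiableOn.diffContOnCl (hW.mono ?_)
    rw [closure_ball _ hr.1.ne']; exact hsub
  have h1 := hd.circleAverage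
  rw [Real.circleAverage_eq_integral_add (-Real.pi)] at h1
  rw [intervalIntegral.integral_comp_add_right (fun θ => W (circleMap c r θ))] at h1
  rw [← MeasureTheory.integral_Ioc_eq_integral_Ioo, ← intervalIntegral.integral_of_le (by linarith), ← h1,
    smul_smul, mul_inv_cancel₀ (by positivity), one_smul]
  have e1 : 0 + -Real.pi = -Real.pi := by ring
  have e2 : 2 * Real.pi + -Real.pi = Real.pi := by ring
  rw [e1, e2]
  congr 1
  ext θ
  simp [circleMap, Complex.exp_mul_I]

/-- Integrating the circle version against `r dr` over `(0, 1)` gives the solid mean value property;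
radius 2 in the hypothesis leaves room for continuity on the closed unit disc. -/
theorem pi_smul_eq_integral_ball {W : ℂ → ℂ} {c : ℂ}
    (hW : DifferentiableOn ℂ W (Metric.ball c 2)) :
    ∫ z in Metric.ball (0 : ℂ) 1, W (c + z) = Real.pi • W c := by
  have hpi := Real.pi_pos
  have h0 := Complex.integral_comp_polarCoord_symm
    ((Metric.ball (0 : ℂ) 1).indicator fun z => W (c + z))
  rw [MeasureTheory.integral_indicator Metric.isOpen_ball.measurableSet] at h0
  rw [← h0]
  set g : ℝ × ℝ → ℂ := fun p =>
    p.1 • W (c + p.1 * (Real.cos p.2 + Real.sin p.2 * Complex.I)) with hg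
  have h1 : ∫ p in polarCoord.target, p.1 • (Metric.ball (0 : ℂ) 1).indicator
      (fun z => W (c + z)) (Complex.polarCoord.symm p)
      = ∫ p in Ioo (0 : ℝ) 1 ×ˢ Ioo (-Real.pi) Real.pi, g p := by
    have h2 : ∫ p in polarCoord.target, p.1 • (Metric.ball (0 : ℂ) 1).indicator
        (fun z => W (c + z)) (Complex.polarCoord.symm p)
        = ∫ p in polarCoord.target, (Iio (1 : ℝ) ×ˢ (univ : Set ℝ)).indicator g p := by
      refine MeasureTheory.setIntegral_congr_fun polarCoord.open_target.measurableSet fun p hp => ?_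
      have hp1 : 0 < p.1 := hp.1
      have hiff : Complex.polarCoord.symm p ∈ Metric.ball (0 : ℂ) 1 ↔
          p ∈ Iio (1 : ℝ) ×ˢ (univ : Set ℝ) := by
        rw [mem_ball_zero_iff, Complex.norm_polarCoord_symm, abs_of_pos hp1]
        simp
      by_cases h : p ∈ Iio (1 : ℝ) ×ˢ (univ : Set ℝ)
      · simp only [Set.indicator_of_mem h, Set.indicator_of_mem (hiff.2 h), hg]
        rw [Complex.polarCoord_symm_apply]
      · simp only [Set.indicator_of_notMem h, Set.indicator_of_notMem (fun h' => h (hiff.1 h')),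
          smul_zero]
    rw [h2, MeasureTheory.setIntegral_indicator (measurableSet_Iio.prod MeasurableSet.univ),
      polarCoord_target, Set.prod_inter_prod, Set.inter_univ]
    rfl
  rw [h1]
  have hcont : ContinuousOn g (Icc (0 : ℝ) 1 ×ˢ Icc (-Real.pi) Real.pi) := by
    refine continuousOn_fst.smul ?_
    refine hW.continuousOn.comp (Continuous.continuousOn (by fun_prop)) fun p hp => ?_
    have hn : ‖(Real.cos p.2 + Real.sin p.2 * Complex.I : ℂ)‖ = 1 := by
      simp
    rw [mem_ball_iff_norm, add_sub_cancel_left, norm_mul, hn, mul_one, Complex.norm_real,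
      Real.norm_of_nonneg hp.1.1]
    linarith [hp.1.2]
  have hint : MeasureTheory.IntegrableOn g (Ioo (0 : ℝ) 1 ×ˢ Ioo (-Real.pi) Real.pi) :=
    (hcont.integrableOn_compact (isCompact_Icc.prod isCompact_Icc)).mono_set
      (prod_mono Ioo_subset_Icc_self Ioo_subset_Icc_self)
  rw [MeasureTheory.Measure.volume_eq_prod] at hint ⊢
  rw [MeasureTheory.setIntegral_prod _ hint]
  have h3 : ∀ r ∈ Ioo (0 : ℝ) 1, ∫ θ in Ioo (-Real.pi) Real.pi, g (r, θ)
      = r • ((2 * Real.pi : ℝ) • W c) := by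
    intro r hr
    simp only [hg]
    rw [MeasureTheory.integral_smul, integral_angle_eq hW hr]
  rw [MeasureTheory.setIntegral_congr_fun measurableSet_Ioo h3, integral_smul_const,
    ← MeasureTheory.integral_Ioc_eq_integral_Ioo, ← intervalIntegral.integral_of_le zero_le_one, integral_id,
    smul_smul]
  congr 1; ring

/-- Sub-mean value inequality for holomorphic functions with an `L²` type right-hand side. -/
theorem norm_le_of_integral_sq {W : ℂ → ℂ} {c : ℂ} (hW : DifferentiableOn ℂ W (Metric.ball c 2)) :
    ‖W c‖ ≤ 1 + ∫ z in Metric.ball c 1, ‖W z‖ ^ 2 := by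
  have hpi := Real.pi_pos
  have hsub : Metric.closedBall c 1 ⊆ Metric.ball c 2 := Metric.closedBall_subset_ball (by norm_num)
  have hcont : ContinuousOn W (Metric.closedBall c 1) := hW.continuousOn.mono hsub
  have hI : MeasureTheory.IntegrableOn (fun z => ‖W z‖ ^ 2) (Metric.ball c 1) :=
    ((hcont.norm.pow 2).integrableOn_compact (isCompact_closedBall c 1)).mono_set
      Metric.ball_subset_closedBall
  have hI1 : MeasureTheory.IntegrableOn (fun z => ‖W z‖) (Metric.ball c 1) :=
    (hcont.norm.integrableOn_compact (isCompact_closedBall c 1)).mono_set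
      Metric.ball_subset_closedBall
  have htrans : ∫ z in Metric.ball (0 : ℂ) 1, W (c + z) = ∫ z in Metric.ball c 1, W z := by
    have h1 := (MeasureTheory.measurePreserving_add_left
      (MeasureTheory.volume : MeasureTheory.Measure ℂ) c).setIntegral_preimage_emb
      (MeasurableEquiv.addLeft c).measurableEmbedding W (Metric.ball c 1)
    rw [← h1]
    congr 2
    ext z; simp
  have h2 := pi_smul_eq_integral_ball hW
  rw [htrans] at h2
  have hv : MeasureTheory.volume.real (Metric.ball c 1) = Real.pi := by
    rw [MeasureTheory.measureReal_def, Complex.volume_ball]; simp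
  have hc1 : MeasureTheory.Integrable (fun _ : ℂ => (1 : ℝ))
      (MeasureTheory.volume.restrict (Metric.ball c 1)) :=
    MeasureTheory.integrableOn_const (by simp [Complex.volume_ball])
  have h3 : Real.pi * ‖W c‖ ≤ Real.pi + ∫ z in Metric.ball c 1, ‖W z‖ ^ 2 := by
    calc Real.pi * ‖W c‖ = ‖∫ z in Metric.ball c 1, W z‖ := by
          rw [h2, norm_smul, Real.norm_of_nonneg hpi.le]
      _ ≤ ∫ z in Metric.ball c 1, ‖W z‖ := MeasureTheory.norm_integral_le_integral_norm _
      -- The elementary bound `s ≤ 1 + s ^ 2` replaces Cauchy–Schwarz; only finiteness of the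
      -- resulting bound matters later.
      _ ≤ ∫ z in Metric.ball c 1, (1 + ‖W z‖ ^ 2) := by
          refine MeasureTheory.integral_mono hI1 ?_ fun z => ?_
          · exact hc1.add hI
          · nlinarith [sq_nonneg (‖W z‖ - 1), norm_nonneg (W z)]
      _ = Real.pi + ∫ z in Metric.ball c 1, ‖W z‖ ^ 2 := by
          rw [MeasureTheory.integral_add hc1 hI]
          simp [hv]
  have h4 : 0 ≤ ∫ z in Metric.ball c 1, ‖W z‖ ^ 2 := by positivity
  have hpi1 : 1 ≤ Real.pi := by linarith [Real.pi_gt_three]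
  by_contra! hc
  have h5 : Real.pi * (1 + ∫ z in Metric.ball c 1, ‖W z‖ ^ 2) < Real.pi * ‖W c‖ := by gcongr
  nlinarith

/-! ### Gradient bound for irrotational flows -/

/-- A `C¹` map up to the boundary has a gradient which is continuous up to the boundary. -/
theorem exists_gradient_extension {Ω : Set Plane} {u : Plane → Plane} (hΩ : IsOpen Ω)
    (hu : ContDiffOn ℝ 1 u (closure Ω)) :
    ∃ G : Plane → Plane →L[ℝ] Plane, ContinuousOn G (closure Ω) ∧ (∀ x ∈ Ω, G x = fderiv ℝ u x) ∧
      ∀ x ∈ closure Ω, HasFDerivWithinAt u (G x) (closure Ω) x := by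
  -- Derivatives within `closure Ω` need not be unique at a boundary point. The limit of the
  -- interior gradients singles one out, and continuity up to the boundary then comes from
  -- `extendFrom`.
  have key : ∀ x ∈ closure Ω, ∃ L, Tendsto (fderiv ℝ u) (𝓝[Ω] x) (𝓝 L) ∧
      HasFDerivWithinAt u L (closure Ω) x := by
    intro x hx
    have h1 := hu x hx
    rw [show (1 : WithTop ℕ∞) = 0 + 1 by norm_num,
      contDiffWithinAt_succ_iff_hasFDerivWithinAt (by simp)] at h1
    obtain ⟨v, hv, -, f', hf', hc⟩ := h1
    rw [insert_eq_of_mem hx] at hv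
    have hxv : x ∈ v := mem_of_mem_nhdsWithin hx hv
    refine ⟨f' x, ?_, (hf' x hxv).mono_of_mem_nhdsWithin hv⟩
    obtain ⟨O, hO, hxO, hOv⟩ := mem_nhdsWithin.1 hv
    have h2 : Tendsto f' (𝓝[v] x) (𝓝 (f' x)) := hc.continuousWithinAt
    have h3 : 𝓝[Ω] x ≤ 𝓝[v] x := by
      refine nhdsWithin_le_iff.2 ?_
      exact nhdsWithin_mono _ subset_closure hv
    refine (h2.mono_left h3).congr' ?_
    filter_upwards [self_mem_nhdsWithin, nhdsWithin_le_nhds (hO.mem_nhds hxO)] with y hyΩ hyO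
    have hvy : v ∈ 𝓝 y := mem_of_superset ((hO.inter hΩ).mem_nhds ⟨hyO, hyΩ⟩)
      fun w hw => hOv ⟨hw.1, subset_closure hw.2⟩
    exact (((hf' y (mem_of_mem_nhds hvy)).hasFDerivAt hvy).fderiv).symm
  have hext : ∀ x ∈ closure Ω, HasFDerivWithinAt u (extendFrom Ω (fderiv ℝ u) x) (closure Ω) x := by
    intro x hx
    obtain ⟨L, hL, hL'⟩ := key x hx
    rwa [extendFrom_eq hx hL]
  refine ⟨extendFrom Ω (fderiv ℝ u), continuousOn_extendFrom Subset.rfl fun x hx => ?_,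
    fun x hx => ?_, hext⟩
  · obtain ⟨L, hL, -⟩ := key x hx
    exact ⟨L, hL⟩
  · have h1 := hext x (subset_closure hx)
    exact ((h1.hasFDerivAt (mem_of_superset (hΩ.mem_nhds hx) subset_closure)).fderiv).symm

/-- An irrotational and incompressible flow in a periodic region lying over a lower half plane. -/
structure IsPeriodicFlow (Ω : Set Plane) (u : Plane → Plane) (a : ℝ) : Prop where
  isOpen : IsOpen Ω
  isPreconnected : IsPreconnected Ω
  image_Tr₂ : Tr₂ '' Ω = Ω
  halfPlane_subset : {x : Plane | x 1 ≤ -a} ⊆ Ω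
  subset_halfPlane : Ω ⊆ {x : Plane | x 1 ≤ a}
  contDiffOn : ContDiffOn ℝ 1 u (closure Ω)
  div_eq_zero : ∀ x ∈ Ω, div u x = 0
  curl_eq_zero : ∀ x ∈ Ω, curl u x = 0
  periodic : ∀ x ∈ Ω, u (Tr₂ x) = u x
  memLp : MeasureTheory.MemLp u 2
    (MeasureTheory.volume.restrict (Ω ∩ {x | x 0 ∈ Icc 0 (2 * Real.pi)}))

/-- The identification of the complex plane with the Euclidean plane. -/
noncomputable abbrev ofComplex : ℂ ≃ₗᵢ[ℝ] Plane := Complex.orthonormalBasisOneI.repr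

theorem ofComplex_zero (c : ℂ) : ofComplex c 0 = c.re := by simp [ofComplex]

theorem ofComplex_one (c : ℂ) : ofComplex c 1 = c.im := by simp [ofComplex]

/-- The complex velocity `u₀ - i u₁`. -/
noncomputable def complexVelocity (u : Plane → Plane) (c : ℂ) : ℂ :=
  (starRingEnd ℂ) (ofComplex.symm (u (ofComplex c)))

theorem norm_complexVelocity (u : Plane → Plane) (c : ℂ) :
    ‖complexVelocity u c‖ = ‖u (ofComplex c)‖ := by
  rw [complexVelocity, RCLike.norm_conj, LinearIsometryEquiv.norm_map]

theorem hasFDerivAt_complexVelocity {u : Plane → Plane} {c : ℂ}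
    (hu : DifferentiableAt ℝ u (ofComplex c)) :
    HasFDerivAt (complexVelocity u)
      ((Complex.conjCLE : ℂ →L[ℝ] ℂ).comp ((ofComplex.symm.toContinuousLinearEquiv :
        Plane →L[ℝ] ℂ).comp ((fderiv ℝ u (ofComplex c)).comp
          (ofComplex.toContinuousLinearEquiv : ℂ →L[ℝ] Plane)))) c := by
  refine (Complex.conjCLE.hasFDerivAt).comp c ?_
  refine (ofComplex.symm.toContinuousLinearEquiv.hasFDerivAt).comp c ?_
  exact hu.hasFDerivAt.comp c ofComplex.toContinuousLinearEquiv.hasFDerivAt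

/-- Vanishing divergence and curl make the Jacobian symmetric and trace free, that is, a multiple of
a reflection. It stretches all directions equally, so a tangential derivative on the boundary
controls the full gradient. -/
theorem fderiv_apply_of_div_curl {u : Plane → Plane} {x : Plane} (hd : div u x = 0)
    (hc : curl u x = 0) (v : Plane) :
    ‖fderiv ℝ u x v‖ = ‖fderiv ℝ u x (EuclideanSpace.single 0 1)‖ * ‖v‖ := by
  set L := fderiv ℝ u x with hL
  have hv : v = v 0 • EuclideanSpace.single (0 : Fin 2) (1 : ℝ)
      + v 1 • EuclideanSpace.single (1 : Fin 2) (1 : ℝ) := by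
    apply plane_ext <;> simp
  have h1 : L (EuclideanSpace.single 0 1) 0 + L (EuclideanSpace.single 1 1) 1 = 0 := hd
  have h2 : L (EuclideanSpace.single 0 1) 1 - L (EuclideanSpace.single 1 1) 0 = 0 := hc
  rw [← sq_eq_sq₀ (norm_nonneg _) (by positivity), mul_pow, plane_norm_sq v]
  conv_lhs => rw [hv]
  rw [map_add, map_smul, map_smul, plane_norm_sq, plane_norm_sq]
  simp only [PiLp.add_apply, PiLp.smul_apply, smul_eq_mul]
  have h3 : L (EuclideanSpace.single 1 1) 1 = -L (EuclideanSpace.single 0 1) 0 := by linarith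
  have h4 : L (EuclideanSpace.single 1 1) 0 = L (EuclideanSpace.single 0 1) 1 := by linarith
  rw [h3, h4]; ring

theorem ofComplex_I : ofComplex Complex.I = EuclideanSpace.single (1 : Fin 2) (1 : ℝ) := by
  apply plane_ext <;> simp [ofComplex]

theorem ofComplex_one' : ofComplex 1 = EuclideanSpace.single (0 : Fin 2) (1 : ℝ) := by
  apply plane_ext <;> simp [ofComplex]

namespace IsPeriodicFlow

variable {Ω : Set Plane} {u : Plane → Plane} {a : ℝ}

/-- The period. -/
noncomputable def period : Plane := !₂[2 * Real.pi, 0]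

theorem add_period_mem_iff (h : IsPeriodicFlow Ω u a) (x : Plane) : x + period ∈ Ω ↔ x ∈ Ω := by
  rw [period, ← Tr₂_eq_add]
  constructor
  · intro hx
    rw [← h.image_Tr₂] at hx
    obtain ⟨y, hy, hyx⟩ := hx
    rw [Tr₂_eq_add, Tr₂_eq_add, add_left_inj] at hyx
    rwa [← hyx]
  · intro hx
    rw [← h.image_Tr₂]
    exact mem_image_of_mem _ hx

theorem periodic' (h : IsPeriodicFlow Ω u a) {x : Plane} (hx : x ∈ Ω) : u (x + period) = u x := by
  rw [← h.periodic x hx, Tr₂_eq_add]; rfl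

/-- Periodicity under integer multiples of the period. -/
theorem zsmul_periodic {X : Type*} {S : Set Plane} {f : Plane → X}
    (hS : ∀ x, x + period ∈ S ↔ x ∈ S) (hf : ∀ x ∈ S, f (x + period) = f x) (n : ℤ) :
    ∀ x ∈ S, x + n • period ∈ S ∧ f (x + n • period) = f x := by
  induction n using Int.induction_on with
  | zero => intro x hx; simpa using hx
  | succ n ih =>
    intro x hx
    obtain ⟨h1, h2⟩ := ih x hx
    rw [add_smul, one_smul, ← add_assoc]
    exact ⟨(hS _).2 h1, (hf _ h1).trans h2⟩
  | pred n ih =>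
    intro x hx
    obtain ⟨h1, h2⟩ := ih x hx
    have e : x + (-(n : ℤ) - 1) • period + period = x + (-(n : ℤ)) • period := by
      rw [sub_smul, one_smul]; abel
    have h3 : x + (-(n : ℤ) - 1) • period ∈ S := by rw [← hS, e]; exact h1
    exact ⟨h3, by rw [← hf _ h3, e, h2]⟩

/-- Translation by a multiple of the period into a fundamental domain. -/
theorem exists_translate (b : ℝ) (x : Plane) : ∃ n : ℤ, (x + n • period) 0 ∈ Ico b (b + 2 * Real.pi) ∧
    (x + n • period) 1 = x 1 := by
  obtain ⟨n, hn, -⟩ := existsUnique_add_zsmul_mem_Ico Real.two_pi_pos (x 0) b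
  exact ⟨n, by simpa [period] using hn, by simp [period]⟩

theorem differentiableAt (h : IsPeriodicFlow Ω u a) {x : Plane} (hx : x ∈ Ω) :
    DifferentiableAt ℝ u x :=
  (h.contDiffOn.differentiableOn (by norm_num) x (subset_closure hx)).differentiableAt
    (mem_of_superset (h.isOpen.mem_nhds hx) subset_closure)

theorem isOpen_preimage (h : IsPeriodicFlow Ω u a) : IsOpen (ofComplex ⁻¹' Ω) :=
  h.isOpen.preimage ofComplex.continuous

theorem fderiv_complexVelocity (h : IsPeriodicFlow Ω u a) {c : ℂ} (hc : ofComplex c ∈ Ω) (w : ℂ) :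
    fderiv ℝ (complexVelocity u) c w
      = (starRingEnd ℂ) (ofComplex.symm (fderiv ℝ u (ofComplex c) (ofComplex w))) := by
  rw [(hasFDerivAt_complexVelocity (h.differentiableAt hc)).fderiv]
  rfl

/-- The complex velocity is holomorphic. -/
theorem differentiableOn_complexVelocity (h : IsPeriodicFlow Ω u a) :
    DifferentiableOn ℂ (complexVelocity u) (ofComplex ⁻¹' Ω) := by
  intro c hc
  refine DifferentiableAt.differentiableWithinAt ?_
  rw [differentiableAt_complex_iff_differentiableAt_real]
  refine ⟨(hasFDerivAt_complexVelocity (h.differentiableAt hc)).differentiableAt, ?_⟩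
  rw [h.fderiv_complexVelocity hc, h.fderiv_complexVelocity hc, ofComplex_I, ofComplex_one']
  have h1 := h.div_eq_zero _ hc
  have h2 := h.curl_eq_zero _ hc
  rw [div, partialComp, partialComp] at h1
  rw [curl, partialComp, partialComp] at h2
  simp only [ofComplex, Complex.orthonormalBasisOneI_repr_symm_apply]
  apply Complex.ext <;> simp <;> linarith

theorem norm_deriv_complexVelocity (h : IsPeriodicFlow Ω u a) {c : ℂ} (hc : ofComplex c ∈ Ω) :
    ‖deriv (complexVelocity u) c‖
      = ‖fderiv ℝ u (ofComplex c) (EuclideanSpace.single 0 1)‖ := by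
  have hd : DifferentiableAt ℂ (complexVelocity u) c :=
    (h.differentiableOn_complexVelocity c hc).differentiableAt (h.isOpen_preimage.mem_nhds hc)
  have h1 : deriv (complexVelocity u) c = fderiv ℝ (complexVelocity u) c 1 := by
    rw [hd.fderiv_restrictScalars ℝ]; simp
  rw [h1, h.fderiv_complexVelocity hc, RCLike.norm_conj, LinearIsometryEquiv.norm_map,
    ofComplex_one']

/-- Two periods are taken so that a unit disc centred in a suitable fundamental strip fits inside
the domain of integration. -/
theorem integrableOn_sq (h : IsPeriodicFlow Ω u a) :
    MeasureTheory.IntegrableOn (fun x => ‖u x‖ ^ 2)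
      (Ω ∩ {x | x 0 ∈ Icc 0 (2 * (2 * Real.pi))}) := by
  have hpi := Real.pi_pos
  have h1 : MeasureTheory.IntegrableOn (fun x => ‖u x‖ ^ 2)
      (Ω ∩ {x | x 0 ∈ Icc 0 (2 * Real.pi)}) := h.memLp.integrable_norm_pow (by norm_num)
  have hmeas : MeasurableSet (Ω ∩ {x : Plane | x 0 ∈ Icc 0 (2 * Real.pi)}) := by
    refine h.isOpen.measurableSet.inter (IsClosed.measurableSet ?_)
    exact isClosed_Icc.preimage (by fun_prop : Continuous fun x : Plane => x 0)
  have h2 : MeasureTheory.IntegrableOn (fun x => ‖u x‖ ^ 2)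
      ((fun x => x + period) '' (Ω ∩ {x | x 0 ∈ Icc 0 (2 * Real.pi)})) := by
    rw [(MeasureTheory.measurePreserving_add_right MeasureTheory.volume period).integrableOn_image
      (MeasurableEquiv.addRight period).measurableEmbedding]
    refine h1.congr_fun (fun x hx => ?_) hmeas
    simp only [Function.comp, h.periodic' hx.1]
  refine (h1.union h2).mono_set fun x hx => ?_
  have hx2 : x 0 ∈ Icc 0 (2 * (2 * Real.pi)) := hx.2
  rcases le_total (x 0) (2 * Real.pi) with hle | hle
  · exact Or.inl ⟨hx.1, hx2.1, hle⟩
  · refine Or.inr ⟨x - period, ⟨?_, ?_⟩, by simp⟩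
    · rw [← h.add_period_mem_iff]; simpa using hx.1
    · have : (x - period) 0 = x 0 - 2 * Real.pi := by simp [period]
      show (x - period) 0 ∈ Icc (0 : ℝ) (2 * Real.pi)
      rw [this]; constructor <;> linarith [hx2.2]

/-- The velocity is bounded far below. -/
theorem exists_velocity_bound (h : IsPeriodicFlow Ω u a) :
    ∃ B : ℝ, ∀ x : Plane, x 1 ≤ -a - 2 → ‖u x‖ ≤ B := by
  have hpi := Real.pi_gt_three
  refine ⟨1 + ∫ x in Ω ∩ {x | x 0 ∈ Icc 0 (2 * (2 * Real.pi))}, ‖u x‖ ^ 2, ?_⟩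
  -- With `x 0` in `[1, 1 + 2π)` the unit disc about `x` stays in the strip from 0 to `4π`; the
  -- margin 2 in depth keeps the disc of radius 2 inside the lower half plane.
  have hlow : ∀ x : Plane, x 1 ≤ -a - 2 → x 0 ∈ Ico 1 (1 + 2 * Real.pi) →
      ‖u x‖ ≤ 1 + ∫ x in Ω ∩ {x | x 0 ∈ Icc 0 (2 * (2 * Real.pi))}, ‖u x‖ ^ 2 := by
    intro x hx hx0
    set c := ofComplex.symm x with hc
    have hcx : ofComplex c = x := ofComplex.apply_symm_apply x
    have hball : ∀ r : ℝ, r ≤ 2 → ∀ z ∈ Metric.ball c r, |(ofComplex z) 0 - x 0| < r ∧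
        |(ofComplex z) 1 - x 1| < r := by
      intro r _ z hz
      rw [mem_ball_iff_norm] at hz
      have h1 := Complex.abs_re_le_norm (z - c)
      have h2 := Complex.abs_im_le_norm (z - c)
      rw [← hcx, ofComplex_zero, ofComplex_zero, ofComplex_one, ofComplex_one, ← Complex.sub_re,
        ← Complex.sub_im]
      exact ⟨h1.trans_lt hz, h2.trans_lt hz⟩
    have hsub : Metric.ball c 2 ⊆ ofComplex ⁻¹' Ω := fun z hz => by
      have h1 := (abs_lt.1 (hball 2 le_rfl z hz).2).2
      exact h.halfPlane_subset (show (ofComplex z) 1 ≤ -a by linarith)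
    have h1 := norm_le_of_integral_sq (h.differentiableOn_complexVelocity.mono hsub)
    rw [norm_complexVelocity, hcx] at h1
    refine h1.trans (add_le_add le_rfl ?_)
    have h2 := (Complex.orthonormalBasisOneI.measurePreserving_repr).setIntegral_image_emb
      ofComplex.toHomeomorph.measurableEmbedding (fun x => ‖u x‖ ^ 2) (Metric.ball c 1)
    have h3 : ∫ z in Metric.ball c 1, ‖complexVelocity u z‖ ^ 2
        = ∫ z in Metric.ball c 1, ‖u (ofComplex z)‖ ^ 2 := by
      simp only [norm_complexVelocity]
    rw [h3, ← h2]
    refine MeasureTheory.setIntegral_mono_set h.integrableOn_sq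
      (Eventually.of_forall fun x => by positivity) (Eventually.of_forall ?_)
    rintro _ ⟨z, hz, rfl⟩
    refine ⟨hsub (Metric.ball_subset_ball (by norm_num) hz), ?_⟩
    have h4 := abs_lt.1 (hball 1 (by norm_num) z hz).1
    show ofComplex z 0 ∈ Icc 0 (2 * (2 * Real.pi))
    constructor <;> linarith [hx0.1, hx0.2]
  intro x hx
  obtain ⟨n, hn0, hn1⟩ := exists_translate 1 x
  have hxΩ : x ∈ Ω := h.halfPlane_subset (show x 1 ≤ -a by linarith)
  have h1 := zsmul_periodic h.add_period_mem_iff (fun x hx => h.periodic' hx) n x hxΩ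
  rw [← h1.2]
  exact hlow _ (by rw [hn1]; exact hx) hn0

/-- The gradient of the velocity is bounded far below. -/
theorem exists_gradient_bound (h : IsPeriodicFlow Ω u a) :
    ∃ B : ℝ, ∀ x : Plane, x 1 ≤ -a - 3 →
      ‖fderiv ℝ u x (EuclideanSpace.single 0 1)‖ ≤ B := by
  obtain ⟨B, hB⟩ := h.exists_velocity_bound
  refine ⟨B, fun x hx => ?_⟩
  set c := ofComplex.symm x with hc
  have hcx : ofComplex c = x := ofComplex.apply_symm_apply x
  have hball : ∀ z ∈ Metric.closedBall c 1, (ofComplex z) 1 ≤ -a - 2 := by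
    intro z hz
    rw [mem_closedBall_iff_norm] at hz
    have h2 := (le_abs_self _).trans (Complex.abs_im_le_norm (z - c))
    rw [Complex.sub_im, ← ofComplex_one, ← ofComplex_one, hcx] at h2
    linarith
  have hsub : Metric.closedBall c 1 ⊆ ofComplex ⁻¹' Ω := fun z hz =>
    h.halfPlane_subset (show (ofComplex z) 1 ≤ -a by linarith [hball z hz])
  have hcΩ : ofComplex c ∈ Ω := hsub (Metric.mem_closedBall_self zero_le_one)
  -- Cauchy's estimate on the unit circle, at the price of one more unit of depth.
  have h1 := Complex.norm_deriv_le_of_forall_mem_sphere_norm_le one_pos (C := B)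
    (f := complexVelocity u) (c := c)
    (DifferentiableOn.diffContOnCl (h.differentiableOn_complexVelocity.mono (by
      rw [closure_ball _ one_ne_zero]; exact hsub)))
    (fun z hz => by
      rw [norm_complexVelocity]; exact hB _ (hball z (Metric.sphere_subset_closedBall hz)))
  rw [h.norm_deriv_complexVelocity hcΩ, hcx, div_one] at h1
  exact h1

/-- Maximum principle: a bound for the gradient on the boundary holds in the whole region. -/
theorem norm_gradient_le (h : IsPeriodicFlow Ω u a) {G : Plane → Plane →L[ℝ] Plane}
    (hGc : ContinuousOn G (closure Ω)) (hG : ∀ x ∈ Ω, G x = fderiv ℝ u x)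
    (hne : (frontier Ω).Nonempty) {B : ℝ}
    (hB : ∀ x ∈ frontier Ω, ‖G x (EuclideanSpace.single 0 1)‖ ≤ B) :
    ∀ x ∈ closure Ω, ‖G x‖ ≤ B := by
  set N : Plane → ℝ := fun x => ‖G x (EuclideanSpace.single 0 1)‖ with hN
  have hNc : ContinuousOn N (closure Ω) := by
    have : ContinuousOn (fun x => G x (EuclideanSpace.single 0 1)) (closure Ω) :=
      hGc.clm_apply continuousOn_const
    exact this.norm
  have hconf : ∀ v : Plane, EqOn (fun x => ‖G x v‖) (fun x => N x * ‖v‖) (closure Ω) := by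
    intro v
    refine EqOn.of_subset_closure (s := Ω) (fun x hx => ?_)
      (hGc.clm_apply continuousOn_const).norm (hNc.mul continuousOn_const)
      subset_closure Subset.rfl
    simp only [hN, hG x hx]
    exact fderiv_apply_of_div_curl (h.div_eq_zero x hx) (h.curl_eq_zero x hx) v
  suffices hmain : ∀ x ∈ closure Ω, N x ≤ B by
    intro x hx
    refine ContinuousLinearMap.opNorm_le_bound _ ((norm_nonneg _).trans (hmain x hx)) fun v => ?_
    have := hconf v hx
    simp only at this
    rw [this]
    gcongr
    exact hmain x hx
  have hclper : ∀ x, x + period ∈ closure Ω ↔ x ∈ closure Ω := by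
    intro x
    have h1 : (Homeomorph.addRight period) ⁻¹' Ω = Ω := by
      ext y; exact h.add_period_mem_iff y
    have h2 := (Homeomorph.addRight (period)).preimage_closure Ω
    rw [h1] at h2
    conv_rhs => rw [← h2]
    rfl
  have hNper : ∀ x ∈ closure Ω, N (x + period) = N x := by
    have h1 : EqOn (fun x => N (x + period)) N (closure Ω) := by
      refine EqOn.of_subset_closure (s := Ω) (fun x hx => ?_)
        (hNc.comp (by fun_prop) fun x hx => (hclper x).2 hx) hNc subset_closure Subset.rfl
      have h2 : fderiv ℝ u (x + period) = fderiv ℝ u x := by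
        rw [← fderiv_comp_add_right]
        refine Filter.EventuallyEq.fderiv_eq ?_
        filter_upwards [h.isOpen.mem_nhds hx] with y hy using h.periodic' hy
      simp only [hN, hG x hx, hG _ ((h.add_period_mem_iff x).2 hx), h2]
    exact h1
  obtain ⟨D, hD⟩ := h.exists_gradient_bound
  have hcl : ∀ x ∈ closure Ω, x 1 ≤ a := by
    have hc : IsClosed {x : Plane | x 1 ≤ a} :=
      isClosed_le (by fun_prop) continuous_const
    exact fun x hx => closure_minimal h.subset_halfPlane hc hx
  -- the weighted bound
  have hweight : ∀ δ : ℝ, 0 < δ → ∀ x ∈ closure Ω,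
      N x * Real.exp (δ * x 1) ≤ B * Real.exp (δ * a) := by
    intro δ hδ x₀ hx₀
    have hB0 : 0 ≤ B := by
      obtain ⟨q, hq⟩ := hne
      exact (norm_nonneg _).trans (hB q hq)
    by_cases hz : N x₀ = 0
    · rw [hz, zero_mul]; positivity
    have hNpos : 0 < N x₀ := lt_of_le_of_ne (norm_nonneg _) (Ne.symm hz)
    set m : Plane → ℝ := fun x => N x * Real.exp (δ * x 1) with hm
    have hmc : ContinuousOn m (closure Ω) := hNc.mul (Continuous.continuousOn (by fun_prop))
    have hm0 : 0 < m x₀ := by simp only [hm]; positivity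
    have hfront : ∀ q ∈ frontier Ω, m q ≤ B * Real.exp (δ * a) := fun q hq => by
      have := hcl q (frontier_subset_closure hq)
      simp only [hm]
      gcongr
      exact hB q hq
    -- The weight tends to 0 at infinite depth, where the gradient is bounded by `D`; below `-R` the
    -- weighted gradient does not exceed `m x₀`. With periodicity, the supremum is attained on the
    -- compact piece `K`.
    obtain ⟨R, hR3, hRx, hR⟩ : ∃ R : ℝ, a + 3 ≤ R ∧ -R ≤ x₀ 1 ∧
        ∀ y, y ≤ -R → |D| * Real.exp (δ * y) ≤ m x₀ := by
      have hlim : Tendsto (fun y : ℝ => |D| * Real.exp (δ * y)) atBot (𝓝 0) := by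
        have h1 : Tendsto (fun y : ℝ => δ * y) atBot atBot :=
          tendsto_id.const_mul_atBot hδ
        simpa using (Real.tendsto_exp_atBot.comp h1).const_mul |D|
      obtain ⟨R', hR'⟩ := eventually_atBot.1 (hlim.eventually_le_const hm0)
      refine ⟨max (max (a + 3) (-(x₀ 1))) (-R'), ?_, ?_, fun y hy => hR' y ?_⟩
      · exact (le_max_left _ _).trans (le_max_left _ _)
      · have : -(x₀ 1) ≤ max (max (a + 3) (-(x₀ 1))) (-R') :=
          (le_max_right _ _).trans (le_max_left _ _)
        linarith
      · have := le_max_right (max (a + 3) (-(x₀ 1))) (-R')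
        linarith
    set K : Set Plane := closure Ω ∩ {x | x 0 ∈ Icc 0 (2 * Real.pi) ∧ -R ≤ x 1} with hK
    have hKc : IsCompact K := by
      refine Metric.isCompact_of_isClosed_isBounded ?_ ?_
      · refine isClosed_closure.inter (IsClosed.inter ?_ ?_)
        · exact isClosed_Icc.preimage (by fun_prop : Continuous fun x : Plane => x 0)
        · exact isClosed_le continuous_const (by fun_prop : Continuous fun x : Plane => x 1)
      · refine (isBounded_iff_forall_norm_le.2 ⟨2 * Real.pi + (|a| + |R|), fun x hx => ?_⟩)
        have h1 := hcl x hx.1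
        have h2 : x 0 ∈ Icc 0 (2 * Real.pi) := hx.2.1
        have h3 : -R ≤ x 1 := hx.2.2
        have h4 : |x 1| ≤ |a| + |R| := by
          rw [abs_le]
          constructor <;> linarith [le_abs_self a, le_abs_self R, abs_nonneg a, abs_nonneg R]
        have h5 : |x 0| ≤ 2 * Real.pi := by rw [abs_of_nonneg h2.1]; exact h2.2
        have h6 := plane_norm_sq x
        have h7 : ‖x‖ ^ 2 ≤ (|x 0| + |x 1|) ^ 2 := by
          rw [h6, ← sq_abs (x 0), ← sq_abs (x 1)]
          nlinarith [abs_nonneg (x 0), abs_nonneg (x 1)]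
        have h8 := abs_le_of_sq_le_sq' h7 (by positivity)
        linarith [h8.2]
    have hred : ∀ x ∈ closure Ω, -R ≤ x 1 → ∃ y ∈ K, m y = m x := by
      intro x hx hxR
      obtain ⟨n, hn0, hn1⟩ := exists_translate 0 x
      have h1 := zsmul_periodic hclper hNper n x hx
      refine ⟨x + n • period, ⟨h1.1, ⟨hn0.1, ?_⟩, by rw [hn1]; exact hxR⟩, ?_⟩
      · have := hn0.2.le; simpa using this
      · simp only [hm, hn1, h1.2]
    obtain ⟨y₀, hy₀, hy₀m⟩ := hred x₀ hx₀ hRx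
    obtain ⟨p, hpK, hpmax⟩ := hKc.exists_isMaxOn ⟨y₀, hy₀⟩ (hmc.mono inter_subset_left)
    have hx₀p : m x₀ ≤ m p := by rw [← hy₀m]; exact hpmax hy₀
    have hglob : ∀ x ∈ closure Ω, m x ≤ m p := by
      intro x hx
      rcases le_total (-R) (x 1) with hle | hle
      · obtain ⟨y, hy, hym⟩ := hred x hx hle
        rw [← hym]; exact hpmax hy
      · refine le_trans ?_ ((hR (x 1) hle).trans hx₀p)
        have hxa : x 1 ≤ -a - 3 := by linarith
        have hxΩ : x ∈ Ω := h.halfPlane_subset (show x 1 ≤ -a by linarith)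
        have h1 := (hD x hxa).trans (le_abs_self D)
        rw [← hG x hxΩ] at h1
        simp only [hm]
        gcongr
    refine hx₀p.trans ?_
    by_cases hpΩ : p ∈ Ω
    -- The weight is the modulus of a holomorphic function: `exp (-(I * δ * c))` has norm `exp (δ *
    -- Im c)`. So `m` is the modulus of the holomorphic `H`, and an interior maximum forces it to be
    -- constant up to the boundary, where the bound is known.
    · set H : ℂ → ℂ := fun c => deriv (complexVelocity u) c * Complex.exp (-(Complex.I * δ * c))
        with hH
      have hHn : ∀ c, ofComplex c ∈ Ω → ‖H c‖ = m (ofComplex c) := by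
        intro c hc
        simp only [hH, hm, hN, norm_mul, h.norm_deriv_complexVelocity hc, hG _ hc,
          Complex.norm_exp, ofComplex_one]
        congr 2
        simp
      have hHd : DifferentiableOn ℂ H (ofComplex ⁻¹' Ω) :=
        (h.differentiableOn_complexVelocity.deriv h.isOpen_preimage).mul
          (Differentiable.differentiableOn (by fun_prop))
      have hpre : IsPreconnected (ofComplex ⁻¹' Ω) :=
        (ofComplex.toHomeomorph.isPreconnected_preimage).2 h.isPreconnected
      have hpc : ofComplex (ofComplex.symm p) = p := ofComplex.apply_symm_apply p
      have hmax := Complex.norm_eqOn_of_isPreconnected_of_isMaxOn hpre h.isOpen_preimage hHd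
        (c := ofComplex.symm p) (by rw [mem_preimage, hpc]; exact hpΩ) (by
          intro c hc
          simp only [Function.comp, mem_ofPred_eq]
          rw [hHn c hc, hHn _ (by rw [hpc]; exact hpΩ), hpc]
          exact hglob _ (subset_closure hc))
      have hconst : EqOn m (fun _ => m p) (closure Ω) := by
        refine EqOn.of_subset_closure (s := Ω) (fun x hx => ?_) hmc continuousOn_const
          subset_closure Subset.rfl
        have hxc : ofComplex (ofComplex.symm x) = x := ofComplex.apply_symm_apply x
        have h1 := hmax (show ofComplex.symm x ∈ ofComplex ⁻¹' Ω by
          rw [mem_preimage, hxc]; exact hx)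
        simp only [Function.comp, Function.const] at h1
        rwa [hHn _ (by rw [hxc]; exact hx), hHn _ (by rw [hpc]; exact hpΩ), hxc, hpc] at h1
      obtain ⟨q, hq⟩ := hne
      rw [← show m q = m p from hconst (frontier_subset_closure hq)]
      exact hfront q hq
    · exact hfront p (by
        rw [frontier, h.isOpen.interior_eq]; exact ⟨hpK.1, hpΩ⟩)
  intro x hx
  -- Removing the weight by letting `δ` decrease to 0.
  have h1 : Tendsto (fun δ : ℝ => N x * Real.exp (δ * x 1)) (𝓝[>] 0) (𝓝 (N x)) := by
    have : Continuous fun δ : ℝ => N x * Real.exp (δ * x 1) := by fun_prop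
    have := this.tendsto 0
    simp only [zero_mul, Real.exp_zero, mul_one] at this
    exact this.mono_left nhdsWithin_le_nhds
  have h2 : Tendsto (fun δ : ℝ => B * Real.exp (δ * a)) (𝓝[>] 0) (𝓝 B) := by
    have : Continuous fun δ : ℝ => B * Real.exp (δ * a) := by fun_prop
    have := this.tendsto 0
    simp only [zero_mul, Real.exp_zero, mul_one] at this
    exact this.mono_left nhdsWithin_le_nhds
  refine le_of_tendsto_of_tendsto h1 h2 ?_
  filter_upwards [self_mem_nhdsWithin] with δ hδ using hweight δ hδ x hx

/-- The flow is Lipschitz along chords which lie in the closure of the region, with a constant given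
by the tangential derivative on the boundary. -/
theorem norm_sub_le (h : IsPeriodicFlow Ω u a) {A : ℝ} (hA : 0 < A) {ζ w : ℝ → Plane}
    (hf : frontier Ω = range ζ) (hζ : ∀ α, DifferentiableAt ℝ ζ α)
    (hspeed : ∀ α, A⁻¹ ≤ ‖deriv ζ α‖) (hw : ∀ α, HasDerivAt (fun α => u (ζ α)) (w α) α)
    (hwA : ∀ α, ‖w α‖ ≤ A) {x y : Plane} (hxy : segment ℝ x y ⊆ closure Ω) :
    ‖u y - u x‖ ≤ A ^ 2 * ‖y - x‖ := by
  obtain ⟨G, hGc, hG, hGd⟩ := exists_gradient_extension h.isOpen h.contDiffOn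
  have hcl : ∀ α, ζ α ∈ closure Ω := fun α => frontier_subset_closure (hf ▸ mem_range_self α)
  have hconf : ∀ v : Plane, EqOn (fun x => ‖G x v‖)
      (fun x => ‖G x (EuclideanSpace.single 0 1)‖ * ‖v‖) (closure Ω) := by
    intro v
    refine EqOn.of_subset_closure (s := Ω) (fun x hx => ?_)
      (hGc.clm_apply continuousOn_const).norm
      ((hGc.clm_apply continuousOn_const).norm.mul continuousOn_const)
      subset_closure Subset.rfl
    simp only [hG x hx]
    exact fderiv_apply_of_div_curl (h.div_eq_zero x hx) (h.curl_eq_zero x hx) v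
  -- By the chain rule `G (ζ α)` maps the tangent to `w α`. By conformality the size of `G` is `‖w
  -- α‖ / ‖deriv ζ α‖`, at most `A * A`.
  have hbd := h.norm_gradient_le hGc hG (hf ▸ range_nonempty ζ) (B := A ^ 2) (by
    rw [hf]
    rintro _ ⟨α, rfl⟩
    have h1 := (hGd (ζ α) (hcl α)).comp_hasDerivAt α (hζ α).hasDerivAt
      (Eventually.of_forall hcl)
    have h2 : G (ζ α) (deriv ζ α) = w α := h1.unique (hw α)
    have h3 := hconf (deriv ζ α) (hcl α)
    simp only [h2] at h3
    have h4 := hwA α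
    rw [h3] at h4
    have h5 : ‖G (ζ α) (EuclideanSpace.single 0 1)‖ * A⁻¹ ≤ A :=
      (mul_le_mul_of_nonneg_left (hspeed α) (norm_nonneg _)).trans h4
    rw [mul_inv_le_iff₀ hA] at h5
    rwa [pow_two])
  exact (convex_segment x y).norm_image_sub_le_of_norm_hasFDerivWithin_le
    (fun z hz => (hGd z (hxy hz)).mono hxy) (fun z hz => hbd z (hxy hz))
    (left_mem_segment ℝ x y) (right_mem_segment ℝ x y)

end IsPeriodicFlow

/-! ### Chords of a moving curve -/

open IsPeriodicFlow in
/-- A continuous family of regular curves which cut the plane into two regions. -/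
structure IsMovingCurve (M : ℝ) (z : ℝ → ℝ → Plane) (U V : ℝ → Set Plane) : Prop where
  regular : ∀ t, IsRegularCurve M fun α => z α t
  splitting : ∀ t, IsSplitting (fun α => z α t) (U t) (V t)
  continuous : Continuous fun p : ℝ × ℝ => z p.1 p.2
  uniform : ∀ t₀ δ : ℝ, 0 < δ → ∀ᶠ t in 𝓝 t₀, ∀ α, ‖z α t - z α t₀‖ < δ
  isOpen_left : IsOpen {p : ℝ × Plane | p.2 ∈ U p.1}
  isOpen_right : IsOpen {p : ℝ × Plane | p.2 ∈ V p.1}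
  periodic_right : ∀ t x, x + period ∈ V t ↔ x ∈ V t

/-- A path which starts outside an open set and enters it crosses its frontier. -/
theorem exists_entry {U : Set Plane} (hU : IsOpen U) {γ : ℝ → Plane} (hγ : Continuous γ)
    (h0 : γ 0 ∉ U) {κ b : ℝ} (hκ : 0 < κ) (hκb : κ ≤ b) (hin : ∀ s ∈ Icc κ b, γ s ∈ U) :
    ∃ s ∈ Ico 0 κ, γ s ∈ frontier U ∧ ∀ r ∈ Ioc s b, γ r ∈ U := by
  -- The supremum of `S` is the last time up to `b` at which the path is outside `U`; it is thus a
  -- frontier point, with everything after it in `U`.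
  set S : Set ℝ := Icc 0 b ∩ γ ⁻¹' Uᶜ with hS
  have hSc : IsCompact S := isCompact_Icc.inter_right (hU.isClosed_compl.preimage hγ)
  have hSne : S.Nonempty := ⟨0, ⟨le_rfl, by linarith⟩, h0⟩
  have hmem := hSc.sSup_mem hSne
  set s := sSup S with hs
  have hsκ : s < κ := by
    by_contra! hc
    exact hmem.2 (hin s ⟨hc, hmem.1.2⟩)
  have hafter : ∀ r ∈ Ioc s b, γ r ∈ U := by
    intro r hr
    by_contra hrU
    have : r ≤ s := le_csSup hSc.bddAbove ⟨⟨by linarith [hmem.1.1, hr.1], hr.2⟩, hrU⟩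
    linarith [hr.1]
  refine ⟨s, ⟨hmem.1.1, hsκ⟩, ?_, hafter⟩
  rw [frontier, hU.interior_eq]
  refine ⟨?_, hmem.2⟩
  have hsb : s < b := by linarith
  have h4 : ContinuousWithinAt γ (Ioc s b) s := hγ.continuousWithinAt
  refine h4.mem_closure ?_ hafter
  rw [closure_Ioc hsb.ne]; exact left_mem_Icc.2 hsb.le

namespace IsMovingCurve

open IsPeriodicFlow

variable {M : ℝ} {z : ℝ → ℝ → Plane} {U V : ℝ → Set Plane}

theorem periodic_zsmul (h : IsMovingCurve M z U V) (n : ℤ) (α t : ℝ) :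
    z (α + n * (2 * Real.pi)) t = z α t + n • period := by
  have hp : ∀ α, z (α + 2 * Real.pi) t = z α t + period := fun α => by
    have := (h.regular t).periodic α
    simp only [Tr₂_eq_add] at this
    exact this
  induction n using Int.induction_on with
  | zero => simp
  | succ n ih =>
    have e : α + ((n : ℤ) + 1 : ℤ) * (2 * Real.pi) = α + (n : ℤ) * (2 * Real.pi) + 2 * Real.pi := by
      push_cast; ring
    rw [e, hp, ih, add_smul, one_smul, add_assoc]
  | pred n ih =>
    have e : α + (-(n : ℤ) - 1 : ℤ) * (2 * Real.pi) + 2 * Real.pi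
        = α + (-(n : ℤ) : ℤ) * (2 * Real.pi) := by
      push_cast; ring
    have := hp (α + (-(n : ℤ) - 1 : ℤ) * (2 * Real.pi))
    rw [e, ih] at this
    rw [sub_smul, one_smul, ← sub_eq_of_eq_add this]; abel

/-- The chords at scale `ε` which avoid the region `V`. -/
def chords (z : ℝ → ℝ → Plane) (V : ℝ → Set Plane) (ε T : ℝ) : Set (ℝ × ℝ × ℝ) :=
  {p | p.1 ∈ Icc 0 T ∧ |p.2.1 - p.2.2| ∈ Icc ε ε⁻¹ ∧
    Disjoint (segment ℝ (z p.2.1 p.1) (z p.2.2 p.1)) (V p.1)}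

/-- For each fixed fraction `s` along the chord, staying out of the space-time open set of `V` is a
closed condition; the set in question is an intersection of these. -/
theorem isClosed_chords (h : IsMovingCurve M z U V) (ε T : ℝ) : IsClosed (chords z V ε T) := by
  have hz := h.continuous
  have h1 : IsClosed {p : ℝ × ℝ × ℝ | p.1 ∈ Icc 0 T} := isClosed_Icc.preimage continuous_fst
  have h2 : IsClosed {p : ℝ × ℝ × ℝ | |p.2.1 - p.2.2| ∈ Icc ε ε⁻¹} :=
    isClosed_Icc.preimage (by fun_prop : Continuous fun p : ℝ × ℝ × ℝ => |p.2.1 - p.2.2|)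
  have h3 : IsClosed {p : ℝ × ℝ × ℝ |
      Disjoint (segment ℝ (z p.2.1 p.1) (z p.2.2 p.1)) (V p.1)} := by
    have : {p : ℝ × ℝ × ℝ | Disjoint (segment ℝ (z p.2.1 p.1) (z p.2.2 p.1)) (V p.1)}
        = ⋂ s ∈ Icc (0 : ℝ) 1, (fun p : ℝ × ℝ × ℝ =>
          (p.1, z p.2.1 p.1 + s • (z p.2.2 p.1 - z p.2.1 p.1))) ⁻¹'
            {q : ℝ × Plane | q.2 ∈ V q.1}ᶜ := by
      ext p
      simp only [mem_ofPred_eq, mem_iInter, mem_preimage, mem_compl_iff, segment_eq_image',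
        Set.disjoint_left, mem_image]
      constructor
      · exact fun hd s hs => hd ⟨s, hs, rfl⟩
      · rintro hd _ ⟨s, hs, rfl⟩
        exact hd s hs
    rw [this]
    refine isClosed_biInter fun s _ => h.isOpen_right.isClosed_compl.preimage ?_
    have c1 : Continuous fun p : ℝ × ℝ × ℝ => z p.2.1 p.1 :=
      hz.comp (by fun_prop : Continuous fun p : ℝ × ℝ × ℝ => (p.2.1, p.1))
    have c2 : Continuous fun p : ℝ × ℝ × ℝ => z p.2.2 p.1 :=
      hz.comp (by fun_prop : Continuous fun p : ℝ × ℝ × ℝ => (p.2.2, p.1))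
    fun_prop
  exact h1.inter (h2.inter h3)

/-- Shifting both parameters by a common multiple of the period preserves admissibility and `Ψ`. So
the first parameter may be taken in `[0, 2π]`, and the remaining closed set is bounded. -/
theorem exists_chord_minimizer (h : IsMovingCurve M z U V) {ε T : ℝ} {Ψ : ℝ × ℝ × ℝ → ℝ}
    (hΨ : Continuous Ψ) (hper : ∀ (n : ℤ) (t α β : ℝ),
      Ψ (t, α + n * (2 * Real.pi), β + n * (2 * Real.pi)) = Ψ (t, α, β))
    (hne : (chords z V ε T).Nonempty) :
    ∃ p ∈ chords z V ε T, ∀ q ∈ chords z V ε T, Ψ p ≤ Ψ q := by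
  have hred : ∀ q ∈ chords z V ε T, ∃ q' ∈ chords z V ε T ∩
      {p | p.2.1 ∈ Icc 0 (2 * Real.pi)}, Ψ q' = Ψ q := by
    rintro ⟨t, α, β⟩ ⟨h1, h2, h3⟩
    obtain ⟨n, hn, -⟩ := existsUnique_add_zsmul_mem_Ico Real.two_pi_pos α 0
    rw [zsmul_eq_mul] at hn
    refine ⟨(t, α + n * (2 * Real.pi), β + n * (2 * Real.pi)), ⟨⟨h1, ?_, ?_⟩, ?_⟩, hper n t α β⟩
    · simpa using h2
    · simp only [h.periodic_zsmul] at h3 ⊢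
      rw [Set.disjoint_left] at h3 ⊢
      intro x hx hxV
      refine h3 (a := x - n • period) ?_ ?_
      · rw [← mem_segment_translate ℝ (n • period)]
        rw [add_comm (n • period) (z α t), add_comm (n • period) (z β t)]
        simpa using hx
      · have := (zsmul_periodic (S := V t) (f := fun _ => ()) (h.periodic_right t)
          (fun _ _ => rfl) (-n) x hxV).1
        rwa [neg_smul, ← sub_eq_add_neg] at this
    · have := hn.2
      exact ⟨hn.1, by simpa using this.le⟩
  have hK : IsCompact (chords z V ε T ∩ {p | p.2.1 ∈ Icc 0 (2 * Real.pi)}) := by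
    refine Metric.isCompact_of_isClosed_isBounded ?_ ?_
    · exact (h.isClosed_chords ε T).inter
        (isClosed_Icc.preimage (by fun_prop : Continuous fun p : ℝ × ℝ × ℝ => p.2.1))
    · refine ((Metric.isBounded_Icc 0 T).prod ((Metric.isBounded_Icc 0 (2 * Real.pi)).prod
        (Metric.isBounded_Icc (0 - ε⁻¹) (2 * Real.pi + ε⁻¹)))).subset ?_
      rintro ⟨t, α, β⟩ ⟨⟨h1, h2, -⟩, h3⟩
      have h4 := abs_le.1 h2.2
      simp only at h3 h4
      exact ⟨h1, h3, by constructor <;> linarith [h3.1, h3.2]⟩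
  obtain ⟨q, hq⟩ := hne
  obtain ⟨q', hq', -⟩ := hred q hq
  obtain ⟨p, hp, hmin⟩ := hK.exists_isMinOn ⟨q', hq'⟩ hΨ.continuousOn
  refine ⟨p, hp.1, fun r hr => ?_⟩
  obtain ⟨r', hr', he⟩ := hred r hr
  rw [← he]
  exact hmin hr'

/-- Small perturbations of a chord in `U` can be shortened to chords which avoid `V`. -/
theorem eventually_shortened (h : IsMovingCurve M z U V) {t₀ α₀ β₀ η : ℝ} (hη : 0 < η)
    (hO : openSegment ℝ (z α₀ t₀) (z β₀ t₀) ⊆ U t₀) :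
    ∀ᶠ p : ℝ × ℝ × ℝ in 𝓝 (t₀, α₀, β₀), ∃ α' β', |α' - α₀| < η ∧ |β' - β₀| < η ∧
      ‖z α' p.1 - z β' p.1‖ ≤ ‖z p.2.1 p.1 - z p.2.2 p.1‖ ∧
      Disjoint (segment ℝ (z α' p.1) (z β' p.1)) (V p.1) := by
  have hz := h.continuous
  have cα : Continuous fun p : ℝ × ℝ × ℝ => z p.2.1 p.1 :=
    hz.comp (by fun_prop : Continuous fun p : ℝ × ℝ × ℝ => (p.2.1, p.1))
  have cβ : Continuous fun p : ℝ × ℝ × ℝ => z p.2.2 p.1 :=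
    hz.comp (by fun_prop : Continuous fun p : ℝ × ℝ × ℝ => (p.2.2, p.1))
  obtain ⟨r₁, hr₁, hsep₁⟩ := (h.regular t₀).exists_separation α₀ hη
  obtain ⟨r₂, hr₂, hsep₂⟩ := (h.regular t₀).exists_separation β₀ hη
  set r := min r₁ r₂ with hr
  have hr0 : 0 < r := lt_min hr₁ hr₂
  set D := ‖z β₀ t₀ - z α₀ t₀‖ + 1 with hD
  have hD0 : 0 < D := by positivity
  -- The end pieces of relative length `κ` are shorter than `r / 3`; the compact middle part stays
  -- in `U` under small perturbations. The perturbed chord is trimmed to the part between its last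
  -- crossing before the middle and its first crossing after it.
  set κ := min (1 / 4) (r / (3 * D)) with hκ
  have hκ0 : 0 < κ := by positivity
  have hκ4 : κ ≤ 1 / 4 := min_le_left _ _
  have hκD : κ * D ≤ r / 3 := by
    calc κ * D ≤ r / (3 * D) * D := by gcongr; exact min_le_right _ _
      _ = r / 3 := by field_simp
  have hmid : ∀ᶠ p : ℝ × ℝ × ℝ in 𝓝 (t₀, α₀, β₀), ∀ s ∈ Icc κ (1 - κ),
      z p.2.1 p.1 + s • (z p.2.2 p.1 - z p.2.1 p.1) ∈ U p.1 := by
    refine isCompact_Icc.eventually_forall_of_forall_eventually fun s hs => ?_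
    have c3 : Continuous fun w : (ℝ × ℝ × ℝ) × ℝ =>
        (w.1.1, z w.1.2.1 w.1.1 + w.2 • (z w.1.2.2 w.1.1 - z w.1.2.1 w.1.1)) := by
      have c1 := cα.comp (continuous_fst (X := ℝ × ℝ × ℝ) (Y := ℝ))
      have c2 := cβ.comp (continuous_fst (X := ℝ × ℝ × ℝ) (Y := ℝ))
      exact (continuous_fst.comp continuous_fst).prodMk
        (c1.add (continuous_snd.smul (c2.sub c1)))
    refine c3.continuousAt.eventually_mem (h.isOpen_left.mem_nhds ?_)
    refine hO ?_
    rw [openSegment_eq_image']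
    exact ⟨s, ⟨by linarith [hs.1], by linarith [hs.2]⟩, rfl⟩
  have e1 : ∀ᶠ p : ℝ × ℝ × ℝ in 𝓝 (t₀, α₀, β₀), ‖z p.2.1 p.1 - z α₀ t₀‖ < r / 3 := by
    refine (ContinuousAt.eventually_lt (f := fun p : ℝ × ℝ × ℝ => ‖z p.2.1 p.1 - z α₀ t₀‖)
      (by fun_prop) continuousAt_const ?_)
    simp; positivity
  have e2 : ∀ᶠ p : ℝ × ℝ × ℝ in 𝓝 (t₀, α₀, β₀), ‖z p.2.2 p.1 - z β₀ t₀‖ < r / 3 := by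
    refine (ContinuousAt.eventually_lt (f := fun p : ℝ × ℝ × ℝ => ‖z p.2.2 p.1 - z β₀ t₀‖)
      (by fun_prop) continuousAt_const ?_)
    simp; positivity
  have e3 : ∀ᶠ p : ℝ × ℝ × ℝ in 𝓝 (t₀, α₀, β₀), ‖z p.2.2 p.1 - z p.2.1 p.1‖ < D :=
    ContinuousAt.eventually_lt (f := fun p : ℝ × ℝ × ℝ => ‖z p.2.2 p.1 - z p.2.1 p.1‖)
      (by fun_prop) continuousAt_const (lt_add_one _)
  have e4 : ∀ᶠ p : ℝ × ℝ × ℝ in 𝓝 (t₀, α₀, β₀), ∀ α, ‖z α p.1 - z α t₀‖ < r / 3 :=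
    (continuous_fst.tendsto ((t₀, α₀, β₀) : ℝ × ℝ × ℝ)).eventually
      (h.uniform t₀ (r / 3) (by positivity))
  filter_upwards [hmid, e1, e2, e3, e4] with ⟨t, α, β⟩ hmid h1 h2 h3 h4
  simp only at hmid h1 h2 h3 h4 ⊢
  have hspl := h.splitting t
  have hout : ∀ γ, z γ t ∉ U t := fun γ hγ =>
    Set.disjoint_left.1 hspl.disjoint_left hγ (mem_range_self (f := fun α => z α t) γ)
  set P : ℝ → Plane := fun s => z α t + s • (z β t - z α t) with hP
  obtain ⟨s₁, hs₁, hf₁, hin₁⟩ := exists_entry hspl.isOpen_left (γ := P) (by fun_prop)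
    (by simpa [hP] using hout α) (κ := κ) (b := 1 / 2) hκ0 (by linarith)
    (fun s hs => hmid s ⟨hs.1, by linarith [hs.2]⟩)
  obtain ⟨s₂, hs₂, hf₂, hin₂⟩ := exists_entry hspl.isOpen_left (γ := fun s => P (1 - s))
    (by fun_prop) (by simpa [hP] using hout β) (κ := κ) (b := 1 / 2) hκ0 (by linarith)
    (fun s hs => hmid (1 - s) ⟨by linarith [hs.2], by linarith [hs.1]⟩)
  rw [hspl.frontier_left] at hf₁ hf₂
  obtain ⟨α', hα'⟩ := hf₁
  obtain ⟨β', hβ'⟩ := hf₂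
  simp only at hα' hβ'
  have hs1lt : s₁ < 1 - s₂ := by linarith [hs₁.2, hs₂.2]
  -- The trimmed ends are curve points close to the old ends at time `t`, hence, by uniform
  -- continuity in time, at `t₀`; separation on the curve at `t₀` then makes the parameters close.
  refine ⟨α', β', hsep₁ α' ?_, hsep₂ β' ?_, ?_, ?_⟩
  · have n1 : ‖P s₁ - z α t‖ ≤ r / 3 := by
      simp only [hP, add_sub_cancel_left, norm_smul, Real.norm_of_nonneg hs₁.1]
      calc s₁ * ‖z β t - z α t‖ ≤ κ * D := by
            have := hs₁.2.le
            gcongr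
        _ ≤ _ := hκD
    have n2 : z α' t₀ - z α₀ t₀ = -(z α' t - z α' t₀) + (P s₁ - z α t) + (z α t - z α₀ t₀) := by
      rw [← hα']; abel
    rw [n2]
    refine lt_of_le_of_lt (norm_add₃_le) ?_
    rw [norm_neg]
    linarith [h4 α', min_le_left r₁ r₂]
  · have n1 : ‖P (1 - s₂) - z β t‖ ≤ r / 3 := by
      have : P (1 - s₂) - z β t = -(s₂ • (z β t - z α t)) := by simp only [hP]; module
      rw [this, norm_neg, norm_smul, Real.norm_of_nonneg hs₂.1]
      calc s₂ * ‖z β t - z α t‖ ≤ κ * D := by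
            have := hs₂.2.le
            gcongr
        _ ≤ _ := hκD
    have n2 : z β' t₀ - z β₀ t₀
        = -(z β' t - z β' t₀) + (P (1 - s₂) - z β t) + (z β t - z β₀ t₀) := by
      rw [← hβ']; abel
    rw [n2]
    refine lt_of_le_of_lt (norm_add₃_le) ?_
    rw [norm_neg]
    linarith [h4 β', min_le_right r₁ r₂]
  · rw [hα', hβ']
    have : P s₁ - P (1 - s₂) = (1 - s₂ - s₁) • (z α t - z β t) := by simp only [hP]; module
    rw [this, norm_smul, Real.norm_of_nonneg (by linarith)]
    have := norm_nonneg (z α t - z β t)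
    nlinarith [hs₁.1, hs₂.1]
  · rw [segment_eq_image', Set.disjoint_left]
    rintro _ ⟨s, hs, rfl⟩ hxV
    have hcurve : ∀ γ, z γ t ∉ V t := fun γ hγ =>
      Set.disjoint_left.1 hspl.disjoint_right hγ (mem_range_self (f := fun α => z α t) γ)
    have e : z α' t + s • (z β' t - z α' t) = P (s₁ + s * (1 - s₂ - s₁)) := by
      rw [hα', hβ']; simp only [hP]; module
    rcases hs.1.eq_or_lt with h0 | h0
    · apply hcurve α'
      simpa [← h0] using hxV
    rcases hs.2.eq_or_lt with h5 | h5
    · apply hcurve β'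
      simpa [h5] using hxV
    simp only [e] at hxV
    refine Set.disjoint_left.1 hspl.disjoint ?_ hxV
    set q := s₁ + s * (1 - s₂ - s₁) with hq
    have hq1 : s₁ < q := by have := mul_pos h0 (sub_pos.2 hs1lt); linarith
    have hq2 : q < 1 - s₂ := by nlinarith
    rcases le_total q (1 / 2) with hle | hle
    · exact hin₁ q ⟨hq1, hle⟩
    · have := hin₂ (1 - q) ⟨by linarith, by linarith⟩
      simpa using this

/-- Chords which avoid `V` cannot become short, if minimal chords in `U` contract at most at an
exponential rate. -/
theorem hasLongChords (h : IsMovingCurve M z U V) {ε T c K : ℝ} (hε : 0 < ε)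
    (hεM : ε ≤ 1 / (16 * M ^ 2)) (hc : 0 < c) (hK : 0 ≤ K)
    (hinit : ∀ α β, c * |α - β| ≤ ‖z α 0 - z β 0‖)
    (hdyn : ∀ t ∈ Icc 0 T, ∀ α β, segment ℝ (z α t) (z β t) ⊆ closure (U t) →
      inner ℝ (z α t - z β t) (deriv (fun a => z a t) α) = (0 : ℝ) →
      inner ℝ (z α t - z β t) (deriv (fun a => z a t) β) = (0 : ℝ) →
      ∃ D, HasDerivWithinAt (fun s => ‖z α s - z β s‖ ^ 2) D (Icc 0 T) t ∧
        -(2 * K * ‖z α t - z β t‖ ^ 2) ≤ D) :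
    ∀ t ∈ Icc 0 T, HasLongChords (fun α => z α t) (V t) ε
      (min (ε / (2 * M)) (c * ε) * Real.exp (-((K + 1) * T))) := by
  intro t₁ ht₁ α₁ β₁ hab₁ hdis₁
  have hM := (h.regular 0).pos
  have hM1 := (h.regular 0).one_le
  set m := min (ε / (2 * M)) (c * ε) with hm
  have hm0 : 0 < m := by positivity
  have hz := h.continuous
  have cα : Continuous fun p : ℝ × ℝ × ℝ => z p.2.1 p.1 :=
    hz.comp (by fun_prop : Continuous fun p : ℝ × ℝ × ℝ => (p.2.1, p.1))
  have cβ : Continuous fun p : ℝ × ℝ × ℝ => z p.2.2 p.1 :=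
    hz.comp (by fun_prop : Continuous fun p : ℝ × ℝ × ℝ => (p.2.2, p.1))
  -- With the rate `K + 1` instead of `K`, the weighted squared length of a chord in `U` satisfying
  -- `hdyn` strictly increases in time, so it cannot be minimal at a positive time.
  set Ψ : ℝ × ℝ × ℝ → ℝ := fun p =>
    ‖z p.2.1 p.1 - z p.2.2 p.1‖ ^ 2 * Real.exp (2 * (K + 1) * p.1) with hΨ
  have hΨc : Continuous Ψ := by fun_prop
  obtain ⟨⟨t₀, α₀, β₀⟩, hp, hmin⟩ := h.exists_chord_minimizer hΨc
    (fun n t α β => by simp only [hΨ, h.periodic_zsmul, add_sub_add_right_eq_sub])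
    ⟨(t₁, α₁, β₁), ht₁, hab₁, hdis₁⟩
  have ht₀ : t₀ ∈ Icc 0 T := hp.1
  have hab₀ : |α₀ - β₀| ∈ Icc ε ε⁻¹ := hp.2.1
  have hdis₀ : Disjoint (segment ℝ (z α₀ t₀) (z β₀ t₀)) (V t₀) := hp.2.2
  have hreg := h.regular t₀
  have hspl := h.splitting t₀
  suffices hlow : m ≤ ‖z α₀ t₀ - z β₀ t₀‖ by
    have h1 := hmin (t₁, α₁, β₁) ⟨ht₁, hab₁, hdis₁⟩
    simp only [hΨ] at h1
    have h2 : (1 : ℝ) ≤ Real.exp (2 * (K + 1) * t₀) :=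
      Real.one_le_exp (by have := ht₀.1; positivity)
    have h3 : Real.exp (2 * (K + 1) * t₁) ≤ Real.exp ((K + 1) * T) ^ 2 := by
      rw [← Real.exp_nat_mul]
      apply Real.exp_le_exp.2
      push_cast
      nlinarith [ht₁.2]
    have h4 : m ^ 2 ≤ (‖z α₁ t₁ - z β₁ t₁‖ * Real.exp ((K + 1) * T)) ^ 2 := by
      calc m ^ 2 ≤ ‖z α₀ t₀ - z β₀ t₀‖ ^ 2 * 1 := by rw [mul_one]; gcongr
        _ ≤ ‖z α₀ t₀ - z β₀ t₀‖ ^ 2 * Real.exp (2 * (K + 1) * t₀) := by gcongr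
        _ ≤ ‖z α₁ t₁ - z β₁ t₁‖ ^ 2 * Real.exp (2 * (K + 1) * t₁) := h1
        _ ≤ ‖z α₁ t₁ - z β₁ t₁‖ ^ 2 * Real.exp ((K + 1) * T) ^ 2 := by gcongr
        _ = _ := by ring
    have h5 := (abs_le_of_sq_le_sq' h4 (by positivity)).2
    rw [Real.exp_neg, ← div_eq_mul_inv, div_le_iff₀ (Real.exp_pos _)]
    exact h5
  by_contra! hlt
  have hshort : ‖z α₀ t₀ - z β₀ t₀‖ < ε / (2 * M) := hlt.trans_le (min_le_left _ _)
  have ht₀pos : 0 < t₀ := by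
    refine lt_of_le_of_ne ht₀.1 fun h0 => ?_
    have h1 := hinit α₀ β₀
    rw [h0] at h1
    have h2 : c * ε ≤ c * |α₀ - β₀| := by gcongr; exact hab₀.1
    linarith [min_le_right (ε / (2 * M)) (c * ε)]
  obtain ⟨hfar, hfar'⟩ := hreg.mem_Ioo_of_norm_lt hεM hε hab₀.1 hshort
  have hinv := hreg.four_mul_le_inv hε hεM
  have hε2 : 2 * ε ≤ 1 / (2 * M ^ 2) := by
    calc 2 * ε ≤ 2 * (1 / (16 * M ^ 2)) := by gcongr
      _ = 1 / (8 * M ^ 2) := by field_simp; norm_num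
      _ ≤ _ := by gcongr; norm_num
  have hε1 := hreg.lt_one_of_le hεM
  have hsm1 : ‖z α₀ t₀ - z β₀ t₀‖ < 1 := by
    have : ε / (2 * M) ≤ ε := div_le_self hε.le (by linarith)
    linarith
  have hdpos : 0 < ‖z α₀ t₀ - z β₀ t₀‖ := by
    rw [norm_pos_iff, sub_ne_zero]
    intro he
    have := hreg.injective he
    rw [this, sub_self, abs_zero] at hab₀
    linarith [hab₀.1]
  -- shorter admissible chords contradict minimality
  have hcontra : ∀ α β, ε ≤ |α - β| → ‖z α t₀ - z β t₀‖ < ‖z α₀ t₀ - z β₀ t₀‖ →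
      Disjoint (segment ℝ (z α t₀) (z β t₀)) (V t₀) → False := by
    intro α β h1 h2 h3
    have h4 := hreg.dist_le_of_norm_lt (h2.trans hsm1)
    have h5 := hmin (t₀, α, β) ⟨ht₀, ⟨h1, by linarith⟩, h3⟩
    simp only [hΨ] at h5
    have h6 := le_of_mul_le_mul_right h5 (Real.exp_pos _)
    have h7 := (abs_le_of_sq_le_sq' h6 (norm_nonneg _)).2
    linarith
  -- A curve point on the open chord splits it into two shorter chords, both avoiding `V`. Since
  -- `|α₀ - β₀| > 2 * ε`, one of them has parameter difference at least `ε`, against minimality.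
  have hO : openSegment ℝ (z α₀ t₀) (z β₀ t₀) ⊆ U t₀ := by
    intro x hx
    have hxV : x ∉ V t₀ := Set.disjoint_left.1 hdis₀ (openSegment_subset_segment ℝ _ _ hx)
    by_contra hxU
    have hxr : x ∈ U t₀ ∪ V t₀ ∪ range fun α => z α t₀ := by rw [hspl.union_eq]; trivial
    obtain ⟨γ, rfl⟩ := hxr.resolve_left fun h' => h'.elim hxU hxV
    simp only at hx
    have hseg := openSegment_subset_segment ℝ _ _ hx
    rw [openSegment_eq_image'] at hx
    obtain ⟨s, hs, hxs⟩ := hx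
    simp only at hxs
    by_cases hγ : ε ≤ |α₀ - γ|
    · refine hcontra α₀ γ hγ ?_ ?_
      · have : z α₀ t₀ - z γ t₀ = s • (z α₀ t₀ - z β₀ t₀) := by rw [← hxs]; module
        rw [this, norm_smul, Real.norm_of_nonneg hs.1.le]
        nlinarith [hs.2]
      · exact hdis₀.mono_left ((convex_segment _ _).segment_subset (left_mem_segment ℝ _ _) hseg)
    · have h1 := abs_sub_le α₀ γ β₀
      refine hcontra γ β₀ (by linarith) ?_ ?_
      · have : z γ t₀ - z β₀ t₀ = (1 - s) • (z α₀ t₀ - z β₀ t₀) := by rw [← hxs]; module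
        rw [this, norm_smul, Real.norm_of_nonneg (by linarith [hs.2])]
        nlinarith [hs.1]
      · exact hdis₀.mono_left ((convex_segment _ _).segment_subset hseg (right_mem_segment ℝ _ _))
  -- the chord is a local minimizer among all nearby chords
  have hloc : ∀ᶠ p : ℝ × ℝ × ℝ in 𝓝 (t₀, α₀, β₀), p.1 ∈ Icc 0 T → Ψ (t₀, α₀, β₀) ≤ Ψ p := by
    set η := min ((|α₀ - β₀| - ε) / 2) ((ε⁻¹ - |α₀ - β₀|) / 2) with hη
    have hη0 : 0 < η := lt_min (by linarith) (by linarith)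
    filter_upwards [h.eventually_shortened hη0 hO] with ⟨t, α, β⟩ hsh ht
    obtain ⟨α', β', h1, h2, h3, h4⟩ := hsh
    simp only at h3 h4 ht
    have l1 := min_le_left ((|α₀ - β₀| - ε) / 2) ((ε⁻¹ - |α₀ - β₀|) / 2)
    have l2 := min_le_right ((|α₀ - β₀| - ε) / 2) ((ε⁻¹ - |α₀ - β₀|) / 2)
    have h5 : |α' - β' - (α₀ - β₀)| < 2 * η := by
      rw [show α' - β' - (α₀ - β₀) = (α' - α₀) - (β' - β₀) by ring]
      have := abs_sub (α' - α₀) (β' - β₀)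
      linarith
    have h6 := abs_sub_abs_le_abs_sub (α' - β') (α₀ - β₀)
    have h7 := abs_sub_abs_le_abs_sub (α₀ - β₀) (α' - β')
    rw [abs_sub_comm (α₀ - β₀)] at h7
    refine (hmin (t, α', β') ⟨ht, ⟨by simp only; linarith, by simp only; linarith⟩, h4⟩).trans ?_
    simp only [hΨ]
    gcongr
  have hsegcl : segment ℝ (z α₀ t₀) (z β₀ t₀) ⊆ closure (U t₀) := by
    rw [← closure_openSegment]
    exact closure_mono hO
  have hE := Real.exp_pos (2 * (K + 1) * t₀)
  have horth₁ : inner ℝ (z α₀ t₀ - z β₀ t₀) (deriv (fun a => z a t₀) α₀) = (0 : ℝ) := by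
    have hl : IsLocalMin (fun a => ‖z a t₀ - z β₀ t₀‖ ^ 2) α₀ := by
      have ht : Tendsto (fun a : ℝ => (t₀, a, β₀)) (𝓝 α₀) (𝓝 (t₀, α₀, β₀)) := by
        have : Continuous fun a : ℝ => (t₀, a, β₀) := by fun_prop
        exact this.tendsto α₀
      filter_upwards [ht.eventually hloc] with a ha
      exact le_of_mul_le_mul_right (ha ht₀) hE
    have := hl.hasDerivAt_eq_zero ((hreg.hasDerivAt α₀).sub_const (z β₀ t₀)).norm_sq
    linarith
  have horth₂ : inner ℝ (z α₀ t₀ - z β₀ t₀) (deriv (fun a => z a t₀) β₀) = (0 : ℝ) := by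
    have hl : IsLocalMin (fun b => ‖z α₀ t₀ - z b t₀‖ ^ 2) β₀ := by
      have ht : Tendsto (fun b : ℝ => (t₀, α₀, b)) (𝓝 β₀) (𝓝 (t₀, α₀, β₀)) := by
        have : Continuous fun b : ℝ => (t₀, α₀, b) := by fun_prop
        exact this.tendsto β₀
      filter_upwards [ht.eventually hloc] with b hb
      exact le_of_mul_le_mul_right (hb ht₀) hE
    have := hl.hasDerivAt_eq_zero ((hreg.hasDerivAt β₀).const_sub (z α₀ t₀)).norm_sq
    rw [inner_neg_right] at this
    linarith
  obtain ⟨D, hD, hDlow⟩ := hdyn t₀ ht₀ α₀ β₀ hsegcl horth₁ horth₂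
  have hexp : HasDerivWithinAt (fun s => Real.exp (2 * (K + 1) * s))
      (Real.exp (2 * (K + 1) * t₀) * (2 * (K + 1))) (Icc 0 T) t₀ := by
    have := ((hasDerivAt_id t₀).const_mul (2 * (K + 1))).exp
    simpa using this.hasDerivWithinAt
  have hprod := hD.mul hexp
  have hlmin : IsLocalMinOn (fun s => ‖z α₀ s - z β₀ s‖ ^ 2 * Real.exp (2 * (K + 1) * s))
      (Icc 0 T) t₀ := by
    have ht : Tendsto (fun s : ℝ => (s, α₀, β₀)) (𝓝 t₀) (𝓝 (t₀, α₀, β₀)) := by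
      have : Continuous fun s : ℝ => (s, α₀, β₀) := by fun_prop
      exact this.tendsto t₀
    have := ht.eventually hloc
    filter_upwards [nhdsWithin_le_nhds this, self_mem_nhdsWithin] with s hs hsI
    exact hs hsI
  -- Only the direction backward in time is used, so `t₀ = T` needs no separate treatment:
  -- minimality makes the derivative at `t₀` nonpositive.
  have hcone : (0 : ℝ) - t₀ ∈ posTangentConeAt (Icc 0 T) t₀ := by
    apply sub_mem_posTangentConeAt_of_segment_subset
    exact (convex_Icc 0 T).segment_subset ht₀ ⟨le_rfl, ht₀.1.trans ht₀.2⟩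
  have hnn := hlmin.hasFDerivWithinAt_nonneg hprod.hasFDerivWithinAt hcone
  simp only [ContinuousLinearMap.toSpanSingleton_apply, smul_eq_mul] at hnn
  have hfin : D * Real.exp (2 * (K + 1) * t₀) + ‖z α₀ t₀ - z β₀ t₀‖ ^ 2 *
      (Real.exp (2 * (K + 1) * t₀) * (2 * (K + 1)))
      = (D + 2 * (K + 1) * ‖z α₀ t₀ - z β₀ t₀‖ ^ 2) * Real.exp (2 * (K + 1) * t₀) := by ring
  rw [hfin] at hnn
  have hpos : 0 < (D + 2 * (K + 1) * ‖z α₀ t₀ - z β₀ t₀‖ ^ 2) * Real.exp (2 * (K + 1) * t₀) := by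
    refine mul_pos ?_ hE
    have := pow_pos hdpos 2
    nlinarith
  nlinarith

end IsMovingCurve

/-! ### Slices of functions of a parameter and of time -/

section Slices

variable {F : Type*} [NormedAddCommGroup F] [NormedSpace ℝ F] {n : ℕ} {g : ℝ × ℝ → F} {B T t : ℝ}

theorem uniqueDiffOn_slab (hT : 0 < T) : UniqueDiffOn ℝ (univ ×ˢ Icc 0 T : Set (ℝ × ℝ)) :=
  uniqueDiffOn_univ.prod (uniqueDiffOn_Icc hT)

theorem ContDiffOn.slice (hg : ContDiffOn ℝ n g (univ ×ˢ Icc 0 T)) (ht : t ∈ Icc 0 T) :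
    ContDiff ℝ n fun a => g (a, t) := by
  rw [← contDiffOn_univ]
  exact hg.comp (g := g) (f := fun a => (a, t)) (by fun_prop) fun a _ => ⟨mem_univ _, ht⟩

/-- The bounds on the solution are for joint derivatives within the closed slab. Evaluating these on
the horizontal vector `(1, 0)` recovers derivatives along a fixed time, also at the ends of the time
interval. -/
theorem iteratedDeriv_slice (hT : 0 < T) (hg : ContDiffOn ℝ n g (univ ×ˢ Icc 0 T))
    (ht : t ∈ Icc 0 T) : ∀ k ≤ n, iteratedDeriv k (fun a => g (a, t)) =
      fun a => iteratedFDerivWithin ℝ k g (univ ×ˢ Icc 0 T) (a, t) fun _ => (1, 0) := by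
  intro k
  induction k with
  | zero => intro _; ext a; simp
  | succ k ih =>
    intro hk
    rw [iteratedDeriv_succ, ih (by omega)]
    ext a
    have hS := hg.ftaylorSeriesWithin (uniqueDiffOn_slab hT)
    have h := hS.fderivWithin k (by exact_mod_cast hk) (a, t) ⟨mem_univ _, ht⟩
    have hl : HasDerivAt (fun a : ℝ => (a, t)) ((1 : ℝ), (0 : ℝ)) a :=
      (hasDerivAt_id a).prodMk (hasDerivAt_const a t)
    have hc := h.comp_hasDerivAt a hl (Eventually.of_forall fun b => mk_mem_prod (mem_univ _) ht)
    have he := ((ContinuousMultilinearMap.apply ℝ (fun _ : Fin k => ℝ × ℝ) F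
      fun _ => (1, 0)).hasFDerivAt).comp_hasDerivAt a hc
    refine he.deriv.trans ?_
    change (ftaylorSeriesWithin ℝ g (univ ×ˢ Icc 0 T) (a, t) (k + 1)) _ = _
    simp only [ftaylorSeriesWithin]
    congr 1
    ext i <;> refine Fin.cases ?_ (fun j => ?_) i <;> simp

theorem CkNormLE.norm_iteratedDeriv_slice_le (hT : 0 < T)
    (hg : CkNormLE n g (univ ×ˢ Icc 0 T) B) (ht : t ∈ Icc 0 T) {k : ℕ} (hk : k ≤ n) (α : ℝ) :
    ‖iteratedDeriv k (fun a => g (a, t)) α‖ ≤ B := by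
  rw [iteratedDeriv_slice hT hg.1 ht k hk]
  refine (ContinuousMultilinearMap.le_opNorm _ _).trans ?_
  simpa using hg.2 k hk (α, t) ⟨mem_univ _, ht⟩

theorem CkNormLE.norm_sub_le_of_slab (hT : 0 < T) (hg : CkNormLE n g (univ ×ˢ Icc 0 T) B)
    (hn : 1 ≤ n) (α : ℝ) {t t' : ℝ} (ht : t ∈ Icc 0 T) (ht' : t' ∈ Icc 0 T) :
    ‖g (α, t) - g (α, t')‖ ≤ B * |t - t'| := by
  have h := Convex.norm_image_sub_le_of_norm_fderivWithin_le (𝕜 := ℝ) (f := g)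
    (s := univ ×ˢ Icc 0 T) (C := B) (x := (α, t')) (y := (α, t))
    (hg.1.differentiableOn (by exact_mod_cast (show n ≠ 0 by omega)))
    (fun x hx => by
      rw [← norm_iteratedFDerivWithin_one g (uniqueDiffOn_slab hT x hx)]
      exact hg.2 1 hn x hx)
    (convex_univ.prod (convex_Icc 0 T)) ⟨mem_univ _, ht'⟩ ⟨mem_univ _, ht⟩
  have h2 : ‖((α, t) : ℝ × ℝ) - (α, t')‖ = |t - t'| := by
    simp [Prod.norm_def]
  rwa [h2] at h

end Slices

theorem norm_iteratedDeriv_horizontal_le {k : ℕ} (hk : 1 ≤ k) (α : ℝ) :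
    ‖iteratedDeriv k (fun a : ℝ => (!₂[a, 0] : Plane)) α‖ ≤ 1 := by
  obtain ⟨k, rfl⟩ : ∃ l, k = l + 1 := ⟨k - 1, by omega⟩
  have h : deriv (fun a : ℝ => (!₂[a, 0] : Plane)) = fun _ => !₂[1, 0] := by
    ext1 a
    have : HasDerivAt (fun a : ℝ => a • (!₂[1, 0] : Plane)) ((1 : ℝ) • !₂[1, 0]) a :=
      (hasDerivAt_id a).smul_const _
    rw [one_smul] at this
    refine (this.congr_of_eventuallyEq (Eventually.of_forall fun b => ?_)).deriv
    apply plane_ext <;> simp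
  rw [iteratedDeriv_succ', h, iteratedDeriv_const]
  split_ifs
  · rw [EuclideanSpace.norm_eq]; simp
  · simp

/-! ### From the fluid system to regular curves, splittings and periodic flows. -/

namespace TwoFluid

variable {S : TwoFluid} {ρ₁ ρ₂ σ g A T t : ℝ}

/-- The bound `A` concerns the displacement from `(α, 0)`; adding back the horizontal line, whose
derivatives have norm at most 1, turns it into `A + 1`. -/
theorem isRegularCurve (hS : S.IsSolution ρ₁ ρ₂ σ g T) (hb : S.IsBoundedBy A T) (hA : 0 < A)
    (hT : 0 < T) (ht : t ∈ Icc 0 T) : IsRegularCurve (A + 1) fun α => S.z α t := by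
  have hz : ContDiff ℝ 4 fun α => S.z α t := hS.contDiff_z.slice (n := 4) ht
  have hl : ContDiff ℝ 4 fun a : ℝ => (!₂[a, 0] : Plane) := by
    rw [contDiff_euclidean]; intro i; fin_cases i <;> simp <;> fun_prop
  refine ⟨by linarith, hz, hS.injective_z t ht, fun α => ?_, fun α => ?_, fun k hk hk4 α => ?_,
    hS.periodic_z t ht⟩
  · have := hb.z_bound.norm_iteratedDeriv_slice_le hT ht (Nat.zero_le _) α
    simp only [iteratedDeriv_zero] at this
    linarith
  · have h1 : (A + 1)⁻¹ ≤ A⁻¹ := by gcongr; linarith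
    exact h1.trans (hb.z_regular α t ht)
  · have h1 := hb.z_bound.norm_iteratedDeriv_slice_le hT ht hk4 α
    have h2 := norm_iteratedDeriv_horizontal_le hk α
    have h3 : iteratedDeriv k (fun α => S.z α t) α =
        iteratedDeriv k (fun a => S.z a t - !₂[a, 0]) α
          + iteratedDeriv k (fun a : ℝ => (!₂[a, 0] : Plane)) α := by
      have hk' : (k : WithTop ℕ∞) ≤ 4 := by exact_mod_cast hk4
      rw [← iteratedDeriv_fun_add ((hz.sub hl).of_le hk').contDiffAt (hl.of_le hk').contDiffAt]
      simp
    rw [h3]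
    exact (norm_add_le _ _).trans (by linarith)

theorem norm_z_sub_le (hb : S.IsBoundedBy A T) (hT : 0 < T) (α : ℝ) {t t' : ℝ}
    (ht : t ∈ Icc 0 T) (ht' : t' ∈ Icc 0 T) : ‖S.z α t - S.z α t'‖ ≤ A * |t - t'| := by
  simpa using hb.z_bound.norm_sub_le_of_slab hT (by norm_num) α ht ht'

theorem isSplitting (hS : S.IsSolution ρ₁ ρ₂ σ g T) (ht : t ∈ Icc 0 T) :
    IsSplitting (fun α => S.z α t) (S.Ω₁ t) (S.Ω₂ t) :=
  ⟨hS.phase₁.isOpen t ht, hS.phase₂.isOpen t ht, hS.disjoint_regions t ht,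
    hS.disjoint_interface₁ t ht, hS.disjoint_interface₂ t ht, hS.union_eq t ht,
    hS.phase₁.frontier_eq t ht, hS.phase₂.frontier_eq t ht⟩

theorem isPeriodicFlow (hS : S.IsSolution ρ₁ ρ₂ σ g T) (ht : t ∈ Icc 0 T) :
    ∃ a, IsPeriodicFlow (S.Ω₁ t) (S.u₁ t) a := by
  obtain ⟨a, ha, hab⟩ := hS.half_planes
  refine ⟨a, hS.phase₁.isOpen t ht, (hS.phase₁.isConnected t ht).isPreconnected,
    hS.phase₁.image_Tr₂ t ht, (hab t ht).1, fun x hx => ?_,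
    (hS.phase₁.velocity_space t ht).of_le (by norm_num), hS.phase₁.div_eq_zero t ht,
    hS.phase₁.curl_eq_zero t ht, hS.phase₁.velocity_periodic t ht, hS.phase₁.velocity_L2 t ht⟩
  by_contra h
  have h' : a ≤ x 1 := (not_le.mp h).le
  exact (hS.disjoint_regions t ht).le_bot ⟨hx, (hab t ht).2 h'⟩

end TwoFluid

/-! ### The interface as a moving curve -/

/-- The regions cut out by a uniformly continuous family of curves vary in an open way. -/
theorem isOpen_spacetime {z : ℝ → ℝ → Plane} {U V : ℝ → Set Plane} {q : Plane}
    (hs : ∀ t, IsSplitting (fun α => z α t) (U t) (V t)) (hU : ∀ t, IsConnected (U t))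
    (hq : ∀ t, q ∈ U t)
    (hu : ∀ t₀ δ : ℝ, 0 < δ → ∀ᶠ t in 𝓝 t₀, ∀ α, ‖z α t - z α t₀‖ < δ) :
    IsOpen {p : ℝ × Plane | p.2 ∈ U p.1} := by
  rw [isOpen_iff_mem_nhds]
  rintro ⟨t₀, x⟩ hx
  have hx' : x ∈ U t₀ := hx
  have hpc := ((hs t₀).isOpen_left.isConnected_iff_isPathConnected).1 (hU t₀)
  -- A path in `U t₀` from `x` to the fixed point `q` stays at distance `δ` from the complement of
  -- `U t₀`. Curves at nearby times miss the path and a small ball about `x`, so the ball remains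
  -- connected to `q`, which lies in `U t` for all `t`.
  obtain ⟨γ, hγ⟩ := hpc.joinedIn x hx' q (hq t₀)
  set K : Set Plane := range γ with hK
  have hKU : K ⊆ U t₀ := by rintro _ ⟨s, rfl⟩; exact hγ s
  have hKc : IsCompact K := isCompact_range γ.continuous
  have hxK : x ∈ K := ⟨0, γ.source⟩
  have hqK : q ∈ K := ⟨1, γ.target⟩
  obtain ⟨δ, hδ, hδU⟩ := hKc.exists_thickening_subset_open (hs t₀).isOpen_left hKU
  have hprod : {t | ∀ α, ‖z α t - z α t₀‖ < δ / 2} ×ˢ Metric.ball x (δ / 2) ∈ 𝓝 (t₀, x) :=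
    prod_mem_nhds (hu t₀ (δ / 2) (by linarith)) (Metric.ball_mem_nhds _ (by linarith))
  refine mem_of_superset hprod ?_
  rintro ⟨t, y⟩ ⟨ht, hy⟩
  have ht' : ∀ α, ‖z α t - z α t₀‖ < δ / 2 := ht
  have hconn : IsPreconnected (K ∪ Metric.ball x (δ / 2)) :=
    (isPreconnected_range γ.continuous).union x hxK (Metric.mem_ball_self (by linarith))
      (convex_ball x _).isPreconnected
  refine (hs t).subset_left hconn ?_ ⟨q, Or.inl hqK, hq t⟩ (Or.inr hy)
  rw [Set.disjoint_left]
  rintro w hw ⟨α, rfl⟩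
  have hd : dist (z α t₀) (z α t) < δ / 2 := by
    rw [dist_comm, dist_eq_norm]; exact ht' α
  have hmem : z α t₀ ∈ U t₀ := by
    apply hδU
    rw [Metric.mem_thickening_iff]
    rcases hw with hw | hw
    · exact ⟨_, hw, hd.trans (by linarith)⟩
    · refine ⟨x, hxK, (dist_triangle _ (z α t) _).trans_lt ?_⟩
      have : dist (z α t) x < δ / 2 := hw
      linarith
  exact Set.disjoint_left.1 (hs t₀).disjoint_left hmem ⟨α, rfl⟩

namespace TwoFluid

variable {S : TwoFluid} {ρ₁ ρ₂ σ g A T t : ℝ}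

/-- Time is clamped to `[0, T]`, so that the family is defined and regular for all real times and
openness in space-time needs no one-sided neighborhoods. The base points of `isOpen_spacetime` come
from the half planes that stay in each fluid. -/
theorem isMovingCurve (hS : S.IsSolution ρ₁ ρ₂ σ g T) (hb : S.IsBoundedBy A T) (hA : 0 < A)
    (hT : 0 < T) : IsMovingCurve (A + 1) (fun α t => S.z α (projIcc 0 T hT.le t))
      (fun t => S.Ω₁ (projIcc 0 T hT.le t)) (fun t => S.Ω₂ (projIcc 0 T hT.le t)) := by
  have hsplit : ∀ t, IsSplitting (fun α => S.z α (projIcc 0 T hT.le t))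
      (S.Ω₁ (projIcc 0 T hT.le t)) (S.Ω₂ (projIcc 0 T hT.le t)) :=
    fun t => isSplitting hS (projIcc 0 T hT.le t).2
  have hunif : ∀ t₀ δ : ℝ, 0 < δ → ∀ᶠ t in 𝓝 t₀, ∀ α,
      ‖S.z α (projIcc 0 T hT.le t) - S.z α (projIcc 0 T hT.le t₀)‖ < δ := by
    intro t₀ δ hδ
    filter_upwards [Metric.ball_mem_nhds t₀ (div_pos hδ hA)] with t ht α
    calc _ ≤ A * |(projIcc 0 T hT.le t : ℝ) - projIcc 0 T hT.le t₀| :=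
          norm_z_sub_le hb hT α (projIcc 0 T hT.le t).2 (projIcc 0 T hT.le t₀).2
      _ ≤ A * |t - t₀| := mul_le_mul_of_nonneg_left (abs_projIcc_sub_projIcc hT.le) hA.le
      _ < A * (δ / A) := by gcongr; exact ht
      _ = δ := by field_simp
  obtain ⟨a, ha, hab⟩ := hS.half_planes
  refine ⟨fun t => isRegularCurve hS hb hA hT (projIcc 0 T hT.le t).2, hsplit, ?_, hunif, ?_, ?_,
    fun t x => ?_⟩
  · exact hS.contDiff_z.continuousOn.comp_continuous (f := fun p : ℝ × ℝ =>
      (p.1, (projIcc 0 T hT.le p.2 : ℝ))) (by fun_prop)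
      fun p => mk_mem_prod (mem_univ _) (projIcc 0 T hT.le p.2).2
  · exact isOpen_spacetime (q := !₂[0, -a]) hsplit
      (fun t => hS.phase₁.isConnected _ (projIcc 0 T hT.le t).2)
      (fun t => (hab _ (projIcc 0 T hT.le t).2).1 (by simp)) hunif
  · exact isOpen_spacetime (q := !₂[0, a]) (fun t => (hsplit t).symm)
      (fun t => hS.phase₂.isConnected _ (projIcc 0 T hT.le t).2)
      (fun t => (hab _ (projIcc 0 T hT.le t).2).2 (by simp)) hunif
  · have him := hS.phase₂.image_Tr₂ _ (projIcc 0 T hT.le t).2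
    have hTr : x + IsPeriodicFlow.period = Tr₂ x := (Tr₂_eq_add x).symm
    rw [hTr]
    constructor
    · intro hx
      rw [← him] at hx
      obtain ⟨y, hy, hyx⟩ := hx
      rw [Tr₂_eq_add, Tr₂_eq_add, add_left_inj] at hyx
      exact hyx ▸ hy
    · intro hx
      rw [← him]
      exact mem_image_of_mem _ hx

theorem hasDerivWithinAt_time (hS : S.IsSolution ρ₁ ρ₂ σ g T) (α : ℝ) (ht : t ∈ Icc 0 T) :
    HasDerivWithinAt (fun s => S.z α s) (zt T S.z α t) (Icc 0 T) t := by
  have h := (hS.contDiff_z.differentiableOn (by norm_num)).comp (f := fun s : ℝ => (α, s))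
    (s := Icc 0 T) (by fun_prop) fun s hs => mk_mem_prod (mem_univ _) hs
  exact (h t ht).hasDerivWithinAt

/-- In the plane a vector orthogonal to the nonzero tangent is a multiple of its `perp`, and the
kinematic condition makes `z_t - u₁` vanish in that direction. -/
theorem inner_zt_sub_eq_zero (hS : S.IsSolution ρ₁ ρ₂ σ g T) (ht : t ∈ Icc 0 T) {α : ℝ}
    (hα : zα S.z α t ≠ 0) {v : Plane} (hv : inner ℝ v (zα S.z α t) = (0 : ℝ)) :
    inner ℝ (zt T S.z α t - S.u₁ t (S.z α t)) v = (0 : ℝ) := by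
  have hk := hS.phase₁.kinematic t ht α
  set w := zα S.z α t
  set x := zt T S.z α t - S.u₁ t (S.z α t)
  have hw : 0 < ‖w‖ ^ 2 := by positivity
  have hid : ‖w‖ ^ 2 * inner ℝ x v = inner ℝ x w * inner ℝ v w
      + inner ℝ x (perp w) * inner ℝ v (perp w) := by
    rw [plane_norm_sq]
    simp only [plane_inner, perp_apply_zero, perp_apply_one]
    ring
  rw [hv, hk, mul_zero, zero_mul, add_zero] at hid
  exact (mul_eq_zero.1 hid).resolve_left hw.ne'

theorem chordArcInf_le (α β : ℝ) : chordArcInf S.z t ≤ chordArc S.z α β t := by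
  refine ciInf_le (f := fun p : ℝ × ℝ => chordArc S.z p.1 p.2 t) ⟨0, ?_⟩ (α, β)
  rintro _ ⟨p, rfl⟩
  simp only [chordArc]
  split_ifs <;> positivity

theorem chordArcInf_mul_le (α β : ℝ) : chordArcInf S.z t * |α - β| ≤ ‖S.z α t - S.z β t‖ := by
  rcases eq_or_ne α β with rfl | h
  · simp
  · have hp : 0 < |α - β| := abs_pos.2 (sub_ne_zero.2 h)
    have := chordArcInf_le (S := S) (t := t) α β
    rw [chordArc, if_neg h, le_div_iff₀ hp] at this
    exact this

/-- Chords of the interface which do not enter the upper fluid stay long. -/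
theorem hasLongChords (hS : S.IsSolution ρ₁ ρ₂ σ g T) (hb : S.IsBoundedBy A T) (hA : 0 < A)
    (hT : 0 < T) {ε : ℝ} (hε : 0 < ε) (hεM : ε ≤ 1 / (16 * (A + 1) ^ 2)) (ht : t ∈ Icc 0 T) :
    HasLongChords (fun α => S.z α t) (S.Ω₂ t) ε
      (min (ε / (2 * (A + 1))) (A⁻¹ * ε) * Real.exp (-((A ^ 2 + 1) * T))) := by
  have hproj : ∀ s ∈ Icc 0 T, (projIcc 0 T hT.le s : ℝ) = s := fun s hs => by
    rw [projIcc_of_mem hT.le hs]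
  have h0 : (0 : ℝ) ∈ Icc 0 T := ⟨le_rfl, hT.le⟩
  have key := (isMovingCurve hS hb hA hT).hasLongChords (K := A ^ 2) (T := T) (c := A⁻¹) hε hεM
    (inv_pos.2 hA) (sq_nonneg A) ?_ ?_ t ht
  · simpa only [hproj t ht] using key
  · intro α β
    rw [hproj 0 h0]
    exact (mul_le_mul_of_nonneg_right hb.chordArc_zero (abs_nonneg _)).trans
      (chordArcInf_mul_le α β)
  · intro s hs α β
    simp only [hproj s hs]
    intro hseg hα hβ
    have hreg := isRegularCurve hS hb hA hT hs
    have hne : ∀ α, zα S.z α s ≠ 0 := fun α h => by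
      have := hb.z_regular α s hs
      rw [h, norm_zero] at this
      linarith [inv_pos.2 hA]
    have hu : ContDiff ℝ 3 fun α => S.u₁ s (S.z α s) := hb.v₁_bound.1.slice (n := 3) hs
    obtain ⟨a, hflow⟩ := isPeriodicFlow hS hs
    have hle := hflow.norm_sub_le (ζ := fun α => S.z α s) hA (hS.phase₁.frontier_eq s hs)
      (fun α => (hreg.hasDerivAt α).differentiableAt) (fun α => hb.z_regular α s hs)
      (fun α => (hu.differentiable (by norm_num) α).hasDerivAt)
      (fun α => by
        have := hb.v₁_bound.norm_iteratedDeriv_slice_le hT hs (k := 1) (by norm_num) α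
        simpa using this) hseg
    refine ⟨2 * inner ℝ (S.z α s - S.z β s) (zt T S.z α s - zt T S.z β s), ?_, ?_⟩
    · have hd := ((hasDerivWithinAt_time hS α hs).sub (hasDerivWithinAt_time hS β hs)).norm_sq
      refine hd.congr_of_mem (fun r hr => ?_) hs
      simp [hproj r hr]
    · have h1 := inner_zt_sub_eq_zero hS hs (hne α) hα
      have h2 := inner_zt_sub_eq_zero hS hs (hne β) hβ
      -- The chord is normal at both ends, so interface velocities may be replaced by fluid
      -- velocities, whose difference along the chord is controlled by the gradient bound.
      have h3 : (inner ℝ (S.z α s - S.z β s) (zt T S.z α s - zt T S.z β s) : ℝ) =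
          inner ℝ (S.z α s - S.z β s) (S.u₁ s (S.z α s) - S.u₁ s (S.z β s)) := by
        rw [real_inner_comm] at h1 h2
        rw [inner_sub_right] at h1 h2 ⊢
        rw [inner_sub_right]
        linarith
      rw [h3]
      have h4 := abs_real_inner_le_norm (S.z α s - S.z β s)
        (S.u₁ s (S.z α s) - S.u₁ s (S.z β s))
      rw [norm_sub_rev (S.u₁ s (S.z α s))] at h4
      rw [norm_sub_rev (S.z β s)] at hle
      have h5 := (abs_le.1 h4).1
      have h6 := mul_le_mul_of_nonneg_left hle (norm_nonneg (S.z α s - S.z β s))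
      nlinarith

end TwoFluid

/-! ### Existence of minimal pairs -/

namespace IsRegularCurve

variable {M ε : ℝ} {ζ : ℝ → Plane}

/-- Both the near and the far chord-arc bounds give at least `|α - β| / (2 * M)`, so a smaller chord
has its parameter difference strictly between the two ranges. -/
theorem mem_Ioo_of_norm_lt_mul (h : IsRegularCurve M ζ) {α β : ℝ}
    (hab : ‖ζ α - ζ β‖ < |α - β| / (2 * M)) : |α - β| ∈ Ioo (1 / (2 * M ^ 2)) (4 * M) := by
  have hM := h.pos
  refine ⟨?_, ?_⟩
  · by_contra! hc
    exact absurd (h.le_norm_sub_of_near hc) (not_le.2 hab)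
  · by_contra! hc
    have h1 := h.le_norm_sub_of_far hc
    have h2 : |α - β| / (2 * M) ≤ |α - β| / 2 := by gcongr; linarith [h.one_le]
    linarith

theorem Ioo_subset_Icc_scale (h : IsRegularCurve M ζ) (hε : 0 < ε) (hεM : ε ≤ 1 / (16 * M ^ 2)) :
    Ioo (1 / (2 * M ^ 2)) (4 * M) ⊆ Icc (2 * ε) (ε⁻¹ / 2) := by
  have hM := h.pos
  intro x hx
  have h1 := h.four_mul_le_inv hε hεM
  have h2 : 2 * (1 / (16 * M ^ 2)) ≤ 1 / (2 * M ^ 2) := by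
    rw [← sub_nonneg]
    have : 1 / (2 * M ^ 2) - 2 * (1 / (16 * M ^ 2)) = 3 / (8 * M ^ 2) := by field_simp; ring
    rw [this]; positivity
  exact ⟨by linarith [hx.1], by linarith [hx.2]⟩

theorem norm_sub_periodic (h : IsRegularCurve M ζ) (α β : ℝ) :
    Function.Periodic (fun s => ‖ζ (α + s) - ζ (β + s)‖) (2 * Real.pi) := by
  intro s
  simp only
  rw [← add_assoc, ← add_assoc, h.periodic, h.periodic, Tr₂_eq_add, Tr₂_eq_add,
    add_sub_add_right_eq_sub]

/-- If two points at scale `ε` are close, then the distance at scale `ε` is minimized by a pair of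
points with parameters well inside the range of admissible ones. -/
theorem exists_isMinimalPair (h : IsRegularCurve M ζ) (hε : 0 < ε) (hεM : ε ≤ 1 / (16 * M ^ 2))
    {a b : ℝ} (hab : |a - b| ∈ Icc ε ε⁻¹) (hd : ‖ζ a - ζ b‖ < ε / (2 * M)) :
    ∃ α₁ α₂, IsMinimalPair ζ ε α₁ α₂ := by
  set K : Set (ℝ × ℝ) := {p | p.1 ∈ Icc 0 (2 * Real.pi) ∧ |p.1 - p.2| ∈ Icc ε ε⁻¹} with hK
  have hshift : ∀ α β, |α - β| ∈ Icc ε ε⁻¹ → ∃ p ∈ K, ‖ζ p.1 - ζ p.2‖ = ‖ζ α - ζ β‖ := by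
    intro α β hαβ
    obtain ⟨s, hs, hse⟩ := (h.norm_sub_periodic α β).exists_mem_Ico Real.two_pi_pos 0 (-α)
    simp only [add_zero] at hse
    refine ⟨(α + s, β + s), ⟨⟨by linarith [hs.1], by linarith [hs.2]⟩, ?_⟩, hse.symm⟩
    simpa using hαβ
  have hKc : IsCompact K := by
    refine Metric.isCompact_of_isClosed_isBounded ?_ ?_
    · exact (isClosed_Icc.preimage (by fun_prop : Continuous fun p : ℝ × ℝ => p.1)).inter
        (isClosed_Icc.preimage (by fun_prop : Continuous fun p : ℝ × ℝ => |p.1 - p.2|))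
    · refine (Metric.isBounded_Icc ((0 : ℝ), -ε⁻¹) (2 * Real.pi, 2 * Real.pi + ε⁻¹)).subset ?_
      rintro ⟨x, y⟩ ⟨hx, hxy⟩
      have := abs_le.1 hxy.2
      exact ⟨⟨hx.1, by simp only at *; linarith [hx.1]⟩, ⟨hx.2, by simp only at *; linarith [hx.2]⟩⟩
  obtain ⟨q, hq, hqe⟩ := hshift a b hab
  have hcont : Continuous fun p : ℝ × ℝ => ‖ζ p.1 - ζ p.2‖ := by
    have := h.continuous
    fun_prop
  obtain ⟨p, hp, hpmin⟩ := hKc.exists_isMinOn ⟨q, hq⟩ hcont.continuousOn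
  have hmin : ∀ α β, |α - β| ∈ Icc ε ε⁻¹ → ‖ζ p.1 - ζ p.2‖ ≤ ‖ζ α - ζ β‖ := by
    intro α β hαβ
    obtain ⟨r, hr, hre⟩ := hshift α β hαβ
    rw [← hre]
    exact hpmin hr
  -- A minimizer over the window `[ε, ε⁻¹]` is short, hence automatically in the smaller window
  -- required of a minimal pair.
  refine ⟨p.1, p.2, h.Ioo_subset_Icc_scale hε hεM ?_, hmin⟩
  exact h.mem_Ioo_of_norm_lt hεM hε hp.2.1 ((hmin a b hab).trans_lt hd)

end IsRegularCurve

theorem TwoFluid.isConjugatePair_iff {S : TwoFluid} {ε t α₁ α₂ : ℝ} (hε : 0 < ε) :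
    IsConjugatePair S.z ε t α₁ α₂ ↔ IsMinimalPair (fun α => S.z α t) ε α₁ α₂ := by
  constructor
  · rintro ⟨h1, h2⟩
    refine ⟨h1, fun α β hαβ => ?_⟩
    rw [h2]
    refine csInf_le ⟨0, ?_⟩ ⟨α, β, hαβ, rfl⟩
    rintro _ ⟨_, _, _, rfl⟩
    exact norm_nonneg _
  · rintro ⟨h1, h2⟩
    have hmem : |α₁ - α₂| ∈ Icc ε ε⁻¹ := ⟨by linarith [h1.1], by linarith [h1.2, inv_pos.2 hε]⟩
    have hleast : IsLeast {r : ℝ | ∃ α β : ℝ, |α - β| ∈ Icc ε ε⁻¹ ∧ r = ‖S.z α t - S.z β t‖}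
        ‖S.z α₁ t - S.z α₂ t‖ := by
      refine ⟨⟨α₁, α₂, hmem, rfl⟩, ?_⟩
      rintro _ ⟨α, β, hαβ, rfl⟩
      exact h2 α β hαβ
    exact ⟨h1, hleast.csInf_eq.symm⟩

/-- A small chord-arc constant is realized by points with parameters at scale `ε`. -/
theorem TwoFluid.exists_of_chordArcInf_lt {S : TwoFluid} {M ε η t : ℝ}
    (h : IsRegularCurve M fun α => S.z α t) (hε : 0 < ε) (hεM : ε ≤ 1 / (16 * M ^ 2))
    (hη : chordArcInf S.z t < η) (hηε : η ≤ ε / (8 * M ^ 2)) :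
    ∃ a b, |a - b| ∈ Icc (2 * ε) (ε⁻¹ / 2) ∧ ‖S.z a t - S.z b t‖ < 4 * M * η := by
  have hM := h.pos
  have hM1 := h.one_le
  have hη2 : η ≤ 1 / (2 * M) := by
    refine hηε.trans ?_
    rw [div_le_div_iff₀ (by positivity) (by positivity)]
    nlinarith [h.lt_one_of_le hεM]
  obtain ⟨⟨a, b⟩, hab⟩ := exists_lt_of_ciInf_lt hη
  simp only [chordArc] at hab
  split_ifs at hab with he
  · have h1 : M⁻¹ ≤ ‖zα S.z a t‖ := h.speed a
    have h2 : 1 / (2 * M) ≤ M⁻¹ := by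
      rw [inv_eq_one_div, div_le_div_iff₀ (by positivity) (by positivity)]; linarith
    linarith
  · have hp : 0 < |a - b| := abs_pos.2 (sub_ne_zero.2 he)
    rw [div_lt_iff₀ hp] at hab
    have h1 : |a - b| ∈ Ioo (1 / (2 * M ^ 2)) (4 * M) := by
      refine h.mem_Ioo_of_norm_lt_mul (hab.trans_le ?_)
      rw [div_eq_mul_one_div, mul_comm]
      gcongr
    refine ⟨a, b, h.Ioo_subset_Icc_scale hε hεM h1, hab.trans_le ?_⟩
    have hη0 : 0 ≤ η := by
      by_contra! hc
      have := norm_nonneg (S.z a t - S.z b t)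
      nlinarith
    rw [mul_comm]
    gcongr
    exact h1.2.le

/-! ### Rigid motions -/

/-- The linear part is an isometry sending the vertical unit vector to `e`, so the horizontal one
goes to a unit normal of `e`. Orientation may be reversed, which is why both signs of `perp e` are
carried through the graph lemmas. -/
theorem AffineIsometryEquiv.exists_frame (R : Plane ≃ᵃⁱ[ℝ] Plane) {m e : Plane} {r : ℝ} (hr : r ≠ 0)
    (h0 : R !₂[0, 0] = m) (h1 : R !₂[0, r] = m + r • e) :
    ‖e‖ = 1 ∧ ∃ τ, (τ = perp e ∨ τ = -perp e) ∧ ∀ ρ y, R !₂[ρ, y] = m + ρ • τ + y • e := by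
  set L := R.linearIsometryEquiv with hL
  have hR : ∀ v, R v = L v + m := by
    intro v
    have h := R.map_vadd !₂[0, 0] v
    rw [vadd_eq_add, vadd_eq_add, h0] at h
    rw [← h]
    congr 1
    apply plane_ext <;> simp
  have hdec : ∀ ρ y : ℝ, L !₂[ρ, y] = ρ • L !₂[1, 0] + y • L !₂[0, 1] := by
    intro ρ y
    rw [← map_smul, ← map_smul, ← map_add]
    congr 1
    apply plane_ext <;> simp
  have he : L !₂[0, 1] = e := by
    have h := hR !₂[0, r]
    rw [h1, hdec, zero_smul, zero_add, add_comm, add_left_inj] at h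
    exact (smul_right_injective Plane hr h).symm
  have hen : ‖e‖ = 1 := by
    rw [← he, L.norm_map, EuclideanSpace.norm_eq]; simp
  refine ⟨hen, L !₂[1, 0], ?_, fun ρ y => ?_⟩
  · have ho : inner ℝ (L !₂[1, 0]) e = (0 : ℝ) := by
      rw [← he, L.inner_map_map, plane_inner]; simp
    have hn : ‖L !₂[1, 0]‖ = 1 := by
      rw [L.norm_map, EuclideanSpace.norm_eq]; simp
    have h2 := eq_smul_perp_of_inner_eq_zero hen ho
    have h3 := abs_inner_perp_of_inner_eq_zero hen ho
    rw [hn] at h3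
    rcases eq_or_eq_neg_of_abs_eq h3 with h4 | h4
    · left; rw [h2, h4, one_smul]
    · right; rw [h2, h4, neg_one_smul]
  · rw [hR, hdec, he]
    abel

/-! ### Graph parametrization near a minimal pair -/

/-- Numerical consequences of the smallness of the width `x` of a strip. -/
theorem width_bounds {M ε x d : ℝ} (hM1 : 1 ≤ M) (hε1 : ε < 1) (hx : 0 < x)
    (hxε : x ≤ ε / (16 * M)) (hdx : d ≤ x ^ 5) :
    x ≤ 1 / 16 ∧ x ≤ ε ∧ x ^ 2 ≤ x / 16 ∧ x ^ 4 ≤ ε / (16 * M) ∧ x ^ 4 ≤ 1 / (128 * M ^ 4) ∧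
      x ^ 4 < 1 / (4 * M ^ 3) ∧ d ≤ x ^ 4 / (8 * M) ∧ d ≤ x ^ 2 / 16 := by
  have hM : 0 < M := by linarith
  have hxM : x * (16 * M) ≤ ε := by rwa [le_div_iff₀ (by positivity)] at hxε
  have hx16 : x * M ≤ 1 / 16 := by linarith
  have hx1 : x ≤ 1 / 16 := by nlinarith
  have hδM : x ^ 4 ≤ 1 / (128 * M ^ 4) := by
    rw [le_div_iff₀ (by positivity)]
    have : (x * M) ^ 4 ≤ (1 / 16) ^ 4 := by gcongr
    rw [mul_pow] at this
    norm_num at this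
    linarith
  have h54 : x ^ 5 ≤ x ^ 4 := pow_le_pow_of_le_one hx.le (by linarith) (by norm_num)
  have h2 : x ^ 2 ≤ 1 / 16 := by nlinarith
  have h42 : x ^ 4 ≤ x ^ 2 / 16 := by nlinarith [sq_nonneg x]
  refine ⟨hx1, by nlinarith, by nlinarith, ?_, hδM, ?_, ?_, by linarith⟩
  · refine le_trans ?_ hxε
    simpa using pow_le_pow_of_le_one hx.le (by linarith : x ≤ 1) (show 1 ≤ 4 by norm_num)
  · refine hδM.trans_lt ?_
    rw [div_lt_div_iff₀ (by positivity) (by positivity)]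
    have : M ^ 3 ≤ M ^ 4 := pow_le_pow_right₀ hM1 (by norm_num)
    have : 0 < M ^ 3 := by positivity
    linarith
  · rw [le_div_iff₀ (by positivity)]
    calc d * (8 * M) ≤ x ^ 5 * (8 * M) := by gcongr
      _ = x ^ 4 * (8 * (x * M)) := by ring
      _ ≤ x ^ 4 * 1 := by gcongr; linarith
      _ = x ^ 4 := mul_one _

/-- Parameters grow at most linearly and heights at most quadratically in `ρ`. With `x * M ≤ 1 /
16`, passing from scale `x ^ 4` to `x ^ 2` absorbs the powers of `M`. -/
theorem IsLocalGraph.abs_lt_sq {M ε x ρ : ℝ} {ζ : ℝ → Plane} {α : ℝ} {e τ m : Plane} {β f : ℝ → ℝ}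
    (hL : IsLocalGraph M ζ α e τ m β f) (hM1 : 1 ≤ M) (hε1 : ε < 1) (hx : 0 < x)
    (hxε : x ≤ ε / (16 * M)) (hf0 : |f 0| ≤ x ^ 2 / 16) (hρ : |ρ| < x ^ 4) :
    |β ρ| < x ^ 2 ∧ |f ρ| < x ^ 2 := by
  have hM : 0 < M := by linarith
  have hxM : x * (16 * M) ≤ ε := by rwa [le_div_iff₀ (by positivity)] at hxε
  have hx16 : x * M ≤ 1 / 16 := by linarith
  have hx2 : 0 < x ^ 2 := by positivity
  obtain ⟨hx1, -, -, -, -, hδr, -⟩ := width_bounds hM1 hε1 hx hxε le_rfl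
  have h1 : 2 * M * |ρ| < x ^ 2 / 16 := by
    calc 2 * M * |ρ| < 2 * M * x ^ 4 := by gcongr
      _ = 2 * (x * M) * x * x ^ 2 := by ring
      _ ≤ 2 * (1 / 16) * (1 / 16) * x ^ 2 := by gcongr
      _ ≤ x ^ 2 / 16 := by linarith
  have h2 : M * (2 * M * |ρ|) ^ 2 ≤ x ^ 2 / 16 := by
    calc M * (2 * M * |ρ|) ^ 2 ≤ M * (x ^ 2 / 16) ^ 2 := by gcongr
      _ = (x * M) * x * x ^ 2 / 256 := by ring
      _ ≤ (1 / 16) * (1 / 16) * x ^ 2 / 256 := by gcongr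
      _ ≤ x ^ 2 / 16 := by linarith
  have h3 := hL.param_le ρ (hρ.trans hδr)
  have h4 := hL.height_le ρ (hρ.trans hδr)
  have h5 : |f ρ| ≤ |f ρ - f 0| + |f 0| := by simpa using abs_add_le (f ρ - f 0) (f 0)
  constructor <;> linarith

/-- Two numbers of opposite signs, bounded above and below, have a product bounded above and below. -/
theorem inv_mul_inv_mem_Icc {M a b s₁ s₂ : ℝ} (hM : 0 < M) (hss : s₁ * s₂ = -1)
    (ha : 1 / (2 * M) ≤ s₁ * a) (hb : 1 / (2 * M) ≤ s₂ * b) (ha' : s₁ * a ≤ M) (hb' : s₂ * b ≤ M) :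
    -(a⁻¹ * b⁻¹) ∈ Icc (4 * M ^ 2)⁻¹ (4 * M ^ 2) := by
  have hM2 : (0 : ℝ) < 1 / (2 * M) := by positivity
  have ha0 := hM2.trans_le ha
  have hb0 := hM2.trans_le hb
  have hprod : -(a⁻¹ * b⁻¹) = (s₁ * a * (s₂ * b))⁻¹ := by
    have : s₁ * a * (s₂ * b) = -(a * b) := by linear_combination a * b * hss
    rw [this, inv_neg, mul_inv]
  rw [hprod]
  constructor
  · have h1 : s₁ * a * (s₂ * b) ≤ M * M := mul_le_mul ha' hb' hb0.le hM.le
    have h2 : s₁ * a * (s₂ * b) ≤ 4 * M ^ 2 := by nlinarith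
    gcongr
  · have h1 : 1 / (2 * M) * (1 / (2 * M)) ≤ s₁ * a * (s₂ * b) := mul_le_mul ha hb hM2.le ha0.le
    calc (s₁ * a * (s₂ * b))⁻¹ ≤ (1 / (2 * M) * (1 / (2 * M)))⁻¹ := by gcongr
      _ = 4 * M ^ 2 := by field_simp; ring

theorem IsRegularCurve.mul_inner_deriv_le {M : ℝ} {ζ : ℝ → Plane} (h : IsRegularCurve M ζ)
    {τ : Plane} (hτ : ‖τ‖ = 1) {s : ℝ} (hs : s = 1 ∨ s = -1) (α : ℝ) :
    s * inner ℝ (deriv ζ α) τ ≤ M := by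
  have h1 := abs_real_inner_le_norm (deriv ζ α) τ
  rw [hτ, mul_one] at h1
  have h2 := abs_le.1 (h1.trans (h.norm_deriv_le α))
  rcases hs with rfl | rfl <;> linarith

/-- Opposite tangents have opposite orientations. -/
theorem sign_mul_eq_neg_one {v w e τ : Plane} (he : ‖e‖ = 1) (hτ : τ = perp e ∨ τ = -perp e)
    (hv : inner ℝ v e = (0 : ℝ)) (hneg : inner ℝ v w < (0 : ℝ)) {s₁ s₂ : ℝ}
    (hs₁ : s₁ = 1 ∨ s₁ = -1) (hs₂ : s₂ = 1 ∨ s₂ = -1) (hvτ : inner ℝ v τ = s₁ * ‖v‖)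
    (hwτ : inner ℝ w τ = s₂ * ‖w‖) : s₁ * s₂ = -1 := by
  rw [plane_expand' he hτ v, hv, zero_smul, add_zero, real_inner_smul_left,
    real_inner_comm w τ, hvτ, hwτ] at hneg
  have h3 : 0 ≤ ‖v‖ * ‖w‖ := by positivity
  rcases hs₁ with rfl | rfl <;> rcases hs₂ with rfl | rfl <;> norm_num <;> nlinarith

theorem sub_midpoint_eq {p q e : Plane} {d : ℝ} (hde : d • e = q - p) :
    p - midpoint ℝ p q = (-(d / 2)) • e ∧ q - midpoint ℝ p q = (d / 2) • e := by
  constructor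
  · rw [show (-(d / 2)) • e = (-(1 / 2) : ℝ) • (d • e) by module, hde, midpoint_eq_smul_add,
      invOf_eq_inv]
    module
  · rw [show (d / 2) • e = (1 / 2 : ℝ) • (d • e) by module, hde, midpoint_eq_smul_add,
      invOf_eq_inv]
    module

namespace IsMinimalPair

variable {M ε c x : ℝ} {ζ : ℝ → Plane} {U V : Set Plane} {α₁ α₂ : ℝ}

/-- Outside the strip between two points of minimal distance, on the side of the second point. -/
theorem outer_strip_right (hp : IsMinimalPair ζ ε α₁ α₂) (h : IsRegularCurve M ζ)
    (hs : IsSplitting ζ U V) (hε : 0 < ε) (hεM : ε ≤ 1 / (16 * M ^ 2))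
    (hd : ‖ζ α₁ - ζ α₂‖ ≤ 1) (hdc : ‖ζ α₁ - ζ α₂‖ < c) (hlong : HasLongChords ζ V ε c)
    {δ : ℝ} (hδ : 0 ≤ δ) (hδε : δ ≤ ε) (hδc : δ ≤ c) {β ρ : ℝ} (hβ : |β - α₂| ≤ δ)
    (hρ : ρ ∈ Ioo 0 δ) : ζ β + ρ • direction ζ α₁ α₂ ∈ U := by
  have := hp.symm.outer_strip h hs hε hεM (by rwa [norm_sub_rev]) (by rwa [norm_sub_rev]) hlong
    hδ hδε hδc hβ hρ
  rwa [direction_comm, smul_neg, sub_neg_eq_add] at this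

theorem inner_strip_right (hp : IsMinimalPair ζ ε α₁ α₂) (h : IsRegularCurve M ζ)
    (hs : IsSplitting ζ U V) (hε : 0 < ε) (hεM : ε ≤ 1 / (16 * M ^ 2))
    (hd : ‖ζ α₁ - ζ α₂‖ ≤ 1) (hO : openSegment ℝ (ζ α₁) (ζ α₂) ⊆ V) {δ : ℝ} (hδε : δ ≤ ε)
    (hδ : 0 ≤ δ) {β ρ : ℝ} (hβ : |β - α₂| ≤ δ) (hρ : ρ ∈ Ioo 0 ‖ζ α₂ - ζ α₁‖) :
    ζ β - ρ • direction ζ α₁ α₂ ∈ V := by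
  have := hp.symm.inner_strip h hs hε hεM (by rwa [norm_sub_rev]) (by rwa [openSegment_symm])
    hδε hδ hβ (by rwa [norm_sub_rev])
  rwa [direction_comm, smul_neg, ← sub_eq_add_neg] at this

theorem inner_deriv_right_eq_zero (hp : IsMinimalPair ζ ε α₁ α₂) (h : IsRegularCurve M ζ)
    (hε : 0 < ε) : inner ℝ (deriv ζ α₂) (direction ζ α₁ α₂) = (0 : ℝ) := by
  have := hp.symm.inner_deriv_eq_zero h hε
  rwa [direction_comm, inner_neg_right, neg_eq_zero] at this

/-- The geometric content of part (ii), with time removed. The constant depends on `M` only, since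
`exists_graph` works at a fixed radius depending on `M`; the width `x` merely restricts the graphs
to a smaller interval. -/
theorem exists_local_graphs (M : ℝ) (hM1 : 1 ≤ M) : ∃ C, 1 ≤ C ∧
    ∀ (ζ : ℝ → Plane) (U V : Set Plane) (ε c x α₁ α₂ : ℝ), IsRegularCurve M ζ →
    IsSplitting ζ U V → HasLongChords ζ V ε c → 0 < ε → ε ≤ 1 / (16 * M ^ 2) →
    IsMinimalPair ζ ε α₁ α₂ → 0 < x → x ≤ ε / (16 * M) → x ≤ c →
    ∀ d, d = ‖ζ α₂ - ζ α₁‖ → d ≤ x ^ 5 →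
    ∀ e, e = direction ζ α₁ α₂ → ∀ τ, (τ = perp e ∨ τ = -perp e) →
    ∀ m, m = midpoint ℝ (ζ α₁) (ζ α₂) →
    ∃ f₁ f₂ β₁ β₂ : ℝ → ℝ,
      MapsTo f₁ (Ioo (-x ^ 4) (x ^ 4)) (Ioo (-x ^ 2) (x ^ 2)) ∧
      MapsTo f₂ (Ioo (-x ^ 4) (x ^ 4)) (Ioo (-x ^ 2) (x ^ 2)) ∧
      MapsTo β₁ (Ioo (-x ^ 4) (x ^ 4)) (Ioo (-x ^ 2) (x ^ 2)) ∧
      MapsTo β₂ (Ioo (-x ^ 4) (x ^ 4)) (Ioo (-x ^ 2) (x ^ 2)) ∧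
      (∀ ρ ∈ Ioo (-x ^ 4) (x ^ 4),
        m + ρ • τ + f₁ ρ • e = ζ (α₁ + β₁ ρ) ∧ m + ρ • τ + f₂ ρ • e = ζ (α₂ + β₂ ρ)) ∧
      f₁ 0 = -(d / 2) ∧ f₂ 0 = d / 2 ∧ β₁ 0 = 0 ∧ β₂ 0 = 0 ∧ deriv f₁ 0 = 0 ∧ deriv f₂ 0 = 0 ∧
      CkNormLE 4 f₁ (Ioo (-x ^ 4) (x ^ 4)) C ∧ CkNormLE 4 f₂ (Ioo (-x ^ 4) (x ^ 4)) C ∧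
      CkNormLE 4 β₁ (Ioo (-x ^ 4) (x ^ 4)) C ∧ CkNormLE 4 β₂ (Ioo (-x ^ 4) (x ^ 4)) C ∧
      (∀ ρ ∈ Ioo (-x ^ 4) (x ^ 4),
        C⁻¹ ≤ -(deriv β₁ ρ * deriv β₂ ρ) ∧ -(deriv β₁ ρ * deriv β₂ ρ) ≤ C ∧ d ≤ f₂ ρ - f₁ ρ) ∧
      (∀ ρ ∈ Ioo (-x ^ 4) (x ^ 4), ∀ y ∈ Ioo (f₂ ρ) (x ^ 2), m + ρ • τ + y • e ∈ U) ∧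
      (∀ ρ ∈ Ioo (-x ^ 4) (x ^ 4), ∀ y ∈ Ioo (-x ^ 2) (f₁ ρ), m + ρ • τ + y • e ∈ U) ∧
      (∀ ρ ∈ Ioo (-x ^ 4) (x ^ 4), ∀ y ∈ Ioo (f₁ ρ) (f₂ ρ), m + ρ • τ + y • e ∈ V) := by
  obtain ⟨C, hC, hgraph⟩ := exists_graph M hM1
  refine ⟨max C (4 * M ^ 2), le_max_of_le_left hC, ?_⟩
  intro ζ U V ε c x α₁ α₂ h hs hlong hε hεM hp hx hxε hxc d hd hdx e he τ hτ m hm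
  have hM := h.pos
  have hε1 := h.lt_one_of_le hεM
  obtain ⟨hx1, hxleε, hx2, hδε, hδM, hδr, hd1, hdx2⟩ := width_bounds hM1 hε1 hx hxε hdx
  have hd0 : 0 < d := hd ▸ hp.norm_pos h hε
  have hdlt : ‖ζ α₁ - ζ α₂‖ < c := by rw [norm_sub_rev, ← hd]; linarith
  have hdle : ‖ζ α₁ - ζ α₂‖ ≤ 1 := by rw [norm_sub_rev, ← hd]; linarith
  have hO := hp.openSegment_subset h hs hε hεM hdle hdlt hlong
  have hen : ‖e‖ = 1 := he ▸ hp.norm_direction h hε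
  have hee : inner ℝ e e = (1 : ℝ) := by rw [real_inner_self_eq_norm_sq, hen]; norm_num
  have heτ : inner ℝ e τ = (0 : ℝ) := by
    rcases hτ with rfl | rfl <;> simp [inner_perp_self]
  have hτn : ‖τ‖ = 1 := by rcases hτ with rfl | rfl <;> simp [norm_perp, hen]
  have hde : d • e = ζ α₂ - ζ α₁ := by rw [hd, he]; exact hp.norm_smul_direction h hε
  have hζ := sub_midpoint_eq hde
  rw [← hm] at hζ
  obtain ⟨hζ₁, hζ₂⟩ := hζ
  have ho₁ : inner ℝ (deriv ζ α₁) e = (0 : ℝ) := he ▸ hp.inner_deriv_eq_zero h hε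
  have ho₂ : inner ℝ (deriv ζ α₂) e = (0 : ℝ) := he ▸ hp.inner_deriv_right_eq_zero h hε
  have hi₁ : inner ℝ (ζ α₁ - m) e = -(d / 2) := by
    rw [hζ₁, inner_smul_left, hee]; simp
  have hi₂ : inner ℝ (ζ α₂ - m) e = d / 2 := by
    rw [hζ₂, inner_smul_left, hee]; simp
  obtain ⟨β₁, f₁, s₁, hs₁, hs₁', hβ₁0, hf₁0, hf₁', hβ₁, hf₁, hg₁⟩ := hgraph ζ h α₁ e τ m hen hτ ho₁
    (by rw [hζ₁, inner_smul_left, heτ, mul_zero])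
    (by rw [hi₁, abs_neg, abs_of_pos (by linarith)]; linarith)
  obtain ⟨β₂, f₂, s₂, hs₂, hs₂', hβ₂0, hf₂0, hf₂', hβ₂, hf₂, hg₂⟩ := hgraph ζ h α₂ e τ m hen hτ ho₂
    (by rw [hζ₂, inner_smul_left, heτ, mul_zero])
    (by rw [hi₂, abs_of_pos (by linarith)]; linarith)
  rw [hi₁] at hf₁0
  rw [hi₂] at hf₂0
  have hsub : Ioo (-x ^ 4) (x ^ 4) ⊆ Ioo (-(1 / (4 * M ^ 3))) (1 / (4 * M ^ 3)) :=
    Ioo_subset_Ioo (neg_le_neg hδr.le) hδr.le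
  have hL₁ : IsLocalGraph M ζ α₁ e τ m β₁ f₁ :=
    ⟨fun ρ hρ => (hg₁ ρ (abs_lt.1 hρ)).1, fun ρ hρ => (hg₁ ρ (abs_lt.1 hρ)).2.1,
      fun ρ hρ => (hg₁ ρ (abs_lt.1 hρ)).2.2.1, hf₁.1.continuousOn⟩
  have hL₂ : IsLocalGraph M ζ α₂ e τ m β₂ f₂ :=
    ⟨fun ρ hρ => (hg₂ ρ (abs_lt.1 hρ)).1, fun ρ hρ => (hg₂ ρ (abs_lt.1 hρ)).2.1,
      fun ρ hρ => (hg₂ ρ (abs_lt.1 hρ)).2.2.1, hf₂.1.continuousOn⟩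
  have hm₁ : ∀ ρ ∈ Ioo (-x ^ 4) (x ^ 4), |β₁ ρ| < x ^ 2 ∧ |f₁ ρ| < x ^ 2 := fun ρ hρ =>
    hL₁.abs_lt_sq hM1 hε1 hx hxε (by rw [hf₁0, abs_neg, abs_of_pos (by linarith)]; linarith)
      (abs_lt.2 hρ)
  have hm₂ : ∀ ρ ∈ Ioo (-x ^ 4) (x ^ 4), |β₂ ρ| < x ^ 2 ∧ |f₂ ρ| < x ^ 2 := fun ρ hρ =>
    hL₂.abs_lt_sq hM1 hε1 hx hxε (by rw [hf₂0, abs_of_pos (by linarith)]; linarith)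
      (abs_lt.2 hρ)
  have hres : ∀ f, CkNormLE 4 f (Ioo (-(1 / (4 * M ^ 3))) (1 / (4 * M ^ 3))) C →
      CkNormLE 4 f (Ioo (-x ^ 4) (x ^ 4)) (max C (4 * M ^ 2)) := fun f hf =>
    (hf.mono_set isOpen_Ioo isOpen_Ioo hsub).mono_const (le_max_left _ _)
  have hss : s₁ * s₂ = -1 :=
    sign_mul_eq_neg_one hen hτ ho₁ (hp.inner_deriv_neg h hs hε hO) hs₁ hs₂ hs₁' hs₂'
  refine ⟨f₁, f₂, β₁, β₂, fun ρ hρ => abs_lt.1 (hm₁ ρ hρ).2, fun ρ hρ => abs_lt.1 (hm₂ ρ hρ).2,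
    fun ρ hρ => abs_lt.1 (hm₁ ρ hρ).1, fun ρ hρ => abs_lt.1 (hm₂ ρ hρ).1, fun ρ hρ =>
    ⟨(hg₁ ρ (hsub hρ)).2.1.symm, (hg₂ ρ (hsub hρ)).2.1.symm⟩, hf₁0, hf₂0, hβ₁0, hβ₂0, hf₁', hf₂',
    hres _ hf₁, hres _ hf₂, hres _ hβ₁, hres _ hβ₂, fun ρ hρ => ?_, fun ρ hρ y hy => ?_,
    fun ρ hρ y hy => ?_, fun ρ hρ y hy => ?_⟩
  · obtain ⟨-, -, -, hd₁, hl₁⟩ := hg₁ ρ (hsub hρ)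
    obtain ⟨-, -, -, hd₂, hl₂⟩ := hg₂ ρ (hsub hρ)
    have hprod := inv_mul_inv_mem_Icc hM hss hl₁ hl₂ (h.mul_inner_deriv_le hτn hs₁ _)
      (h.mul_inner_deriv_le hτn hs₂ _)
    rw [← hd₁, ← hd₂] at hprod
    refine ⟨(inv_anti₀ (by positivity) (le_max_right _ _)).trans hprod.1,
      hprod.2.trans (le_max_right _ _), ?_⟩
    subst he hd
    exact hp.le_gap h hε hεM hL₁ hL₂ hf₁0 hf₂0 hδM hδε (abs_lt.2 hρ)
  -- A point above the upper graph is `ζ (α₂ + β₂ ρ)` moved along `e` by less than `2 * x ^ 2 < x`,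
  -- so it lies in the outer strip. The lower graph is symmetric.
  · have h1 := hp.outer_strip_right h hs hε hεM hdle hdlt hlong hx.le hxleε hxc
      (β := α₂ + β₂ ρ) (ρ := y - f₂ ρ) (by
        rw [add_sub_cancel_left]; linarith [(hm₂ ρ hρ).1])
      ⟨by linarith [hy.1], by linarith [hy.2, (abs_lt.1 (hm₂ ρ hρ).2).1]⟩
    rw [(hg₂ ρ (hsub hρ)).2.1, ← he] at h1
    convert h1 using 1
    module
  · have h1 := hp.outer_strip h hs hε hεM hdle hdlt hlong hx.le hxleε hxc
      (β := α₁ + β₁ ρ) (ρ := f₁ ρ - y) (by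
        rw [add_sub_cancel_left]; linarith [(hm₁ ρ hρ).1])
      ⟨by linarith [hy.2], by linarith [hy.1, (abs_lt.1 (hm₁ ρ hρ).2).2]⟩
    rw [(hg₁ ρ (hsub hρ)).2.1, ← he] at h1
    convert h1 using 1
    module
  · subst he hd
    exact hp.mem_right_between h hs hε hεM hO hτ hm hL₁ hL₂ hf₁0 hf₂0 hδM hδε hd1 (abs_lt.2 hρ) hy

end IsMinimalPair

/-! ### Comparison with the chord-arc constant and conclusion. -/

/-- Distances at scale `ε` are controlled by a small chord-arc constant. -/
theorem TwoFluid.norm_le_chordArcInf {S : TwoFluid} {M ε t α₁ α₂ : ℝ}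
    (h : IsRegularCurve M fun α => S.z α t) (hε : 0 < ε) (hεM : ε ≤ 1 / (16 * M ^ 2))
    (hp : IsMinimalPair (fun α => S.z α t) ε α₁ α₂)
    (hsmall : chordArcInf S.z t < ε / (8 * M ^ 2)) :
    ‖S.z α₂ t - S.z α₁ t‖ ≤ 4 * M * chordArcInf S.z t := by
  have hM := h.pos
  by_contra! hc
  -- The infimum need not be attained, so a threshold `η` strictly above it is used, small enough
  -- that a pair below it would beat the minimal pair.
  have hη : chordArcInf S.z t < min (‖S.z α₂ t - S.z α₁ t‖ / (4 * M)) (ε / (8 * M ^ 2)) :=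
    lt_min (by rw [lt_div_iff₀ (by positivity)]; linarith) hsmall
  obtain ⟨a, b, hab, hlt⟩ := exists_of_chordArcInf_lt h hε hεM hη (min_le_right _ _)
  have h1 := hp.le a b ⟨by linarith [hab.1], by linarith [hab.2, inv_pos.2 hε]⟩
  have h2 : 4 * M * min (‖S.z α₂ t - S.z α₁ t‖ / (4 * M)) (ε / (8 * M ^ 2))
      ≤ 4 * M * (‖S.z α₂ t - S.z α₁ t‖ / (4 * M)) := by
    gcongr; exact min_le_left _ _
  rw [mul_div_cancel₀ _ (by positivity)] at h2
  simp only [norm_sub_rev (S.z α₁ t)] at h1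
  linarith

theorem proposition2p5 (A : ℝ) (hA : 0 < A) :
    ∃ ε₁max : ℝ, 0 < ε₁max ∧ ∀ ε₁ : ℝ, 0 < ε₁ → ε₁ ≤ ε₁max →
    ∃ C : ℝ, 0 < C ∧ ∀ ε₂ : ℝ, 0 < ε₂ → ∀ T : ℝ, 0 < T →
    ∃ ε₄ ε₅ : ℝ, ε₄ ∈ Ioo 0 ε₂ ∧ ε₅ ∈ Ioo 0 ε₂ ∧ ε₄ ≤ ε₅ ^ 100 ∧
    ∀ (ρ₁ ρ₂ σ g : ℝ) (S : TwoFluid), 0 < ρ₁ → 0 < ρ₂ → 0 ≤ σ → 0 ≤ g →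
      S.IsSolution ρ₁ ρ₂ σ g T → S.IsBoundedBy A T →
    ∀ t ∈ Icc 0 T, chordArcInf S.z t ≤ ε₄ →
      (∃ α₁ α₂ : ℝ, IsConjugatePair S.z ε₁ t α₁ α₂) ∧
      ∀ α₁ α₂ : ℝ, IsConjugatePair S.z ε₁ t α₁ α₂ →
      ∀ (d : ℝ) (e : Plane), d = ‖S.z α₂ t - S.z α₁ t‖ → e = d⁻¹ • (S.z α₂ t - S.z α₁ t) →
        -- part (i)
        (openSegment ℝ (S.z α₁ t) (S.z α₂ t) ⊆ S.Ω₂ t ∧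
          inner ℝ (zα S.z α₁ t) e = 0 ∧ inner ℝ (zα S.z α₂ t) e = 0 ∧
          inner ℝ (zα S.z α₁ t) (zα S.z α₂ t) < 0 ∧
          0 < d ∧ C⁻¹ * chordArcInf S.z t ≤ d ∧ d ≤ C * chordArcInf S.z t ∧
          (∀ β ρ : ℝ, |β - α₁| ≤ ε₅ → ρ ∈ Ioo 0 ε₅ → S.z β t - ρ • e ∈ S.Ω₁ t) ∧
          (∀ β ρ : ℝ, |β - α₂| ≤ ε₅ → ρ ∈ Ioo 0 ε₅ → S.z β t + ρ • e ∈ S.Ω₁ t) ∧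
          (∀ β ρ : ℝ, |β - α₁| ≤ ε₅ → ρ ∈ Ioo 0 d → S.z β t + ρ • e ∈ S.Ω₂ t) ∧
          (∀ β ρ : ℝ, |β - α₂| ≤ ε₅ → ρ ∈ Ioo 0 d → S.z β t - ρ • e ∈ S.Ω₂ t)) ∧
        -- part (ii)
        ∀ R : Plane ≃ᵃⁱ[ℝ] Plane,
          R !₂[0, 0] = midpoint ℝ (S.z α₁ t) (S.z α₂ t) →
          R !₂[0, -(d / 2)] = S.z α₁ t → R !₂[0, d / 2] = S.z α₂ t →
          ∃ f₁ f₂ β₁ β₂ : ℝ → ℝ,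
            MapsTo f₁ (Ioo (-ε₅ ^ 4) (ε₅ ^ 4)) (Ioo (-ε₅ ^ 2) (ε₅ ^ 2)) ∧
            MapsTo f₂ (Ioo (-ε₅ ^ 4) (ε₅ ^ 4)) (Ioo (-ε₅ ^ 2) (ε₅ ^ 2)) ∧
            MapsTo β₁ (Ioo (-ε₅ ^ 4) (ε₅ ^ 4)) (Ioo (-ε₅ ^ 2) (ε₅ ^ 2)) ∧
            MapsTo β₂ (Ioo (-ε₅ ^ 4) (ε₅ ^ 4)) (Ioo (-ε₅ ^ 2) (ε₅ ^ 2)) ∧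
            (∀ ρ ∈ Ioo (-ε₅ ^ 4) (ε₅ ^ 4),
              R !₂[ρ, f₁ ρ] = S.z (α₁ + β₁ ρ) t ∧ R !₂[ρ, f₂ ρ] = S.z (α₂ + β₂ ρ) t) ∧
            f₁ 0 = -(d / 2) ∧ f₂ 0 = d / 2 ∧ β₁ 0 = 0 ∧ β₂ 0 = 0 ∧
            deriv f₁ 0 = 0 ∧ deriv f₂ 0 = 0 ∧
            CkNormLE 4 f₁ (Ioo (-ε₅ ^ 4) (ε₅ ^ 4)) C ∧ CkNormLE 4 f₂ (Ioo (-ε₅ ^ 4) (ε₅ ^ 4)) C ∧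
            CkNormLE 4 β₁ (Ioo (-ε₅ ^ 4) (ε₅ ^ 4)) C ∧ CkNormLE 4 β₂ (Ioo (-ε₅ ^ 4) (ε₅ ^ 4)) C ∧
            (∀ ρ ∈ Ioo (-ε₅ ^ 4) (ε₅ ^ 4),
              C⁻¹ ≤ -(deriv β₁ ρ * deriv β₂ ρ) ∧ -(deriv β₁ ρ * deriv β₂ ρ) ≤ C ∧
              d ≤ f₂ ρ - f₁ ρ) ∧
            (∀ ρ ∈ Ioo (-ε₅ ^ 4) (ε₅ ^ 4), ∀ y ∈ Ioo (f₂ ρ) (ε₅ ^ 2), R !₂[ρ, y] ∈ S.Ω₁ t) ∧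
            (∀ ρ ∈ Ioo (-ε₅ ^ 4) (ε₅ ^ 4), ∀ y ∈ Ioo (-ε₅ ^ 2) (f₁ ρ), R !₂[ρ, y] ∈ S.Ω₁ t) ∧
            (∀ ρ ∈ Ioo (-ε₅ ^ 4) (ε₅ ^ 4), ∀ y ∈ Ioo (f₁ ρ) (f₂ ρ), R !₂[ρ, y] ∈ S.Ω₂ t) := by
  have hM : 0 < A + 1 := by linarith
  have hM1 : 1 ≤ A + 1 := by linarith
  obtain ⟨C₀, hC₀, hgraphs⟩ := IsMinimalPair.exists_local_graphs (A + 1) hM1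
  refine ⟨1 / (16 * (A + 1) ^ 2), by positivity, fun ε hε hεM => ?_⟩
  have hC₀C : C₀ ≤ max (max C₀ (4 * (A + 1))) (1 / (2 * ε)) :=
    (le_max_left _ _).trans (le_max_left _ _)
  have hMC : 4 * (A + 1) ≤ max (max C₀ (4 * (A + 1))) (1 / (2 * ε)) :=
    (le_max_right _ _).trans (le_max_left _ _)
  have hεC : 1 / (2 * ε) ≤ max (max C₀ (4 * (A + 1))) (1 / (2 * ε)) := le_max_right _ _
  -- The three entries serve the graph bounds, the upper bound of `d`, and the lower bound of `d`
  -- (from `C⁻¹ ≤ 2 * ε ≤ |α₁ - α₂|`).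
  set C := max (max C₀ (4 * (A + 1))) (1 / (2 * ε)) with hCdef
  have hC : 0 < C := by linarith
  refine ⟨C, hC, fun ε₂ hε₂ T hT => ?_⟩
  set c := min (ε / (2 * (A + 1))) (A⁻¹ * ε) * Real.exp (-((A ^ 2 + 1) * T)) with hcdef
  have hc : 0 < c := mul_pos (lt_min (by positivity) (by positivity)) (Real.exp_pos _)
  -- This is `ε₅`. Only the condition `x ≤ c` involves `T`, through the exponential contraction of
  -- chords.
  obtain ⟨x, hx, hxε, hxc, hxε₂⟩ : ∃ x : ℝ, 0 < x ∧ x ≤ ε / (16 * (A + 1)) ∧ x ≤ c ∧ x < ε₂ :=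
    ⟨min (ε / (16 * (A + 1))) (min c (ε₂ / 2)), lt_min (by positivity) (lt_min hc (by linarith)),
      min_le_left _ _, (min_le_right _ _).trans (min_le_left _ _),
      ((min_le_right _ _).trans (min_le_right _ _)).trans_lt (by linarith)⟩
  have hε1 : ε ≤ 1 := by
    refine hεM.trans ?_
    rw [div_le_one (by positivity)]
    nlinarith
  have hxM : x * (16 * (A + 1)) ≤ ε := by rwa [le_div_iff₀ (by positivity)] at hxε
  have hxM16 : x * (A + 1) ≤ 1 / 16 := by linarith
  have hx1 : x ≤ 1 / 16 := by nlinarith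
  have hxleε : x ≤ ε := by nlinarith
  have hpow : ∀ n : ℕ, 1 ≤ n → x ^ n ≤ x := fun n hn => by
    simpa using pow_le_pow_of_le_one hx.le (by linarith : x ≤ 1) hn
  -- The choice `ε₄ = ε₅ ^ 100` makes the required inequality an equality, and far exceeds what is
  -- needed: a chord of length at most `4 * (A + 1) * x ^ 100` is below `x ^ 5`.
  refine ⟨x ^ 100, x, ⟨by positivity, (hpow 100 (by norm_num)).trans_lt hxε₂⟩, ⟨hx, hxε₂⟩, le_rfl, ?_⟩
  intro ρ₁ ρ₂ σ g S _ _ _ _ hS hb t ht hinf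
  have h := TwoFluid.isRegularCurve hS hb hA hT ht
  have hs := TwoFluid.isSplitting hS ht
  have hlong := TwoFluid.hasLongChords hS hb hA hT hε hεM ht
  rw [← hcdef] at hlong
  have hx100 : x ^ 100 < ε / (8 * (A + 1) ^ 2) := by
    rw [lt_div_iff₀ (by positivity)]
    calc x ^ 100 * (8 * (A + 1) ^ 2) ≤ x ^ 2 * (8 * (A + 1) ^ 2) := by
          gcongr ?_ * _
          exact pow_le_pow_of_le_one hx.le (by linarith) (by norm_num)
      _ = x * (16 * (A + 1)) * (x * (A + 1)) / 2 := by ring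
      _ ≤ ε * (1 / 16) / 2 := by gcongr
      _ < ε := by linarith
  refine ⟨?_, ?_⟩
  · obtain ⟨a, b, hab, hlt⟩ := TwoFluid.exists_of_chordArcInf_lt h hε hεM
      (hinf.trans_lt hx100) le_rfl
    obtain ⟨α₁, α₂, hp⟩ := h.exists_isMinimalPair hε hεM
      (a := a) (b := b) ⟨by linarith [hab.1], by linarith [hab.2, inv_pos.2 hε]⟩ (hlt.trans_eq (by
        field_simp; ring))
    exact ⟨α₁, α₂, (TwoFluid.isConjugatePair_iff hε).2 hp⟩
  intro α₁ α₂ hconj d e hd he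
  have hp := (TwoFluid.isConjugatePair_iff hε).1 hconj
  have hdinf : d ≤ 4 * (A + 1) * chordArcInf S.z t :=
    hd ▸ TwoFluid.norm_le_chordArcInf h hε hεM hp (hinf.trans_lt hx100)
  have hd0 : 0 < d := hd ▸ hp.norm_pos h hε
  have hinf0 : 0 < chordArcInf S.z t := by
    by_contra! hneg
    nlinarith
  have hdx : d ≤ x ^ 5 := by
    calc d ≤ 4 * (A + 1) * x ^ 100 := hdinf.trans (by gcongr)
      _ = 4 * (x * (A + 1)) * x ^ 99 := by ring
      _ ≤ 1 * x ^ 99 := by gcongr; linarith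
      _ ≤ x ^ 5 := by
        rw [one_mul]
        exact pow_le_pow_of_le_one hx.le (by linarith) (by norm_num)
  have hdx' : d < x := by
    have : x ^ 5 ≤ x ^ 2 := pow_le_pow_of_le_one hx.le (by linarith) (by norm_num)
    nlinarith
  have hdle : ‖S.z α₁ t - S.z α₂ t‖ ≤ 1 := by rw [norm_sub_rev, ← hd]; linarith
  have hdlt : ‖S.z α₁ t - S.z α₂ t‖ < c := by rw [norm_sub_rev, ← hd]; linarith
  have hO := hp.openSegment_subset h hs hε hεM hdle hdlt hlong
  have hedir : e = direction (fun α => S.z α t) α₁ α₂ := by rw [he, hd]; rfl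
  refine ⟨⟨hO, ?_, ?_, hp.inner_deriv_neg h hs hε hO, hd0, ?_, ?_, fun β ρ hβ hρ => ?_,
    fun β ρ hβ hρ => ?_, fun β ρ hβ hρ => ?_, fun β ρ hβ hρ => ?_⟩, fun R hR0 _ hR2 => ?_⟩
  · rw [hedir]; exact hp.inner_deriv_eq_zero h hε
  · rw [hedir]; exact hp.inner_deriv_right_eq_zero h hε
  · have h1 := TwoFluid.chordArcInf_mul_le (S := S) (t := t) α₁ α₂
    rw [norm_sub_rev, ← hd] at h1
    have h2 : C⁻¹ ≤ |α₁ - α₂| := by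
      refine le_trans ?_ hp.scale.1
      rw [inv_le_comm₀ hC (by positivity), ← one_div]
      exact hεC
    calc C⁻¹ * chordArcInf S.z t ≤ |α₁ - α₂| * chordArcInf S.z t := by gcongr
      _ ≤ d := by rwa [mul_comm]
  · exact hdinf.trans (by gcongr)
  · rw [hedir]; exact hp.outer_strip h hs hε hεM hdle hdlt hlong hx.le hxleε hxc hβ hρ
  · rw [hedir]; exact hp.outer_strip_right h hs hε hεM hdle hdlt hlong hx.le hxleε hxc hβ hρ
  · rw [hedir]; exact hp.inner_strip h hs hε hεM hdle hO hxleε hx.le hβ (hd ▸ hρ)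
  · rw [hedir]; exact hp.inner_strip_right h hs hε hεM hdle hO hxleε hx.le hβ (hd ▸ hρ)
  have hR2' : R !₂[0, d / 2] = midpoint ℝ (S.z α₁ t) (S.z α₂ t) + (d / 2) • e := by
    have hde : d • e = S.z α₂ t - S.z α₁ t := by
      rw [he, smul_smul, mul_inv_cancel₀ hd0.ne', one_smul]
    rw [hR2, show (d / 2) • e = (1 / 2 : ℝ) • (d • e) by module, hde, midpoint_eq_smul_add,
      invOf_eq_inv]
    module
  obtain ⟨-, τ, hτ, hR⟩ := AffineIsometryEquiv.exists_frame R (by positivity : d / 2 ≠ 0) hR0 hR2'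
  obtain ⟨f₁, f₂, β₁, β₂, h1, h2, h3, h4, h5, h6, h7, h8, h9, h10, h11, h12, h13, h14, h15, h16,
    h17, h18, h19⟩ := hgraphs _ _ _ ε c x α₁ α₂ h hs hlong hε hεM hp hx hxε hxc d hd hdx e hedir τ hτ
      _ rfl
  simp only [hR]
  refine ⟨f₁, f₂, β₁, β₂, h1, h2, h3, h4, h5, h6, h7, h8, h9, h10, h11, h12.mono_const hC₀C,
    h13.mono_const hC₀C, h14.mono_const hC₀C, h15.mono_const hC₀C, fun ρ hρ => ?_, h17, h18, h19⟩
  obtain ⟨h20, h21, h22⟩ := h16 ρ hρ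
  exact ⟨(inv_anti₀ (by linarith) hC₀C).trans h20, h21.trans hC₀C, h22⟩
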